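/- For $a,b>0$ let the Hardy class $E(a,b)$ be the set of Schwartz functions $f:\mathbb{R}\to\mathbb{C}$ with \[ \sup_{x\in\mathbb{R}}|f(x)|e^{a\pi x^2}+\sup_{\xi\in\mathbb{R}}|\hat f(\xi)|e^{b\pi \xi^2}<\infty,\qquad \hat f(\xi)=\int_{\mathbb{R}}f(x)e^{-2\pi i x\xi}\,dx . \] Fix $0<A<1$ and put $\mathfrak{c}_1(A)=\frac{2}{A}$ if $A<\frac{1}{\sqrt2}$ and $\mathfrak{c}_1(A)=4\sqrt{1-A^2}$ if $\frac1{\sqrt2}\le A<1$. Below, $\Lambda\subset\mathbb{R}$ is a discrete set, unbounded above and below, written in increasing order as $\Lambda=\{\lambda_j\}_{j\in\mathbb{Z}}$ with $\lambda_j<\lambda_{j+1}$ for all $j$. (i) Let $f,g\in E(A,A)$ and suppose that \[ \limsup_{j\to\pm\infty}|\lambda_j|(\lambda_{j+1}-\lambda_j)<\frac{1}{\mathfrak{c}_1(A)} . \] If $|f(\lambda)|=|g(\lambda)|$ for all $\lambda\in\Lambda$, then $|f(x)|=|g(x)|$ for all $x\in\mathbb{R}$. (ii) Conversely, if \[ \liminf_{j\to\pm\infty}|\lambda_j|(\lambda_{j+1}-\lambda_j)>\frac{1}{\mathfrak{c}_1(A)}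 \] (the value $+\infty$ being allowed), then there exist $f,g\in E(A,A)$ such that $|f(\lambda)|=|g(\lambda)|$ for all $\lambda\in\Lambda$, but $|f(x)|\ne|g(x)|$ for some $x\in\mathbb{R}$. Here $\limsup_{j\to\pm\infty}$ (resp. $\liminf_{j\to\pm\infty}$) is the larger of the two upper limits (resp. the smaller of the two lower limits) at $j\to+\infty$ and $j\to-\infty$. -/

import Mathlib

open Filter
open scoped FourierTransform SchwartzMap

/-- The Hardy class `E(a,b)`: Schwartz functions `f` on the real line with
`sup_x |f(x)| e^{aπx²} + sup_ξ |f̂(ξ)| e^{bπξ²} < ∞`, where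
`f̂(ξ) = ∫ f(x) e^{-2πixξ} dx` (the normalization of Mathlib's `𝓕`). -/
def HardyClass (a b : ℝ) : Set 𝓢(ℝ, ℂ) :=
  {f | BddAbove (Set.range fun x : ℝ => ‖f x‖ * Real.exp (a * Real.pi * |x| ^ 2)) ∧
    BddAbove (Set.range fun ξ : ℝ => ‖𝓕 (f : ℝ → ℂ) ξ‖ * Real.exp (b * Real.pi * |ξ| ^ 2))}

/-- The threshold constant: `2/A` for `A < 1/√2` and `4√(1-A²)` for `1/√2 ≤ A`. -/
noncomputable def pauliConst (A : ℝ) : ℝ :=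
  if A < 1 / √2 then 2 / A else 4 * √(1 - A ^ 2)

/-- `l` is the increasing two-sided enumeration of the set `Λ` of reals, which is unbounded in both
directions. Such a `Λ` has finitely many points in each bounded interval, and every discrete
(locally finite) set that is unbounded in both directions has such an enumeration, unique up to a
shift of the index. -/
structure IsOrderedEnumeration (Λ : Set ℝ) (l : ℤ → ℝ) : Prop where
  strictMono : StrictMono l
  range_eq : Set.range l = Λ
  not_bddAbove : ¬ BddAbove Λ
  not_bddBelow : ¬ BddBelow Λ

/-- `limsup_{j → ±∞} |l_j| (l_{j+1} - l_j)`, in the extended reals. -/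
noncomputable def limsupSpacing (l : ℤ → ℝ) : EReal :=
  limsup (fun j : ℤ => ((|l j| * (l (j + 1) - l j) : ℝ) : EReal)) (atBot ⊔ atTop)

/-- `liminf_{j → ±∞} |l_j| (l_{j+1} - l_j)`, in the extended reals. -/
noncomputable def liminfSpacing (l : ℤ → ℝ) : EReal :=
  liminf (fun j : ℤ => ((|l j| * (l (j + 1) - l j) : ℝ) : EReal)) (atBot ⊔ atTop)

/-! Uniqueness. The functions `f` and `g` extend to entire functions of size `O(e^{π y²/A})`, so
`|f|² - |g|²` extends to an entire `F` with `F(x) = O(e^{-2πA x²})` on the line and `F(z) = O(e^{2π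
y²/A})` everywhere. Since `λ_{j+1}² - λ_j² ≈ 2 λ_j (λ_{j+1} - λ_j)`, the gap condition yields some
`D < 2/c₁(A)` such that every far cell `[(k+1)D, (k+2)D)` contains the square of a positive zero of
`F`.

After scaling by `√D`, divide `F` by a canonical product having these zeros. Interlacing with the
zeros of `sin πz²` makes the product as large as `|sin πz²|` up to powers of `|z|` and `|y|`
(`canonProd_upper`, `canonProd_lower`). On the rays `arg z = ±θ` the division therefore gains `e^{-π
r² sin 2θ}`, while the decay on the axis survives up to an arbitrarily small loss. If `D (2π/A sin²θ
+ 2πA cos 2θ) < π sin 2θ`, then a Gaussian factor makes the quotient bounded on the axis and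
decaying on both rays. Phragmén–Lindelöf in thin sectors bounds it by `M e^{-m x²}` for every `m`,
with `M` independent of `m`, so it vanishes (`eq_zero_of_gaussian_decay_of_zeros`). The best `θ ≥
π/4` gives the two branches of `c₁` (`exists_angle`).

Sharpness. Split `Λ` by the parity of the index. Squares within one class are separated by some `D >
4/c₁(A)`, so there are real entire functions `P`, `Q` vanishing on the two classes, of size
`e^{2(π/D)|xy|}` up to `e^{ε|z|²}` (`exists_entire_vanishing`). Put `f = w(P + Q)` and `g = w(P -
Q)` with `w = e^{-a z²}`. On the line `|f|² - |g|² = 4 w² P Q`, which is zero on `Λ` but not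
identically. Membership in the Hardy class reduces to `a > πA` and `(π/D)² < a (π/A - a)`;
maximising the right side over `a ≥ πA` gives the same threshold (`exists_gaussian_weight`,
`exists_hardyClass_of_entire`). -/

/-! ### Canonical products with interlacing zeros -/

/-- The reciprocals of the zeros of the comparison lattice. -/
noncomputable def recipSqrt (k : ℕ) : ℝ := 1 / √(k + 1)

/-- The sequence `t` interlaces with the reciprocals of the square roots. -/
def Interlaced (t : ℕ → ℝ) : Prop := ∀ k, recipSqrt (k + 1) ≤ t k ∧ t k ≤ recipSqrt k

lemma recipSqrt_pos (k : ℕ) : 0 < recipSqrt k := by unfold recipSqrt; positivity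

lemma recipSqrt_le_one (k : ℕ) : recipSqrt k ≤ 1 := by
  unfold recipSqrt
  rw [div_le_one (by positivity)]
  exact Real.one_le_sqrt.2 (by linarith [k.cast_nonneg (α := ℝ)])

lemma recipSqrt_sq (k : ℕ) : recipSqrt k ^ 2 = 1 / ((k : ℝ) + 1) := by
  unfold recipSqrt
  rw [div_pow, Real.sq_sqrt (by positivity), one_pow]

lemma recipSqrt_antitone : Antitone recipSqrt := by
  intro j k h
  unfold recipSqrt
  gcongr

lemma summable_recipSqrt_sub : Summable fun k => recipSqrt k - recipSqrt (k + 1) := by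
  refine summable_of_sum_range_le (c := 1)
    (fun k => sub_nonneg.2 (recipSqrt_antitone k.le_succ)) fun n => ?_
  rw [Finset.sum_range_sub']
  linarith [recipSqrt_le_one 0, recipSqrt_pos n]

lemma Interlaced.pos {t : ℕ → ℝ} (ht : Interlaced t) (k : ℕ) : 0 < t k :=
  (recipSqrt_pos _).trans_le (ht k).1

lemma Interlaced.recipSqrt : Interlaced recipSqrt :=
  fun k => ⟨recipSqrt_antitone k.le_succ, le_rfl⟩

/-- A factor of the canonical product, minus one. -/
noncomputable def canonTerm (t s : ℕ → ℝ) (k : ℕ) (z : ℂ) : ℂ :=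
  (1 - z * t k) * (1 + z * s k) * (1 + z ^ 2 * (recipSqrt k : ℂ) ^ 2) - 1

/-- The canonical product with zeros at the points `1 / t k`, `-1 / s k` and `± i √(k + 1)`. -/
noncomputable def canonProd (t s : ℕ → ℝ) (z : ℂ) : ℂ := ∏' k, (1 + canonTerm t s k z)

lemma one_add_canonTerm (t s : ℕ → ℝ) (k : ℕ) (z : ℂ) :
    1 + canonTerm t s k z =
      (1 - z * t k) * (1 + z * s k) * (1 + z ^ 2 * (recipSqrt k : ℂ) ^ 2) := by
  unfold canonTerm; ring

/-- A summable majorant of the terms of the canonical product. -/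
noncomputable def canonMajorant (k : ℕ) : ℝ :=
  4 * (recipSqrt k - recipSqrt (k + 1)) + 1 / ((k : ℝ) + 1) ^ 2

lemma summable_canonMajorant : Summable canonMajorant := by
  refine (summable_recipSqrt_sub.mul_left 4).add ?_
  have := (summable_nat_add_iff 1).2 (Real.summable_one_div_nat_pow.2 (one_lt_two))
  simpa using this

/-- The reciprocals of the zeros are not summable, so a positive and a negative zero must be paired.
In the expanded factor the coefficients of `z`, `z²`, `z³` are then bounded by multiples of `T_k -
T_{k+1}`, which telescopes, and that of `z⁴` by `1/(k+1)²`. -/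
lemma norm_canonTerm_le {t s : ℕ → ℝ} (ht : Interlaced t) (hs : Interlaced s) (k : ℕ) (z : ℂ) :
    ‖canonTerm t s k z‖ ≤ (1 + ‖z‖) ^ 4 * canonMajorant k := by
  set T := recipSqrt k
  set T' := recipSqrt (k + 1)
  have hT : 0 < T := recipSqrt_pos k
  have hT' : 0 < T' := recipSqrt_pos _
  have h1 : T ≤ 1 := recipSqrt_le_one k
  have hle : T' ≤ T := recipSqrt_antitone k.le_succ
  obtain ⟨ht1, ht2⟩ := ht k
  obtain ⟨hs1, hs2⟩ := hs k
  have e : canonTerm t s k z = z * ((s k - t k : ℝ) : ℂ) + z ^ 2 * ((T ^ 2 - t k * s k : ℝ) : ℂ)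
      + z ^ 3 * ((T ^ 2 * (s k - t k) : ℝ) : ℂ) + z ^ 4 * ((-(t k * s k * T ^ 2) : ℝ) : ℂ) := by
    unfold canonTerm; push_cast; ring
  have b1 : |s k - t k| ≤ T - T' := abs_le.2 ⟨by linarith, by linarith⟩
  have b2 : |T ^ 2 - t k * s k| ≤ 2 * (T - T') := by
    have u : t k * s k ≤ T * T := by gcongr; exact hs.pos k |>.le
    have l : T' * T' ≤ t k * s k := by gcongr; exact ht.pos k |>.le
    exact abs_le.2 ⟨by nlinarith, by nlinarith⟩
  have b3 : |T| ^ 2 * |s k - t k| ≤ T - T' := by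
    rw [abs_of_pos hT]
    calc T ^ 2 * |s k - t k| ≤ 1 * (T - T') := by gcongr; nlinarith
      _ = _ := one_mul _
  have b4 : |-(t k * s k * T ^ 2)| ≤ 1 / ((k : ℝ) + 1) ^ 2 := by
    have hp := ht.pos k
    have hq := hs.pos k
    rw [abs_neg, abs_of_nonneg (by positivity)]
    calc t k * s k * T ^ 2 ≤ T * T * T ^ 2 := by gcongr
      _ = (T ^ 2) ^ 2 := by ring
      _ = _ := by rw [recipSqrt_sq]; simp
  have hz := norm_nonneg z
  have hd : 0 ≤ T - T' := by linarith
  have c1 : ‖z‖ ≤ (1 + ‖z‖) ^ 4 := by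
    calc ‖z‖ ≤ (1 + ‖z‖) ^ 1 := by linarith
      _ ≤ _ := pow_le_pow_right₀ (by linarith) (by norm_num)
  have c2 : ‖z‖ ^ 2 ≤ (1 + ‖z‖) ^ 4 := by
    calc ‖z‖ ^ 2 ≤ (1 + ‖z‖) ^ 2 := by gcongr; linarith
      _ ≤ _ := pow_le_pow_right₀ (by linarith) (by norm_num)
  have c3 : ‖z‖ ^ 3 ≤ (1 + ‖z‖) ^ 4 := by
    calc ‖z‖ ^ 3 ≤ (1 + ‖z‖) ^ 3 := by gcongr; linarith
      _ ≤ _ := pow_le_pow_right₀ (by linarith) (by norm_num)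
  have c4 : ‖z‖ ^ 4 ≤ (1 + ‖z‖) ^ 4 := by gcongr; linarith
  rw [e]
  refine (norm_add₄_le).trans ?_
  simp only [norm_mul, norm_pow, Complex.norm_real, Real.norm_eq_abs]
  have : (1 + ‖z‖) ^ 4 * canonMajorant k = (1 + ‖z‖) ^ 4 * (T - T')
      + (1 + ‖z‖) ^ 4 * (2 * (T - T')) + (1 + ‖z‖) ^ 4 * (T - T')
      + (1 + ‖z‖) ^ 4 * (1 / ((k : ℝ) + 1) ^ 2) := by
    unfold canonMajorant; ring
  rw [this]
  gcongr

lemma summable_canonTerm {t s : ℕ → ℝ} (ht : Interlaced t) (hs : Interlaced s) (z : ℂ) :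
    Summable fun k => ‖canonTerm t s k z‖ :=
  (summable_canonMajorant.mul_left _).of_nonneg_of_le (fun _ => norm_nonneg _)
    fun k => norm_canonTerm_le ht hs k z

/-- An infinite product of entire functions with locally uniformly summable terms is entire. -/
lemma differentiable_tprod_one_add {f : ℕ → ℂ → ℂ} {u : ℕ → ℝ} {w : ℝ → ℝ} (hw : Monotone w)
    (hu : Summable u) (hu0 : ∀ k, 0 ≤ u k) (hf : ∀ k, Differentiable ℂ (f k))
    (h : ∀ k z, ‖f k z‖ ≤ w ‖z‖ * u k) : Differentiable ℂ fun z => ∏' k, (1 + f k z) := by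
  intro z
  have hb : IsOpen (Metric.ball (0 : ℂ) (‖z‖ + 1)) := Metric.isOpen_ball
  have := Summable.hasProdLocallyUniformlyOn_one_add (f := f) (u := fun k => w (‖z‖ + 1) * u k) hb
    (hu.mul_left _) (.of_forall fun k x hx => (h k x).trans (by
      gcongr
      · exact hu0 k
      · exact hw (by simpa using (Metric.mem_ball.1 hx).le)))
    (fun k => (hf k).continuous.continuousOn)
  have h2 := this.differentiableOn (.of_forall fun _ => by
    simpa [Finset.prod_fn] using
      DifferentiableOn.finsetProd (fun k _ => ((hf k).const_add 1).differentiableOn)) hb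
  exact h2.differentiableAt (hb.mem_nhds (by simp))

lemma differentiable_canonTerm (t s : ℕ → ℝ) (k : ℕ) : Differentiable ℂ (canonTerm t s k) := by
  unfold canonTerm; fun_prop

lemma canonMajorant_nonneg (k : ℕ) : 0 ≤ canonMajorant k := by
  have := recipSqrt_antitone k.le_succ
  simp only [Nat.succ_eq_add_one] at this
  unfold canonMajorant
  have : 0 ≤ recipSqrt k - recipSqrt (k + 1) := by linarith
  positivity

/-- The truncation makes the weight monotone on all of `ℝ`, as `differentiable_tprod_one_add`
demands, and has no effect at a norm. -/
lemma monotone_one_add_max_pow : Monotone fun r : ℝ => (1 + max r 0) ^ 4 := by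
  intro a b h
  have : 0 ≤ max a 0 := le_max_right _ _
  dsimp only
  gcongr

lemma norm_canonTerm_le' {t s : ℕ → ℝ} (ht : Interlaced t) (hs : Interlaced s) (k : ℕ) (z : ℂ) :
    ‖canonTerm t s k z‖ ≤ (1 + max ‖z‖ 0) ^ 4 * canonMajorant k := by
  rw [max_eq_left (norm_nonneg z)]
  exact norm_canonTerm_le ht hs k z

lemma differentiable_canonProd {t s : ℕ → ℝ} (ht : Interlaced t) (hs : Interlaced s) :
    Differentiable ℂ (canonProd t s) :=
  differentiable_tprod_one_add (w := fun r => (1 + max r 0) ^ 4) monotone_one_add_max_pow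
    summable_canonMajorant canonMajorant_nonneg (differentiable_canonTerm t s)
    (norm_canonTerm_le' ht hs)

lemma canonProd_ne_zero {t s : ℕ → ℝ} (ht : Interlaced t) (hs : Interlaced s) {z : ℂ}
    (h : ∀ k, 1 + canonTerm t s k z ≠ 0) : canonProd t s z ≠ 0 :=
  tprod_one_add_ne_zero_of_summable h (summable_canonTerm ht hs z)

lemma tendsto_canonProd {t s : ℕ → ℝ} (ht : Interlaced t) (hs : Interlaced s) (z : ℂ) :
    Tendsto (fun N => ∏ k ∈ Finset.range N, (1 + canonTerm t s k z)) atTop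
      (nhds (canonProd t s z)) :=
  (multipliable_one_add_of_summable (summable_canonTerm ht hs z)).hasProd.tendsto_prod_nat

lemma canonProd_eq_zero_of {t s : ℕ → ℝ} {z : ℂ} (k : ℕ) (h : 1 + canonTerm t s k z = 0) :
    canonProd t s z = 0 :=
  tprod_of_exists_eq_zero ⟨k, h⟩

/-- Zeros of the canonical product at which exactly one factor vanishes simply are simple. -/
lemma deriv_canonProd_ne_zero {t s : ℕ → ℝ} (ht : Interlaced t) (hs : Interlaced s) {z : ℂ} {j : ℕ}
    (hj : 1 + canonTerm t s j z = 0) (hd : deriv (canonTerm t s j) z ≠ 0)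
    (h : ∀ k ≠ j, 1 + canonTerm t s k z ≠ 0) : deriv (canonProd t s) z ≠ 0 := by
  classical
  -- Replacing the `j`-th term by zero deletes that factor; the remaining product is entire and
  -- nonzero at `z`.
  set f : ℕ → ℂ → ℂ := fun k w => if k = j then 0 else canonTerm t s k w
  have hfle : ∀ k w, ‖f k w‖ ≤ ‖canonTerm t s k w‖ := by
    intro k w; simp only [f]; split_ifs <;> simp
  have hR : Differentiable ℂ fun w => ∏' k, (1 + f k w) :=
    differentiable_tprod_one_add (w := fun r => (1 + max r 0) ^ 4) monotone_one_add_max_pow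
      summable_canonMajorant canonMajorant_nonneg
      (fun k => by
        simp only [f]; split_ifs
        · exact differentiable_const _
        · exact differentiable_canonTerm t s k)
      (fun k w => (hfle k w).trans (norm_canonTerm_le' ht hs k w))
  have hfs : ∀ w, Summable fun k => ‖f k w‖ := fun w =>
    (summable_canonTerm ht hs w).of_nonneg_of_le (fun _ => norm_nonneg _) (fun k => hfle k w)
  have hR0 : ∏' k, (1 + f k z) ≠ 0 := by
    refine tprod_one_add_ne_zero_of_summable (fun k => ?_) (hfs z)
    simp only [f]; split_ifs with hk
    · simp
    · exact h k hk
  have heq : canonProd t s = fun w => (1 + canonTerm t s j w) * ∏' k, (1 + f k w) := by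
    funext w
    have hl := (tendsto_canonProd ht hs w)
    have hr := (multipliable_one_add_of_summable (hfs w)).hasProd.tendsto_prod_nat.const_mul
      (1 + canonTerm t s j w)
    refine tendsto_nhds_unique hl (hr.congr' ?_)
    filter_upwards [eventually_gt_atTop j] with N hN
    rw [← Finset.mul_prod_erase _ _ (Finset.mem_range.2 hN),
      ← Finset.mul_prod_erase (Finset.range N) (fun k => 1 + canonTerm t s k w)
        (Finset.mem_range.2 hN)]
    simp only [f, if_true, add_zero, one_mul]
    congr 1
    refine Finset.prod_congr rfl fun k hk => ?_
    rw [if_neg (Finset.ne_of_mem_erase hk)]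
  rw [heq]
  have := (((differentiable_canonTerm t s j z).const_add 1).hasDerivAt.mul (hR z).hasDerivAt).deriv
  simp only [Pi.mul_def] at this
  rw [this, hj, zero_mul, add_zero]
  simpa using ⟨hd, hR0⟩

/-! ### Interlacing and comparison with `sin πz²` -/

/-- Products of a quasi-convex function over interlacing sequences: upper bound. -/
lemma prod_interlaced_le {φ : ℝ → ℝ} {c m : ℝ} (hm : 0 ≤ m) (hφm : ∀ t, m ≤ φ t)
    (hanti : ∀ u v, u ≤ v → v ≤ c → φ v ≤ φ u) (hmono : ∀ u v, c ≤ u → u ≤ v → φ u ≤ φ v)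
    {t : ℕ → ℝ} (ht : Interlaced t) (N : ℕ) :
    (c ≤ recipSqrt N → ∏ k ∈ Finset.range N, φ (t k) ≤ ∏ k ∈ Finset.range N, φ (recipSqrt k)) ∧
      m * ∏ k ∈ Finset.range N, φ (t k) ≤ ∏ k ∈ Finset.range (N + 1), φ (recipSqrt k) := by
  have h0 : ∀ t, 0 ≤ φ t := fun t => hm.trans (hφm t)
  -- While the nodes stay above the minimiser `c`, compare `φ (t k)` with the upper end of its cell;
  -- below `c`, with the lower end. The change from one pairing to the other leaves one factor on
  -- the right unused, and that factor is at least `m`.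
  induction N with
  | zero => simpa using hφm _
  | succ N ih =>
    obtain ⟨h1, h2⟩ := ih
    obtain ⟨hl, hr⟩ := ht N
    have hT := recipSqrt_antitone N.le_succ
    simp only [Nat.succ_eq_add_one] at hT
    have hP : 0 ≤ ∏ k ∈ Finset.range N, φ (t k) := Finset.prod_nonneg fun _ _ => h0 _
    have hQ : 0 ≤ ∏ k ∈ Finset.range N, φ (recipSqrt k) := Finset.prod_nonneg fun _ _ => h0 _
    have hQ' : 0 ≤ ∏ k ∈ Finset.range (N + 1), φ (recipSqrt k) :=
      Finset.prod_nonneg fun _ _ => h0 _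
    rw [Finset.prod_range_succ _ (N + 1), Finset.prod_range_succ (fun k => φ (t k)) N]
    have first : c ≤ recipSqrt (N + 1) →
        (∏ k ∈ Finset.range N, φ (t k)) * φ (t N) ≤
          ∏ k ∈ Finset.range (N + 1), φ (recipSqrt k) := by
      intro hc
      rw [Finset.prod_range_succ]
      exact mul_le_mul (h1 (hc.trans hT)) (hmono _ _ (hc.trans hl) hr) (h0 _) hQ
    refine ⟨first, ?_⟩
    by_cases hc : c ≤ recipSqrt (N + 1)
    · rw [mul_comm]
      exact mul_le_mul (first hc) (hφm _) hm hQ'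
    · push Not at hc
      by_cases hc' : c ≤ recipSqrt N
      · have hmax : φ (t N) ≤ φ (recipSqrt N) ∨ φ (t N) ≤ φ (recipSqrt (N + 1)) := by
          rcases le_total c (t N) with h | h
          · exact Or.inl (hmono _ _ h hr)
          · exact Or.inr (hanti _ _ hl h)
        rcases hmax with h | h
        · have e : (∏ k ∈ Finset.range N, φ (t k)) * φ (t N) ≤
              ∏ k ∈ Finset.range (N + 1), φ (recipSqrt k) := by
            rw [Finset.prod_range_succ]
            exact mul_le_mul (h1 hc') h (h0 _) hQ
          rw [mul_comm]
          exact mul_le_mul e (hφm _) hm hQ'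
        · rw [← mul_assoc]
          exact mul_le_mul h2 h (h0 _) hQ'
      · push Not at hc'
        rw [← mul_assoc]
        exact mul_le_mul h2 (hanti _ _ hl (hr.trans hc'.le)) (h0 _) hQ'

/-- Products of a quasi-convex function over interlacing sequences: lower bound. -/
lemma le_prod_interlaced {φ : ℝ → ℝ} {c m : ℝ} (hm : 0 ≤ m) (hφm : ∀ t, m ≤ φ t)
    (hanti : ∀ u v, u ≤ v → v ≤ c → φ v ≤ φ u) (hmono : ∀ u v, c ≤ u → u ≤ v → φ u ≤ φ v)
    {t : ℕ → ℝ} (ht : Interlaced t) (N : ℕ) :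
    (c ≤ recipSqrt (N + 1) → ∏ k ∈ Finset.range (N + 1), φ (recipSqrt (k + 1)) ≤
        ∏ k ∈ Finset.range (N + 1), φ (t k)) ∧
      m * ∏ k ∈ Finset.range N, φ (recipSqrt (k + 1)) ≤ ∏ k ∈ Finset.range (N + 1), φ (t k) := by
  have h0 : ∀ t, 0 ≤ φ t := fun t => hm.trans (hφm t)
  -- The pairing is reversed: lower ends of the cells above `c`, upper ends below it. Now one factor
  -- `φ (t k)` is left over, and it is at least `m`.
  induction N with
  | zero => simpa using ⟨fun h => hmono _ _ h (ht 0).1, hφm _⟩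
  | succ N ih =>
    obtain ⟨h1, h2⟩ := ih
    obtain ⟨hl, hr⟩ := ht (N + 1)
    have hT := recipSqrt_antitone (N + 1).le_succ
    simp only [Nat.succ_eq_add_one] at hT
    have hP : 0 ≤ ∏ k ∈ Finset.range (N + 1), φ (t k) := Finset.prod_nonneg fun _ _ => h0 _
    have hQ : 0 ≤ ∏ k ∈ Finset.range (N + 1), φ (recipSqrt (k + 1)) :=
      Finset.prod_nonneg fun _ _ => h0 _
    rw [Finset.prod_range_succ (fun k => φ (t k)) (N + 1)]
    have first : c ≤ recipSqrt (N + 1 + 1) →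
        ∏ k ∈ Finset.range (N + 1 + 1), φ (recipSqrt (k + 1)) ≤
          (∏ k ∈ Finset.range (N + 1), φ (t k)) * φ (t (N + 1)) := by
      intro hc
      rw [Finset.prod_range_succ]
      exact mul_le_mul (h1 (hc.trans hT)) (hmono _ _ hc hl) (h0 _) hP
    refine ⟨first, ?_⟩
    by_cases hc : c ≤ recipSqrt (N + 1)
    · rw [mul_comm]
      exact mul_le_mul (h1 hc) (hφm _) hm hP
    · push Not at hc
      rw [Finset.prod_range_succ, ← mul_assoc]
      exact mul_le_mul h2 (hanti _ _ hr hc.le) (h0 _) hP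

section quasiconvex

variable (z : ℂ)

/-- Completing the square in `t` shows that `‖1 - z t‖` decreases up to `Re z / |z|²` and increases
afterwards, with minimum `|Im z| / |z|`. This is the quasi-convexity used for the interlacing
estimates. -/
lemma norm_one_sub_mul_sq (hz : z ≠ 0) (t : ℝ) :
    ‖1 - z * t‖ ^ 2 = ‖z‖ ^ 2 * (t - z.re / ‖z‖ ^ 2) ^ 2 + (|z.im| / ‖z‖) ^ 2 := by
  have hn : ‖z‖ ≠ 0 := norm_ne_zero_iff.2 hz
  have e : ‖z‖ ^ 2 = z.re ^ 2 + z.im ^ 2 := by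
    rw [Complex.sq_norm, Complex.normSq_apply]; ring
  have e2 : ‖1 - z * t‖ ^ 2 = 1 - 2 * z.re * t + ‖z‖ ^ 2 * t ^ 2 := by
    rw [Complex.sq_norm, Complex.normSq_apply, e]; simp; ring
  rw [e2, div_pow, sq_abs]
  have : z.im ^ 2 = ‖z‖ ^ 2 - z.re ^ 2 := by rw [e]; ring
  rw [this]
  field_simp
  ring

lemma le_norm_one_sub_mul (hz : z ≠ 0) (t : ℝ) : |z.im| / ‖z‖ ≤ ‖1 - z * t‖ := by
  refine le_of_sq_le_sq ?_ (norm_nonneg _)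
  rw [norm_one_sub_mul_sq z hz]
  nlinarith [mul_nonneg (sq_nonneg ‖z‖) (sq_nonneg (t - z.re / ‖z‖ ^ 2))]

lemma norm_one_sub_mul_anti (hz : z ≠ 0) (u v : ℝ) (huv : u ≤ v) (hv : v ≤ z.re / ‖z‖ ^ 2) :
    ‖1 - z * v‖ ≤ ‖1 - z * u‖ := by
  refine le_of_sq_le_sq ?_ (norm_nonneg _)
  rw [norm_one_sub_mul_sq z hz, norm_one_sub_mul_sq z hz]
  have : (v - z.re / ‖z‖ ^ 2) ^ 2 ≤ (u - z.re / ‖z‖ ^ 2) ^ 2 := by nlinarith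
  gcongr

lemma norm_one_sub_mul_mono (hz : z ≠ 0) (u v : ℝ) (hu : z.re / ‖z‖ ^ 2 ≤ u) (huv : u ≤ v) :
    ‖1 - z * u‖ ≤ ‖1 - z * v‖ := by
  refine le_of_sq_le_sq ?_ (norm_nonneg _)
  rw [norm_one_sub_mul_sq z hz, norm_one_sub_mul_sq z hz]
  have : (u - z.re / ‖z‖ ^ 2) ^ 2 ≤ (v - z.re / ‖z‖ ^ 2) ^ 2 := by nlinarith
  gcongr

end quasiconvex

lemma prod_norm_one_sub_le {z : ℂ} (hz : z ≠ 0) {t : ℕ → ℝ} (ht : Interlaced t) (N : ℕ) :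
    |z.im| / ‖z‖ * ∏ k ∈ Finset.range N, ‖1 - z * t k‖ ≤
      ∏ k ∈ Finset.range (N + 1), ‖1 - z * recipSqrt k‖ :=
  (prod_interlaced_le (φ := fun t : ℝ => ‖1 - z * t‖) (by positivity) (le_norm_one_sub_mul z hz)
    (norm_one_sub_mul_anti z hz) (norm_one_sub_mul_mono z hz) ht N).2

lemma le_prod_norm_one_sub {z : ℂ} (hz : z ≠ 0) {t : ℕ → ℝ} (ht : Interlaced t) (N : ℕ) :
    |z.im| / ‖z‖ * ∏ k ∈ Finset.range N, ‖1 - z * recipSqrt (k + 1)‖ ≤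
      ∏ k ∈ Finset.range (N + 1), ‖1 - z * t k‖ :=
  (le_prod_interlaced (φ := fun t : ℝ => ‖1 - z * t‖) (by positivity) (le_norm_one_sub_mul z hz)
    (norm_one_sub_mul_anti z hz) (norm_one_sub_mul_mono z hz) ht N).2

lemma recipSqrt_sq' (k : ℕ) : (recipSqrt k : ℂ) ^ 2 = 1 / ((k : ℂ) + 1) := by
  rw [← Complex.ofReal_pow, recipSqrt_sq]; simp

lemma norm_prod_one_add_canonTerm (t s : ℕ → ℝ) (N : ℕ) (z : ℂ) :
    ‖∏ k ∈ Finset.range N, (1 + canonTerm t s k z)‖ =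
      (∏ k ∈ Finset.range N, ‖1 - z * t k‖) * (∏ k ∈ Finset.range N, ‖1 - -z * s k‖) *
        ∏ k ∈ Finset.range N, ‖1 + z ^ 2 / ((k : ℂ) + 1)‖ := by
  rw [norm_prod, ← Finset.prod_mul_distrib, ← Finset.prod_mul_distrib]
  refine Finset.prod_congr rfl fun k _ => ?_
  rw [one_add_canonTerm, norm_mul, norm_mul, recipSqrt_sq']
  congr 2
  · ring_nf
  · rw [mul_one_div]

/-- This is why the canonical product carries the zeros `± i √(k+1)`: at the lattice nodes its
factors become those of Euler's product for `sin (π z²)`. -/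
lemma euler_factor (k : ℕ) (z : ℂ) :
    ‖1 - z * recipSqrt k‖ * ‖1 - -z * recipSqrt k‖ * ‖1 + z ^ 2 / ((k : ℂ) + 1)‖ =
      ‖1 - (z ^ 2) ^ 2 / ((k : ℂ) + 1) ^ 2‖ := by
  rw [← norm_mul, ← norm_mul]
  congr 1
  have h := recipSqrt_sq' k
  have : (1 - z * recipSqrt k) * (1 - -z * recipSqrt k) = 1 - z ^ 2 * (recipSqrt k : ℂ) ^ 2 := by
    ring
  rw [this, h]
  have : ((k : ℂ) + 1) ≠ 0 := Nat.cast_add_one_ne_zero k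
  field_simp
  ring

lemma tendsto_norm_euler (z : ℂ) :
    Tendsto (fun N : ℕ => Real.pi * ‖z‖ ^ 2 *
      ∏ k ∈ Finset.range N, ‖1 - (z ^ 2) ^ 2 / ((k : ℂ) + 1) ^ 2‖) atTop
      (nhds ‖Complex.sin (Real.pi * z ^ 2)‖) := by
  refine (Complex.tendsto_euler_sin_prod (z ^ 2)).norm.congr fun N => ?_
  rw [norm_mul, norm_mul, norm_prod, norm_pow, Complex.norm_real, Real.norm_of_nonneg Real.pi_pos.le]

/-- Upper bound for the canonical product off the real axis. -/
lemma canonProd_upper {t s : ℕ → ℝ} (ht : Interlaced t) (hs : Interlaced s) (z : ℂ) :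
    Real.pi * (z.im ^ 2 * ‖canonProd t s z‖) ≤ ‖Complex.sin (Real.pi * z ^ 2)‖ := by
  rcases eq_or_ne z 0 with rfl | hz
  · simp
  have hn : 0 < ‖z‖ := norm_pos_iff.2 hz
  -- The interlacing bound has `N + 1` lattice factors for each sign against `N` factors of the
  -- product. The surplus pair at `k = N` multiplies to `1 - z²/(N+1)`, which tends to one.
  have hlim : Tendsto (fun N : ℕ => (Real.pi * ‖z‖ ^ 2 *
      ∏ k ∈ Finset.range N, ‖1 - (z ^ 2) ^ 2 / ((k : ℂ) + 1) ^ 2‖) * ‖1 - z ^ 2 / ((N : ℂ) + 1)‖) atTop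
      (nhds (‖Complex.sin (Real.pi * z ^ 2)‖ * 1)) := by
    refine (tendsto_norm_euler z).mul ?_
    have h1 : Tendsto (fun N : ℕ => z ^ 2 * (1 / ((N : ℂ) + 1))) atTop (nhds (z ^ 2 * 0)) :=
      tendsto_one_div_add_atTop_nhds_zero_nat.const_mul _
    have := (tendsto_const_nhds (x := (1 : ℂ))).sub h1 |>.norm
    simpa [div_eq_mul_inv] using this
  rw [mul_one] at hlim
  refine le_of_tendsto_of_tendsto'
    (((tendsto_canonProd ht hs z).norm.const_mul (z.im ^ 2)).const_mul Real.pi) hlim fun N => ?_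
  rw [norm_prod_one_add_canonTerm]
  have b1 := prod_norm_one_sub_le hz ht N
  have b2 := prod_norm_one_sub_le (neg_ne_zero.2 hz) hs N
  rw [Complex.neg_im, abs_neg, norm_neg] at b2
  set P1 := ∏ k ∈ Finset.range N, ‖1 - z * t k‖
  set P2 := ∏ k ∈ Finset.range N, ‖1 - -z * s k‖
  set P3 := ∏ k ∈ Finset.range N, ‖1 + z ^ 2 / ((k : ℂ) + 1)‖ with hP3
  have p3 : 0 ≤ P3 := Finset.prod_nonneg fun _ _ => norm_nonneg _
  have b := mul_le_mul b1 b2 (by positivity) (by positivity)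
  have e : (∏ k ∈ Finset.range N, ‖1 - (z ^ 2) ^ 2 / ((k : ℂ) + 1) ^ 2‖) *
      ‖1 - z ^ 2 / ((N : ℂ) + 1)‖ = (∏ k ∈ Finset.range (N + 1), ‖1 - z * recipSqrt k‖) *
        (∏ k ∈ Finset.range (N + 1), ‖1 - -z * recipSqrt k‖) * P3 := by
    rw [Finset.prod_range_succ, Finset.prod_range_succ, hP3]
    simp_rw [← euler_factor]
    rw [Finset.prod_mul_distrib, Finset.prod_mul_distrib]
    have : ‖1 - z ^ 2 / ((N : ℂ) + 1)‖ = ‖1 - z * recipSqrt N‖ * ‖1 - -z * recipSqrt N‖ := by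
      rw [← norm_mul]; congr 1
      have h := recipSqrt_sq' N
      rw [div_eq_mul_one_div, ← h]; ring
    rw [this]; ring
  rw [mul_assoc, mul_assoc, mul_assoc, e]
  have e3 : z.im ^ 2 = ‖z‖ ^ 2 * ((|z.im| / ‖z‖) * (|z.im| / ‖z‖)) := by
    field_simp; rw [sq_abs]
  calc Real.pi * (z.im ^ 2 * (P1 * (P2 * P3)))
      = Real.pi * (‖z‖ ^ 2 * ((|z.im| / ‖z‖ * P1 * (|z.im| / ‖z‖ * P2)) * P3)) := by
        rw [e3]; ring
    _ ≤ _ := by gcongr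

/-- Lower bound for the canonical product off the real axis. -/
lemma canonProd_lower {t s : ℕ → ℝ} (ht : Interlaced t) (hs : Interlaced s) {z : ℂ} :
    z.im ^ 2 * ‖Complex.sin (Real.pi * z ^ 2)‖ ≤
      Real.pi * ‖z‖ ^ 4 * ‖1 - z ^ 2‖ * ‖canonProd t s z‖ := by
  rcases eq_or_ne z 0 with rfl | hz
  · simp
  have hn : 0 < ‖z‖ := norm_pos_iff.2 hz
  -- The lower interlacing bound uses only the nodes from index one on. The missing pair at index
  -- zero contributes the factor `1 - z²`.
  have hlim := ((tendsto_canonProd ht hs z).norm.const_mul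
    (Real.pi * ‖z‖ ^ 4 * ‖1 - z ^ 2‖)).comp (tendsto_add_atTop_nat 1)
  refine le_of_tendsto_of_tendsto' (((tendsto_norm_euler z).comp
    (tendsto_add_atTop_nat 1)).const_mul (z.im ^ 2)) hlim fun N => ?_
  simp only [Function.comp]
  rw [norm_prod_one_add_canonTerm]
  have b1 := le_prod_norm_one_sub hz ht N
  have b2 := le_prod_norm_one_sub (neg_ne_zero.2 hz) hs N
  rw [Complex.neg_im, abs_neg, norm_neg] at b2
  set P1 := ∏ k ∈ Finset.range (N + 1), ‖1 - z * t k‖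
  set P2 := ∏ k ∈ Finset.range (N + 1), ‖1 - -z * s k‖
  set P3 := ∏ k ∈ Finset.range (N + 1), ‖1 + z ^ 2 / ((k : ℂ) + 1)‖ with hP3
  have p3 : 0 ≤ P3 := Finset.prod_nonneg fun _ _ => norm_nonneg _
  have p1 : 0 ≤ P1 := Finset.prod_nonneg fun _ _ => norm_nonneg _
  have b := mul_le_mul b1 b2 (mul_nonneg (by positivity)
    (Finset.prod_nonneg fun _ _ => norm_nonneg _)) p1
  set Q1 := ∏ k ∈ Finset.range N, ‖1 - z * recipSqrt (k + 1)‖ with hQ1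
  set Q2 := ∏ k ∈ Finset.range N, ‖1 - -z * recipSqrt (k + 1)‖ with hQ2
  have e : (∏ k ∈ Finset.range (N + 1), ‖1 - (z ^ 2) ^ 2 / ((k : ℂ) + 1) ^ 2‖) =
      ‖1 - z ^ 2‖ * (Q1 * Q2) * P3 := by
    simp_rw [← euler_factor]
    rw [Finset.prod_mul_distrib, Finset.prod_mul_distrib, Finset.prod_range_succ',
      Finset.prod_range_succ' (fun k => ‖1 - -z * recipSqrt k‖)]
    have : ‖1 - z ^ 2‖ = ‖1 - z * recipSqrt 0‖ * ‖1 - -z * recipSqrt 0‖ := by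
      rw [← norm_mul]; congr 1
      simp [recipSqrt]; ring
    rw [this, hQ1, hQ2]; ring
  rw [e]
  have e3 : z.im ^ 2 = ‖z‖ ^ 2 * ((|z.im| / ‖z‖) * (|z.im| / ‖z‖)) := by
    field_simp; rw [sq_abs]
  calc z.im ^ 2 * (Real.pi * ‖z‖ ^ 2 * (‖1 - z ^ 2‖ * (Q1 * Q2) * P3))
      = Real.pi * ‖z‖ ^ 4 * ‖1 - z ^ 2‖ * ((|z.im| / ‖z‖ * Q1 * (|z.im| / ‖z‖ * Q2)) * P3) := by
        rw [e3]; ring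
    _ ≤ Real.pi * ‖z‖ ^ 4 * ‖1 - z ^ 2‖ * (P1 * P2 * P3) := by
        have := Real.pi_pos.le
        gcongr

lemma norm_sin_le_exp (w : ℂ) : ‖Complex.sin w‖ ≤ Real.exp |w.im| := by
  have h : Complex.sin w = (Complex.exp (-w * Complex.I) - Complex.exp (w * Complex.I)) *
    Complex.I / 2 := rfl
  rw [h, norm_div, norm_mul, Complex.norm_I, mul_one, Complex.norm_ofNat, div_le_iff₀ two_pos]
  refine (norm_sub_le _ _).trans ?_
  rw [Complex.norm_exp, Complex.norm_exp]
  have h1 : (-w * Complex.I).re ≤ |w.im| := by simpa using le_abs_self w.im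
  have h2 : (w * Complex.I).re ≤ |w.im| := by simpa using neg_le_abs w.im
  linarith [Real.exp_le_exp.2 h1, Real.exp_le_exp.2 h2]

lemma sinh_abs_le_norm_sin (w : ℂ) : Real.sinh |w.im| ≤ ‖Complex.sin w‖ := by
  have h : Complex.sin w = (Complex.exp (-w * Complex.I) - Complex.exp (w * Complex.I)) *
    Complex.I / 2 := rfl
  rw [h, norm_div, norm_mul, Complex.norm_I, mul_one, Complex.norm_ofNat, le_div_iff₀ two_pos,
    Real.sinh_eq]
  have := abs_norm_sub_norm_le (Complex.exp (-w * Complex.I)) (Complex.exp (w * Complex.I))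
  rw [Complex.norm_exp, Complex.norm_exp] at this
  simp only [neg_mul, Complex.neg_re, Complex.mul_I_re, neg_neg] at this ⊢
  refine le_trans ?_ this
  rcases abs_cases w.im with ⟨e, _⟩ | ⟨e, _⟩ <;> rw [e]
  · linarith [le_abs_self (Real.exp w.im - Real.exp (-w.im))]
  · rw [neg_neg]; linarith [neg_le_abs (Real.exp w.im - Real.exp (-w.im))]

lemma im_pi_mul_sq (z : ℂ) : ((Real.pi : ℂ) * z ^ 2).im = 2 * Real.pi * (z.re * z.im) := by
  rw [Complex.im_ofReal_mul, sq, Complex.mul_im]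
  ring

lemma abs_im_pi_mul_sq (z : ℂ) :
    |((Real.pi : ℂ) * z ^ 2).im| = 2 * Real.pi * |z.re * z.im| := by
  rw [im_pi_mul_sq, abs_mul, abs_of_pos Real.two_pi_pos]

/-- Growth of the canonical product. -/
lemma norm_canonProd_le {t s : ℕ → ℝ} (ht : Interlaced t) (hs : Interlaced s) (z : ℂ) :
    ‖canonProd t s z‖ ≤
      4 * Real.exp (2 * Real.pi * (|z.re| + 1) + 2 * Real.pi * |z.re * z.im|) := by
  have hpi := Real.pi_pos
  have key : ∀ w : ℂ, w.im ^ 2 * ‖canonProd t s w‖ ≤ Real.exp (2 * Real.pi * |w.re * w.im|) := by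
    intro w
    have h1 := canonProd_upper ht hs w
    have h2 := norm_sin_le_exp (Real.pi * w ^ 2)
    rw [abs_im_pi_mul_sq] at h2
    have h0 : 0 ≤ w.im ^ 2 * ‖canonProd t s w‖ := by positivity
    nlinarith [Real.pi_gt_three]
  by_cases hy : 1 ≤ |z.im|
  · have h1 := key z
    have h2 : 1 ≤ z.im ^ 2 := by rw [← sq_abs]; nlinarith
    have h3 : Real.exp (2 * Real.pi * |z.re * z.im|) ≤
        Real.exp (2 * Real.pi * (|z.re| + 1) + 2 * Real.pi * |z.re * z.im|) := by
      apply Real.exp_le_exp.2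
      have : 0 ≤ 2 * Real.pi * (|z.re| + 1) := by positivity
      linarith
    nlinarith [norm_nonneg (canonProd t s z), Real.exp_pos (2 * Real.pi * |z.re * z.im|)]
  · push Not at hy
    set x : ℂ := (z.re : ℂ)
    -- The bound `key` degenerates like `y⁻²` near the axis. On the unit circle about `Re z` one has
    -- `|(w - x)² - 1| = 2 |Im w|`, so its square cancels the degeneracy, while at `z` itself the
    -- multiplier has modulus at least one.
    set q : ℂ → ℂ := fun w => canonProd t s w * ((w - x) ^ 2 - 1) ^ 2
    have hq : Differentiable ℂ q := by
      have := differentiable_canonProd ht hs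
      fun_prop
    have hbd : ∀ w ∈ frontier (Metric.ball x 1), ‖q w‖ ≤
        4 * Real.exp (2 * Real.pi * (|z.re| + 1)) := by
      intro w hw
      rw [frontier_ball _ one_ne_zero, mem_sphere_iff_norm] at hw
      have e1 : ‖w - x‖ ^ 2 = (w.re - z.re) ^ 2 + w.im ^ 2 := by
        rw [Complex.sq_norm, Complex.normSq_apply]; simp [x]; ring
      have e2 : ‖(w - x) ^ 2 - 1‖ ^ 2 = 4 * w.im ^ 2 := by
        rw [Complex.sq_norm, Complex.normSq_apply]
        rw [hw] at e1
        have e4 : w.im ^ 2 = 1 - (w.re - z.re) ^ 2 := by linarith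
        simp [x, sq]
        simp only [← sq] at *
        ring_nf
        have e5 : w.im ^ 4 = (w.im ^ 2) ^ 2 := by ring
        rw [e5, e4]
        ring
      have e3 : |w.re| ≤ |z.re| + 1 := by
        have : |w.re - z.re| ≤ 1 := by
          rw [← sq_le_one_iff_abs_le_one]; nlinarith [sq_nonneg w.im]
        have := abs_sub_abs_le_abs_sub w.re z.re
        linarith
      have e4 : |w.im| ≤ 1 := by
        rw [← sq_le_one_iff_abs_le_one]; nlinarith [sq_nonneg (w.re - z.re)]
      simp only [q, norm_mul, norm_pow]
      rw [e2]
      have hk := key w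
      have h3 : Real.exp (2 * Real.pi * |w.re * w.im|) ≤
          Real.exp (2 * Real.pi * (|z.re| + 1)) := by
        apply Real.exp_le_exp.2
        have : |w.re * w.im| ≤ (|z.re| + 1) * 1 := by rw [abs_mul]; gcongr
        rw [mul_one] at this
        gcongr
      linarith
    have hz : z ∈ closure (Metric.ball x 1) := by
      rw [closure_ball _ one_ne_zero, mem_closedBall_iff_norm]
      have : z - x = z.im * Complex.I := by apply Complex.ext <;> simp [x]
      rw [this, norm_mul, Complex.norm_I, mul_one, Complex.norm_real]
      exact hy.le
    have hmax := Complex.norm_le_of_forall_mem_frontier_norm_le Metric.isBounded_ball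
      hq.diffContOnCl hbd hz
    have h1 : 1 ≤ ‖(z - x) ^ 2 - 1‖ ^ 2 := by
      have : z - x = z.im * Complex.I := by apply Complex.ext <;> simp [x]
      rw [this, mul_pow, Complex.I_sq, Complex.sq_norm, Complex.normSq_apply]
      have e : ((z.im : ℂ) ^ 2 * -1 - 1) = ((-(z.im ^ 2) - 1 : ℝ) : ℂ) := by push_cast; ring
      rw [e, Complex.ofReal_re, Complex.ofReal_im]
      nlinarith [sq_nonneg z.im]
    simp only [q, norm_mul, norm_pow] at hmax
    have h3 : Real.exp (2 * Real.pi * (|z.re| + 1)) ≤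
        Real.exp (2 * Real.pi * (|z.re| + 1) + 2 * Real.pi * |z.re * z.im|) := by
      apply Real.exp_le_exp.2
      have : 0 ≤ 2 * Real.pi * |z.re * z.im| := by positivity
      linarith
    nlinarith [norm_nonneg (canonProd t s z)]

/-! ### Phragmén–Lindelöf in sectors -/

/-- The complex number with polar coordinates `r`, `φ`. -/
noncomputable def polar (r φ : ℝ) : ℂ := r * Complex.exp (φ * Complex.I)

lemma norm_polar {r : ℝ} (hr : 0 ≤ r) (φ : ℝ) : ‖polar r φ‖ = r := by
  rw [polar, norm_mul, Complex.norm_exp_ofReal_mul_I, mul_one, Complex.norm_real,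
    Real.norm_of_nonneg hr]

lemma polar_re (r φ : ℝ) : (polar r φ).re = r * Real.cos φ := by
  rw [polar, Complex.re_ofReal_mul, Complex.exp_ofReal_mul_I_re]

lemma polar_im (r φ : ℝ) : (polar r φ).im = r * Real.sin φ := by
  rw [polar, Complex.im_ofReal_mul, Complex.exp_ofReal_mul_I_im]

lemma polar_zero_right (r : ℝ) : polar r 0 = r := by simp [polar]

lemma polar_add (r φ ψ : ℝ) : polar r (φ + ψ) = Complex.exp (φ * Complex.I) * polar r ψ := by
  simp only [polar, Complex.ofReal_add, add_mul, Complex.exp_add]; ring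

/-- Phragmén–Lindelöf for functions of order two in a sector of opening less than a quadrant whose
lower side is the positive real axis. -/
lemma norm_le_of_sector_aux {f : ℂ → ℂ} {θ C B M : ℝ} (hθ : 0 < θ) (hθ2 : θ < Real.pi / 2)
    (hd : ∀ r φ, 0 ≤ r → 0 ≤ φ → φ ≤ θ → DifferentiableAt ℂ f (polar r φ))
    (hB : ∀ r φ, 0 ≤ r → 0 ≤ φ → φ ≤ θ → ‖f (polar r φ)‖ ≤ M * Real.exp (B * r ^ 2))
    (h1 : ∀ r, 0 ≤ r → ‖f (polar r 0)‖ ≤ C) (h2 : ∀ r, 0 ≤ r → ‖f (polar r θ)‖ ≤ C)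
    {r φ : ℝ} (hr : 0 ≤ r) (hφ0 : 0 ≤ φ) (hφ : φ ≤ θ) : ‖f (polar r φ)‖ ≤ C := by
  have hpi := Real.pi_pos
  -- The map `v ↦ v^q` carries the closed first quadrant to the sector of opening `θ`. Since `q <
  -- 1`, order two becomes order `2q < 2`, which the quadrant theorem allows.
  set q : ℝ := 2 * θ / Real.pi with hq
  have hq0 : 0 < q := by positivity
  have hq1 : q < 1 := by rw [hq, div_lt_one hpi]; linarith
  have hqθ : Real.pi / 2 * q = θ := by rw [hq]; field_simp
  have hpow : ∀ v : ℂ, v ^ (q : ℂ) = polar (‖v‖ ^ q) (v.arg * q) := by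
    intro v
    rw [Complex.cpow_ofReal, polar, Complex.exp_mul_I]
    push_cast
    rfl
  have harg : ∀ v : ℂ, 0 ≤ v.re → 0 ≤ v.im → 0 ≤ v.arg * q ∧ v.arg * q ≤ θ := by
    intro v h h'
    have a0 : 0 ≤ v.arg := Complex.arg_nonneg_iff.2 h'
    have a1 : v.arg ≤ Real.pi / 2 := (abs_le.1 (Complex.abs_arg_le_pi_div_two_iff.2 h)).2
    refine ⟨by positivity, ?_⟩
    rw [← hqθ]; gcongr
  have hdf : ∀ v : ℂ, 0 ≤ v.re → 0 ≤ v.im → DifferentiableAt ℂ f (v ^ (q : ℂ)) := by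
    intro v h h'
    rw [hpow]
    exact hd _ _ (by positivity) (harg v h h').1 (harg v h h').2
  have hg : DiffContOnCl ℂ (fun v : ℂ => f (v ^ (q : ℂ))) (Set.Ioi 0 ×ℂ Set.Ioi 0) := by
    constructor
    · intro v hv
      obtain ⟨hv1, hv2⟩ := hv
      simp only [Set.mem_preimage, Set.mem_Ioi] at hv1 hv2
      refine DifferentiableAt.differentiableWithinAt ?_
      exact (hdf v hv1.le hv2.le).comp v
        (differentiableAt_id.cpow_const (Complex.mem_slitPlane_iff.2 (Or.inl hv1)))
    · intro v hv
      rw [Complex.closure_reProdIm, closure_Ioi, Complex.mem_reProdIm] at hv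
      obtain ⟨hv1, hv2⟩ := hv
      simp only [Set.mem_Ici] at hv1 hv2
      refine ContinuousAt.continuousWithinAt ?_
      refine ContinuousAt.comp (f := fun v : ℂ => v ^ (q : ℂ)) (hdf v hv1 hv2).continuousAt ?_
      have := Complex.continuousAt_cpow_of_re_pos (p := (v, (q : ℂ))) (Or.inl hv1)
        (by simpa using hq0)
      exact ContinuousAt.comp (f := fun v : ℂ => (v, (q : ℂ))) this
        (continuousAt_id.prodMk continuousAt_const)
  have hres := PhragmenLindelof.quadrant_I (z := polar (r ^ (1 / q)) (φ / q)) (C := C) hg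
    ⟨2 * q, by linarith, B, by
      refine Asymptotics.IsBigO.of_bound M ?_
      refine eventually_inf_principal.2 (.of_forall fun v hv => ?_)
      obtain ⟨hv1, hv2⟩ := hv
      simp only [Set.mem_preimage, Set.mem_Ioi] at hv1 hv2
      obtain ⟨a, b⟩ := harg v hv1.le hv2.le
      have := hB (‖v‖ ^ q) (v.arg * q) (by positivity) a b
      rw [← hpow, ← Real.rpow_natCast, ← Real.rpow_mul (norm_nonneg v)] at this
      rw [Real.norm_of_nonneg (Real.exp_pos _).le, mul_comm 2 q]
      exact_mod_cast this⟩
    (fun x hx => by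
      rw [hpow, Complex.arg_ofReal_of_nonneg hx, zero_mul]
      exact h1 _ (by positivity))
    (fun x hx => by
      rcases hx.eq_or_lt with rfl | hx
      · rw [hpow]; simp only [Complex.ofReal_zero, zero_mul, Complex.arg_zero]
        exact h1 _ (by positivity)
      · rw [hpow, Complex.arg_real_mul _ hx, Complex.arg_I, hqθ]
        exact h2 _ (by positivity))
    (by
      rw [polar_re]
      have : φ / q ≤ Real.pi / 2 := by rw [div_le_iff₀ hq0, hqθ]; exact hφ
      have : 0 ≤ φ / q := by positivity
      exact mul_nonneg (by positivity) (Real.cos_nonneg_of_mem_Icc ⟨by linarith, by linarith⟩))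
    (by
      rw [polar_im]
      have : φ / q ≤ Real.pi / 2 := by rw [div_le_iff₀ hq0, hqθ]; exact hφ
      have : 0 ≤ φ / q := by positivity
      exact mul_nonneg (by positivity) (Real.sin_nonneg_of_nonneg_of_le_pi (by linarith)
        (by linarith)))
  have hφq : φ / q ≤ Real.pi / 2 := by rw [div_le_iff₀ hq0, hqθ]; exact hφ
  have hφq0 : 0 ≤ φ / q := by positivity
  rcases hr.eq_or_lt with rfl | hr
  · have := h1 0 le_rfl
    simpa [polar] using this
  · have hpos : 0 < r ^ (1 / q) := by positivity
    rw [hpow, norm_polar hpos.le] at hres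
    have e : (polar (r ^ (1 / q)) (φ / q)).arg = φ / q := by
      rw [polar, Complex.exp_mul_I, Complex.arg_mul_cos_add_sin_mul_I hpos
        ⟨by linarith, by linarith⟩]
    rw [e, ← Real.rpow_mul hr.le, one_div, inv_mul_cancel₀ hq0.ne', Real.rpow_one,
      div_mul_cancel₀ _ hq0.ne'] at hres
    exact hres

/-- Phragmén–Lindelöf for functions of order two in a sector of opening less than a quadrant. -/
lemma norm_le_of_sector {f : ℂ → ℂ} {α β C B M : ℝ} (hαβ : α < β) (hβ : β - α < Real.pi / 2)
    (hd : ∀ r φ, 0 ≤ r → α ≤ φ → φ ≤ β → DifferentiableAt ℂ f (polar r φ))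
    (hB : ∀ r φ, 0 ≤ r → α ≤ φ → φ ≤ β → ‖f (polar r φ)‖ ≤ M * Real.exp (B * r ^ 2))
    (h1 : ∀ r, 0 ≤ r → ‖f (polar r α)‖ ≤ C) (h2 : ∀ r, 0 ≤ r → ‖f (polar r β)‖ ≤ C)
    {r φ : ℝ} (hr : 0 ≤ r) (hφ0 : α ≤ φ) (hφ : φ ≤ β) : ‖f (polar r φ)‖ ≤ C := by
  have := norm_le_of_sector_aux (f := fun z => f (Complex.exp (α * Complex.I) * z)) (θ := β - α)
    (B := B) (M := M) (C := C) (r := r) (φ := φ - α) (by linarith) hβ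
    (fun r φ hr h h' => by
      have := hd r (α + φ) hr (by linarith) (by linarith)
      rw [polar_add] at this
      exact this.comp (polar r φ) (differentiableAt_id.const_mul _))
    (fun r φ hr h h' => by
      rw [← polar_add]
      exact hB _ _ hr (by linarith) (by linarith))
    (fun r hr => by rw [← polar_add, add_zero]; exact h1 r hr)
    (fun r hr => by rw [← polar_add, add_sub_cancel]; exact h2 r hr)
    hr (by linarith) (by linarith)
  rwa [← polar_add, add_sub_cancel] at this

lemma polar_sq_re (r φ : ℝ) : (polar r φ ^ 2).re = r ^ 2 * Real.cos (2 * φ) := by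
  rw [sq, Complex.mul_re, polar_re, polar_im, Real.cos_two_mul']; ring

lemma polar_sq_im (r φ : ℝ) : (polar r φ ^ 2).im = r ^ 2 * Real.sin (2 * φ) := by
  rw [sq, Complex.mul_im, polar_re, polar_im, Real.sin_two_mul]; ring

/-- The modulus of a complex Gaussian in polar coordinates. -/
lemma norm_exp_polar_sq (p q r φ : ℝ) :
    ‖Complex.exp ((p + q * Complex.I) * polar r φ ^ 2)‖ =
      Real.exp (r ^ 2 * (p * Real.cos (2 * φ) - q * Real.sin (2 * φ))) := by
  rw [Complex.norm_exp, Complex.mul_re, polar_sq_re, polar_sq_im]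
  congr 1
  simp
  ring

/-- Phragmén–Lindelöf with Gaussian comparison functions. -/
lemma norm_le_gaussian_of_sector {f : ℂ → ℂ} {α β C B M : ℝ} (p q : ℝ) (hM : 0 ≤ M)
    (hαβ : α < β) (hβ : β - α < Real.pi / 2)
    (hd : ∀ r φ, 0 ≤ r → α ≤ φ → φ ≤ β → DifferentiableAt ℂ f (polar r φ))
    (hB : ∀ r φ, 0 ≤ r → α ≤ φ → φ ≤ β → ‖f (polar r φ)‖ ≤ M * Real.exp (B * r ^ 2))
    (h1 : ∀ r, 0 ≤ r → ‖f (polar r α)‖ ≤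
      C * Real.exp (r ^ 2 * (p * Real.cos (2 * α) + q * Real.sin (2 * α))))
    (h2 : ∀ r, 0 ≤ r → ‖f (polar r β)‖ ≤
      C * Real.exp (r ^ 2 * (p * Real.cos (2 * β) + q * Real.sin (2 * β))))
    {r φ : ℝ} (hr : 0 ≤ r) (hφ0 : α ≤ φ) (hφ : φ ≤ β) :
    ‖f (polar r φ)‖ ≤ C * Real.exp (r ^ 2 * (p * Real.cos (2 * φ) + q * Real.sin (2 * φ))) := by
  set E : ℝ → ℝ → ℝ := fun r φ => r ^ 2 * (p * Real.cos (2 * φ) + q * Real.sin (2 * φ))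
  -- The Gaussian factor has modulus `exp (-r² (p cos 2φ + q sin 2φ))`, so the claim is that `g` is
  -- bounded by `C`.
  set g : ℂ → ℂ := fun z => f z * Complex.exp (((-p : ℝ) + q * Complex.I) * z ^ 2)
  have hg : ∀ r φ, ‖g (polar r φ)‖ = ‖f (polar r φ)‖ * Real.exp (-E r φ) := by
    intro r φ
    simp only [g, norm_mul]
    rw [norm_exp_polar_sq]
    congr 2
    simp only [E]; ring
  have hle : ∀ r φ, ‖g (polar r φ)‖ ≤ C ↔ ‖f (polar r φ)‖ ≤ C * Real.exp (E r φ) := by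
    intro r φ
    rw [hg, Real.exp_neg, ← div_eq_mul_inv, div_le_iff₀ (Real.exp_pos _)]
  rw [← hle]
  refine norm_le_of_sector (f := g) (B := B + (|p| + |q|)) (M := M) hαβ hβ ?_ ?_ ?_ ?_ hr hφ0 hφ
  · intro r φ hr h h'
    exact (hd r φ hr h h').mul (by fun_prop)
  · intro r φ hr h h'
    rw [hg]
    have hE : -E r φ ≤ (|p| + |q|) * r ^ 2 := by
      have c := Real.abs_cos_le_one (2 * φ)
      have s := Real.abs_sin_le_one (2 * φ)
      have a1 : -(p * Real.cos (2 * φ)) ≤ |p| := by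
        calc -(p * Real.cos (2 * φ)) ≤ |p * Real.cos (2 * φ)| := neg_le_abs _
          _ = |p| * |Real.cos (2 * φ)| := abs_mul _ _
          _ ≤ |p| * 1 := by gcongr
          _ = _ := mul_one _
      have a2 : -(q * Real.sin (2 * φ)) ≤ |q| := by
        calc -(q * Real.sin (2 * φ)) ≤ |q * Real.sin (2 * φ)| := neg_le_abs _
          _ = |q| * |Real.sin (2 * φ)| := abs_mul _ _
          _ ≤ |q| * 1 := by gcongr
          _ = _ := mul_one _
      simp only [E]
      nlinarith [sq_nonneg r]
    calc ‖f (polar r φ)‖ * Real.exp (-E r φ)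
        ≤ (M * Real.exp (B * r ^ 2)) * Real.exp ((|p| + |q|) * r ^ 2) :=
          mul_le_mul (hB r φ hr h h') (Real.exp_le_exp.2 hE) (Real.exp_pos _).le (by positivity)
      _ = _ := by rw [mul_assoc, ← Real.exp_add]; ring_nf
  · exact fun r hr => (hle _ _).2 (h1 r hr)
  · exact fun r hr => (hle _ _).2 (h2 r hr)

/-! ### Dividing by the canonical product -/

/-- The quotient of two functions, extended to simple zeros of the denominator. -/
noncomputable def regQuot (F P : ℂ → ℂ) (z : ℂ) : ℂ :=
  open Classical in if P z = 0 then deriv F z / deriv P z else F z / P z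

lemma regQuot_of_ne {F P : ℂ → ℂ} {z : ℂ} (h : P z ≠ 0) : regQuot F P z = F z / P z := by
  simp [regQuot, h]

/-- At a common zero that is simple for `P`, the quotient agrees nearby with the quotient of the
difference quotients `dslope F z` and `dslope P z`, both entire, the second nonzero at `z`. -/
lemma differentiableAt_regQuot {F P : ℂ → ℂ} (hF : Differentiable ℂ F) (hP : Differentiable ℂ P)
    {z : ℂ} (h : P z ≠ 0 ∨ (F z = 0 ∧ deriv P z ≠ 0)) : DifferentiableAt ℂ (regQuot F P) z := by
  by_cases hz : P z = 0
  · obtain ⟨hFz, hd⟩ := h.resolve_left (not_not.2 hz)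
    have dF : DifferentiableAt ℂ (dslope F z) z :=
      ((Complex.differentiableOn_dslope univ_mem).2 hF.differentiableOn).differentiableAt univ_mem
    have dP : DifferentiableAt ℂ (dslope P z) z :=
      ((Complex.differentiableOn_dslope univ_mem).2 hP.differentiableOn).differentiableAt univ_mem
    have h0 : dslope P z z ≠ 0 := by rwa [dslope_same]
    refine (dF.div dP h0).congr_of_eventuallyEq ?_
    filter_upwards [dP.continuousAt.eventually_ne h0] with w hw
    rcases eq_or_ne w z with rfl | hne
    · simp [regQuot, hz, dslope_same]
    · rw [dslope_of_ne _ hne, slope_def_field, hz, sub_zero] at hw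
      have hPw : P w ≠ 0 := fun h => hw (by rw [h, zero_div])
      have : w - z ≠ 0 := sub_ne_zero.2 hne
      rw [regQuot_of_ne hPw, Pi.div_apply, dslope_of_ne _ hne, dslope_of_ne _ hne, slope_def_field,
        slope_def_field, hz, hFz, sub_zero, sub_zero]
      field_simp
  · refine ((hF z).div (hP z) hz).congr_of_eventuallyEq ?_
    filter_upwards [(hP z).continuousAt.eventually_ne hz] with w hw
    simp [regQuot_of_ne hw]

/-- The zeros `-1/s k` and `± i √(k+1)` lie outside the open right half-plane, so there only the
factor with `t k` can vanish. -/
lemma one_add_canonTerm_ne_zero {t s : ℕ → ℝ} (hs : Interlaced s) {z : ℂ} (hz : 0 < z.re) {k : ℕ}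
    (h : 1 - z * t k ≠ 0) : 1 + canonTerm t s k z ≠ 0 := by
  rw [one_add_canonTerm]
  refine mul_ne_zero (mul_ne_zero h ?_) ?_
  · intro h0
    have := congrArg Complex.re h0
    simp at this
    nlinarith [mul_pos hz (hs.pos k)]
  · intro h0
    have e : 1 + z ^ 2 * (recipSqrt k : ℂ) ^ 2 =
        (1 + Complex.I * (z * recipSqrt k)) * (1 - Complex.I * (z * recipSqrt k)) := by
      ring_nf; simp
    rw [e, mul_eq_zero] at h0
    have hT := recipSqrt_pos k
    rcases h0 with h0 | h0 <;>
    · have := congrArg Complex.im h0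
      simp at this
      rcases this with h | h <;> linarith

lemma deriv_canonTerm_ne_zero {t s : ℕ → ℝ} (ht : Interlaced t) (hs : Interlaced s) {z : ℂ}
    (hz : 0 < z.re) {k : ℕ} (h : 1 - z * t k = 0) : deriv (canonTerm t s k) z ≠ 0 := by
  set Q : ℂ → ℂ := fun w => (1 + w * s k) * (1 + w ^ 2 * (recipSqrt k : ℂ) ^ 2)
  have e : canonTerm t s k = fun w => (1 - w * t k) * Q w - 1 := by
    funext w; simp only [canonTerm, Q]; ring
  have hQ : Differentiable ℂ Q := by simp only [Q]; fun_prop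
  have hQ0 : Q z ≠ 0 := by
    have := one_add_canonTerm_ne_zero (t := fun _ => 0) hs hz (k := k) (by simp)
    rw [one_add_canonTerm] at this
    simpa [Q] using this
  have h1 : HasDerivAt (fun w : ℂ => 1 - w * t k) (-(1 * (t k : ℂ))) z :=
    ((hasDerivAt_id z).mul_const _).const_sub 1
  have := (h1.mul (hQ z).hasDerivAt).sub_const 1
  rw [e]
  have h2 := this.deriv
  simp only [Pi.mul_apply] at h2
  rw [h, zero_mul, add_zero] at h2
  intro h3
  have h4 : deriv (fun w => (1 - w * (t k : ℂ)) * Q w - 1) z = -(1 * (t k : ℂ)) * Q z := h2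
  rw [h3] at h4
  have : (t k : ℂ) ≠ 0 := by exact_mod_cast (ht.pos k).ne'
  simp_all

lemma canonProd_zero (t s : ℕ → ℝ) : canonProd t s 0 = 1 := by
  simp [canonProd, canonTerm]

/-- The quotient by the canonical product is holomorphic in the right half-plane when the numerator
vanishes at the positive zeros. -/
lemma differentiableAt_regQuot_canonProd {F : ℂ → ℂ} (hF : Differentiable ℂ F) {t s : ℕ → ℝ}
    (ht : Interlaced t) (hs : Interlaced s) (hinj : Function.Injective t)
    (hz : ∀ k, F ((1 / t k : ℝ) : ℂ) = 0) {z : ℂ} (hre : 0 < z.re ∨ z = 0) :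
    DifferentiableAt ℂ (regQuot F (canonProd t s)) z := by
  refine differentiableAt_regQuot hF (differentiable_canonProd ht hs) ?_
  rcases hre with hre | rfl
  · by_cases h : ∃ k, 1 - z * t k = 0
    · obtain ⟨k, hk⟩ := h
      have htk : (t k : ℂ) ≠ 0 := by exact_mod_cast (ht.pos k).ne'
      have ez : z = ((1 / t k : ℝ) : ℂ) := by
        push_cast
        rw [eq_div_iff htk]
        exact (sub_eq_zero.1 hk).symm
      refine Or.inr ⟨ez ▸ hz k, deriv_canonProd_ne_zero ht hs (j := k) ?_
        (deriv_canonTerm_ne_zero ht hs hre hk) ?_⟩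
      · rw [one_add_canonTerm, hk]; simp
      · intro j hj
        refine one_add_canonTerm_ne_zero hs hre fun h0 => hj (hinj ?_)
        have : z * t j = z * t k := by linear_combination hk - h0
        have hz0 : z ≠ 0 := by rintro rfl; simp at hre
        exact_mod_cast mul_left_cancel₀ hz0 this
    · push Not at h
      exact Or.inl (canonProd_ne_zero ht hs fun k => one_add_canonTerm_ne_zero hs hre (h k))
  · exact Or.inl (by rw [canonProd_zero]; exact one_ne_zero)

/-- Follows from `1 + 2t ≤ e^{2t}`. It trades `sinh` for the full exponential at the price of a
polynomial factor, without division at `t = 0`. -/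
lemma exp_mul_self_le_sinh (t : ℝ) : Real.exp t * t ≤ (1 + 2 * t) * Real.sinh t := by
  have h : Real.exp (-(2 * t)) * (1 + 2 * t) ≤ 1 := by
    rw [Real.exp_neg, inv_mul_le_iff₀ (Real.exp_pos _), mul_one]
    linarith [Real.add_one_le_exp (2 * t)]
  have e : Real.exp (-t) = Real.exp t * Real.exp (-(2 * t)) := by
    rw [← Real.exp_add]; ring_nf
  rw [Real.sinh_eq, e]
  nlinarith [Real.exp_pos t, mul_le_mul_of_nonneg_left h (Real.exp_pos t).le]

lemma canonProd_ne_zero_of_im {t s : ℕ → ℝ} (ht : Interlaced t) (hs : Interlaced s) {z : ℂ}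
    (hre : 0 < z.re) (him : z.im ≠ 0) : canonProd t s z ≠ 0 := by
  refine canonProd_ne_zero ht hs fun k => one_add_canonTerm_ne_zero hs hre fun h => him ?_
  have := congrArg Complex.im h
  simpa [(ht.pos k).ne'] using this

/-- Bound for the quotient by the canonical product off the real axis. -/
lemma norm_regQuot_mul_le {F : ℂ → ℂ} {t s : ℕ → ℝ} (ht : Interlaced t) (hs : Interlaced s) {z : ℂ}
    (hre : 0 < z.re) (him : z.im ≠ 0) :
    ‖regQuot F (canonProd t s) z‖ * (z.im ^ 2 * Real.sinh (2 * Real.pi * |z.re * z.im|)) ≤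
      Real.pi * ‖z‖ ^ 4 * (1 + ‖z‖ ^ 2) * ‖F z‖ := by
  have hP := canonProd_ne_zero_of_im ht hs hre him
  have h1 := canonProd_lower ht hs (z := z)
  have h2 := sinh_abs_le_norm_sin (Real.pi * z ^ 2)
  rw [abs_im_pi_mul_sq] at h2
  have hF : ‖F z‖ = ‖regQuot F (canonProd t s) z‖ * ‖canonProd t s z‖ := by
    rw [regQuot_of_ne hP, ← norm_mul, div_mul_cancel₀ _ hP]
  have h3 : ‖1 - z ^ 2‖ ≤ 1 + ‖z‖ ^ 2 := by
    refine (norm_sub_le _ _).trans ?_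
    simp
  have hpi := Real.pi_pos
  calc _ ≤ ‖regQuot F (canonProd t s) z‖ * (z.im ^ 2 * ‖Complex.sin (Real.pi * z ^ 2)‖) := by
        gcongr
    _ ≤ ‖regQuot F (canonProd t s) z‖ *
        (Real.pi * ‖z‖ ^ 4 * (1 + ‖z‖ ^ 2) * ‖canonProd t s z‖) := by
        refine mul_le_mul_of_nonneg_left (h1.trans ?_) (norm_nonneg _)
        gcongr
    _ = _ := by rw [hF]; ring

lemma pow_four_mul_le_exp {r : ℝ} (hr : 0 ≤ r) : r ^ 4 * (1 + r ^ 2) ≤ Real.exp (6 * r) := by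
  have h1 : r ≤ Real.exp r := by linarith [Real.add_one_le_exp r]
  have h2 : 1 + r ^ 2 ≤ Real.exp r ^ 2 := by nlinarith [Real.add_one_le_exp r]
  calc r ^ 4 * (1 + r ^ 2) ≤ Real.exp r ^ 4 * Real.exp r ^ 2 := by gcongr
    _ = _ := by rw [← pow_add, ← Real.exp_nat_mul]; norm_num

/-- Crude version of the bound off the real axis. -/
lemma norm_regQuot_mul_le_crude {F : ℂ → ℂ} {t s : ℕ → ℝ} (ht : Interlaced t) (hs : Interlaced s)
    {z : ℂ} (hre : 0 < z.re) (him : z.im ≠ 0) :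
    ‖regQuot F (canonProd t s) z‖ * (z.re * |z.im| ^ 3) ≤ Real.exp (6 * ‖z‖) * ‖F z‖ := by
  have h := norm_regQuot_mul_le (F := F) ht hs hre him
  have hpi := Real.pi_pos
  have h1 : 2 * Real.pi * |z.re * z.im| ≤ Real.sinh (2 * Real.pi * |z.re * z.im|) :=
    Real.self_le_sinh_iff.2 (by positivity)
  have h2 : ‖regQuot F (canonProd t s) z‖ * (z.im ^ 2 * (2 * Real.pi * |z.re * z.im|)) ≤
      Real.pi * ‖z‖ ^ 4 * (1 + ‖z‖ ^ 2) * ‖F z‖ := le_trans (by gcongr) h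
  rw [abs_mul, abs_of_pos hre, ← sq_abs z.im] at h2
  have h3 := mul_le_mul_of_nonneg_right (pow_four_mul_le_exp (norm_nonneg z)) (norm_nonneg (F z))
  have h4 : 0 ≤ ‖regQuot F (canonProd t s) z‖ * (z.re * |z.im| ^ 3) := by positivity
  have h5 : Real.pi * (‖regQuot F (canonProd t s) z‖ * (z.re * |z.im| ^ 3)) ≤
      Real.pi * (Real.exp (6 * ‖z‖) * ‖F z‖) := by
    nlinarith
  exact le_of_mul_le_mul_left h5 hpi

/-- Bound for the quotient near the positive real axis by the maximum principle on a disc. -/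
lemma norm_regQuot_le_of_circle {F : ℂ → ℂ} (hF : Differentiable ℂ F) {t s : ℕ → ℝ}
    (ht : Interlaced t) (hs : Interlaced s) (hinj : Function.Injective t)
    (hz : ∀ k, F ((1 / t k : ℝ) : ℂ) = 0) {S : ℝ} (hS : 0 ≤ S) {z : ℂ} (hx : 2 ≤ z.re)
    (hy : |z.im| ≤ 1)
    (h : ∀ w : ℂ, |w.re - z.re| ≤ 1 → |w.im| ≤ 1 → Real.exp (6 * ‖w‖) * ‖F w‖ ≤ S) :
    ‖regQuot F (canonProd t s) z‖ ≤ 8 * S := by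
  set x : ℂ := (z.re : ℂ)
  -- The crude bound loses `|Im w|³`. The cube of `(w - x)² - 1`, of modulus `(2 |Im w|)³` on the
  -- circle, removes this loss and produces the constant `8`.
  set q : ℂ → ℂ := fun w => regQuot F (canonProd t s) w * ((w - x) ^ 2 - 1) ^ 3
  have hzx : z - x = z.im * Complex.I := by apply Complex.ext <;> simp [x]
  have hq : ∀ w ∈ Metric.closedBall x 1, DifferentiableAt ℂ q w := by
    intro w hw
    have : 0 < w.re := by
      have h1 := (Complex.abs_re_le_norm (w - x)).trans (mem_closedBall_iff_norm.1 hw)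
      simp only [Complex.sub_re, x, Complex.ofReal_re] at h1
      linarith [(abs_le.1 h1).1]
    have := differentiableAt_regQuot_canonProd hF ht hs hinj hz (Or.inl this)
    simp only [q]
    fun_prop
  have hdc : DiffContOnCl ℂ q (Metric.ball x 1) := by
    refine ⟨fun w hw => (hq w (Metric.ball_subset_closedBall hw)).differentiableWithinAt, ?_⟩
    rw [closure_ball _ one_ne_zero]
    exact fun w hw => (hq w hw).continuousAt.continuousWithinAt
  have hbd : ∀ w ∈ frontier (Metric.ball x 1), ‖q w‖ ≤ 8 * S := by
    intro w hw
    rw [frontier_ball _ one_ne_zero, mem_sphere_iff_norm] at hw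
    have e1 : (w.re - z.re) ^ 2 + w.im ^ 2 = 1 := by
      have : ‖w - x‖ ^ 2 = (w.re - z.re) ^ 2 + w.im ^ 2 := by
        rw [Complex.sq_norm, Complex.normSq_apply]; simp [x]; ring
      rw [← this, hw]; norm_num
    have e2 : ‖(w - x) ^ 2 - 1‖ = 2 * |w.im| := by
      have e4 : w.im ^ 2 = 1 - (w.re - z.re) ^ 2 := by linarith
      rw [← sq_eq_sq₀ (norm_nonneg _) (by positivity), Complex.sq_norm, Complex.normSq_apply,
        mul_pow, sq_abs]
      simp [x, sq]
      simp only [← sq] at *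
      ring_nf
      have e5 : w.im ^ 4 = (w.im ^ 2) ^ 2 := by ring
      rw [e5, e4]
      ring
    have e3 : |w.re - z.re| ≤ 1 := by
      rw [← sq_le_one_iff_abs_le_one]; nlinarith [sq_nonneg w.im]
    have e4 : |w.im| ≤ 1 := by
      rw [← sq_le_one_iff_abs_le_one]; nlinarith [sq_nonneg (w.re - z.re)]
    have hw1 : 1 ≤ w.re := by linarith [(abs_le.1 e3).1]
    simp only [q, norm_mul, norm_pow]
    rw [e2]
    by_cases him : w.im = 0
    · rw [him]; simpa using hS
    · have h1 := norm_regQuot_mul_le_crude (F := F) ht hs (by linarith) him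
      have h2 := h w e3 e4
      have h3 : 0 ≤ ‖regQuot F (canonProd t s) w‖ * |w.im| ^ 3 := by positivity
      nlinarith
  have hcl : z ∈ closure (Metric.ball x 1) := by
    rw [closure_ball _ one_ne_zero, mem_closedBall_iff_norm, hzx, norm_mul, Complex.norm_I, mul_one,
      Complex.norm_real]
    exact hy
  have hmax := Complex.norm_le_of_forall_mem_frontier_norm_le Metric.isBounded_ball hdc hbd hcl
  have h1 : 1 ≤ ‖(z - x) ^ 2 - 1‖ := by
    rw [hzx, mul_pow, Complex.I_sq]
    have e : ((z.im : ℂ) ^ 2 * -1 - 1) = ((-(z.im ^ 2 + 1) : ℝ) : ℂ) := by push_cast; ring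
    rw [e, Complex.norm_real, Real.norm_eq_abs, abs_neg, abs_of_pos (by positivity)]
    nlinarith [sq_nonneg z.im]
  have h2 : 1 ≤ ‖(z - x) ^ 2 - 1‖ ^ 3 := one_le_pow₀ h1
  simp only [q, norm_mul, norm_pow] at hmax
  nlinarith [norm_nonneg (regQuot F (canonProd t s) z)]

/-- Used throughout to absorb polynomial and `e^{Lr}` losses into an arbitrarily small change of the
Gaussian rate. -/
lemma linear_le_sq {ε : ℝ} (hε : 0 < ε) (L r : ℝ) : L * r ≤ ε * r ^ 2 + L ^ 2 / (4 * ε) := by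
  have : 0 ≤ (2 * ε * r - L) ^ 2 / (4 * ε) := by positivity
  have e : (2 * ε * r - L) ^ 2 / (4 * ε) = ε * r ^ 2 - L * r + L ^ 2 / (4 * ε) := by
    field_simp; ring
  linarith

/-- A function of order two that decays like a Gaussian on the positive axis is controlled by
Gaussians in the sector `|arg z| ≤ π / 4`. -/
lemma norm_le_near_real_axis {F : ℂ → ℂ} (hF : Differentiable ℂ F) {C a B : ℝ} (hC : 0 ≤ C)
    (hreal : ∀ x : ℝ, 0 ≤ x → ‖F x‖ ≤ C * Real.exp (-a * x ^ 2))
    (hall : ∀ z, ‖F z‖ ≤ C * Real.exp (B * ‖z‖ ^ 2)) {z : ℂ} (hz : |z.im| ≤ z.re) :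
    ‖F z‖ ≤ C * Real.exp (-a * (z.re ^ 2 - z.im ^ 2) + B * (2 * (z.re * |z.im|))) := by
  have hpi := Real.pi_pos
  have hpol : z = polar ‖z‖ z.arg := (Complex.norm_mul_exp_arg_mul_I z).symm
  have hre : 0 ≤ z.re := (abs_nonneg _).trans hz
  have h2 := Complex.abs_arg_le_pi_div_two_iff.2 hre
  have e1 : ‖z‖ ^ 2 * Real.cos (2 * z.arg) = z.re ^ 2 - z.im ^ 2 := by
    rw [← polar_sq_re, ← hpol, sq, Complex.mul_re]; ring
  have e2 : ‖z‖ ^ 2 * Real.sin (2 * z.arg) = 2 * (z.re * z.im) := by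
    rw [← polar_sq_im, ← hpol, sq, Complex.mul_im]; ring
  have harg : |z.arg| ≤ Real.pi / 4 := by
    by_contra hcon
    push Not at hcon
    have hz0 : z ≠ 0 := by rintro rfl; simp at hcon; linarith
    have hn : 0 < ‖z‖ := norm_pos_iff.2 hz0
    have hneg : Real.cos (2 * |z.arg|) < 0 :=
      Real.cos_neg_of_pi_div_two_lt_of_lt (by linarith) (by linarith)
    have e3 : Real.cos (2 * |z.arg|) = Real.cos (2 * z.arg) := by
      rw [← Real.cos_abs (2 * z.arg), abs_mul, abs_two]
    have : z.im ^ 2 ≤ z.re ^ 2 := sq_le_sq.2 (by rwa [abs_of_nonneg hre])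
    rw [e3] at hneg
    nlinarith [mul_neg_of_pos_of_neg (pow_pos hn 2) hneg]
  have hb : ∀ r φ, 0 ≤ r → ‖F (polar r φ)‖ ≤ C * Real.exp (B * r ^ 2) := by
    intro r φ hr
    have := hall (polar r φ)
    rwa [norm_polar hr] at this
  have hcos : Real.cos (2 * (Real.pi / 4)) = 0 := by
    rw [show 2 * (Real.pi / 4) = Real.pi / 2 by ring, Real.cos_pi_div_two]
  have hsin : Real.sin (2 * (Real.pi / 4)) = 1 := by
    rw [show 2 * (Real.pi / 4) = Real.pi / 2 by ring, Real.sin_pi_div_two]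
  -- In each half-sector the comparison exponent `-a cos 2φ ± B sin 2φ` equals `-a` on the axis and
  -- `B` on the ray at angle `π/4`, matching the two available bounds.
  rcases le_total 0 z.im with him | him
  · have := norm_le_gaussian_of_sector (f := F) (α := 0) (β := Real.pi / 4) (-a) B (C := C) hC
      (by positivity) (by linarith) (fun _ _ _ _ _ => hF _) (fun r φ hr _ _ => hb r φ hr)
      (fun r hr => by
        have := hreal r hr
        rw [polar_zero_right]
        simpa [mul_comm] using this)
      (fun r hr => by
        have := hb r (Real.pi / 4) hr
        rw [hcos, hsin]
        simpa [mul_comm] using this)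
      (norm_nonneg z) (Complex.arg_nonneg_iff.2 him) (abs_le.1 harg).2
    rw [← hpol] at this
    rw [abs_of_nonneg him]
    convert this using 3
    linear_combination a * e1 - B * e2
  · have := norm_le_gaussian_of_sector (f := F) (α := -(Real.pi / 4)) (β := 0) (-a) (-B) (C := C) hC
      (by linarith) (by linarith) (fun _ _ _ _ _ => hF _) (fun r φ hr _ _ => hb r φ hr)
      (fun r hr => by
        have := hb r (-(Real.pi / 4)) hr
        rw [mul_neg, Real.cos_neg, Real.sin_neg, hcos, hsin]
        simpa [mul_comm] using this)
      (fun r hr => by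
        have := hreal r hr
        rw [polar_zero_right]
        simpa [mul_comm] using this)
      (norm_nonneg z) (abs_le.1 harg).1
        (by
          rcases him.eq_or_lt with h | h
          · rw [Complex.arg_eq_zero_iff.2 ⟨hre, h⟩]
          · exact (Complex.arg_neg_iff.2 h).le)
    rw [← hpol] at this
    rw [abs_of_nonpos him]
    convert this using 3
    linear_combination a * e1 + B * e2

lemma polar_re_pos_or_eq_zero {r φ θ : ℝ} (hr : 0 ≤ r) (hθ : θ < Real.pi / 2) (hφ : |φ| ≤ θ) :
    0 < (polar r φ).re ∨ polar r φ = 0 := by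
  rcases hr.eq_or_lt with rfl | hr
  · right; simp [polar]
  · left
    rw [polar_re]
    have := abs_le.1 hφ
    exact mul_pos hr (Real.cos_pos_of_mem_Ioo ⟨by linarith, by linarith⟩)

lemma exists_bound_on_compact_sector {G : ℂ → ℂ} {θ : ℝ}
    (hG : ∀ r φ, 0 ≤ r → |φ| ≤ θ → ContinuousAt G (polar r φ)) (R : ℝ) :
    ∃ M, 0 ≤ M ∧ ∀ r φ, 0 ≤ r → r ≤ R → |φ| ≤ θ → ‖G (polar r φ)‖ ≤ M := by
  have hK : IsCompact (Set.Icc 0 R ×ˢ Set.Icc (-θ) θ) := isCompact_Icc.prod isCompact_Icc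
  have hc : ContinuousOn (fun p : ℝ × ℝ => G (polar p.1 p.2)) (Set.Icc 0 R ×ˢ Set.Icc (-θ) θ) := by
    rintro ⟨r, φ⟩ ⟨⟨h1, h2⟩, h3, h4⟩
    refine ContinuousAt.continuousWithinAt ?_
    refine ContinuousAt.comp (f := fun p : ℝ × ℝ => polar p.1 p.2) (hG r φ h1 (abs_le.2 ⟨h3, h4⟩)) ?_
    unfold polar
    fun_prop
  obtain ⟨M, hM⟩ := hK.exists_bound_of_continuousOn hc
  refine ⟨max M 0, le_max_right _ _, fun r φ h1 h2 h3 => ?_⟩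
  exact (hM (r, φ) ⟨⟨h1, h2⟩, abs_le.1 h3⟩).trans (le_max_left _ _)

/-! ### Estimates for the quotient and the vanishing theorem -/

section

variable {F : ℂ → ℂ} {t s : ℕ → ℝ} {C a B θ : ℝ}

/-- Quadratic growth of the quotient in a sector. -/
lemma exists_regQuot_growth (hF : Differentiable ℂ F) (ht : Interlaced t) (hs : Interlaced s)
    (hinj : Function.Injective t) (hz : ∀ k, F ((1 / t k : ℝ) : ℂ) = 0) (hC : 0 ≤ C) (hB : 0 ≤ B)
    (hθ0 : 0 ≤ θ) (hθ : θ < Real.pi / 2) (hall : ∀ z, ‖F z‖ ≤ C * Real.exp (B * ‖z‖ ^ 2)) :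
    ∃ M B', 0 ≤ M ∧ ∀ r φ, 0 ≤ r → |φ| ≤ θ →
      ‖regQuot F (canonProd t s) (polar r φ)‖ ≤ M * Real.exp (B' * r ^ 2) := by
  have hG : ∀ r φ, 0 ≤ r → |φ| ≤ θ → ContinuousAt (regQuot F (canonProd t s)) (polar r φ) :=
    fun r φ hr hφ => (differentiableAt_regQuot_canonProd hF ht hs hinj hz
      (polar_re_pos_or_eq_zero hr hθ hφ)).continuousAt
  obtain ⟨M, hM0, hM⟩ := exists_bound_on_compact_sector hG 3
  have hc : 0 < Real.cos θ := Real.cos_pos_of_mem_Ioo ⟨by linarith, hθ⟩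
  -- The three summands serve `r ≤ 3`, points far from the axis (`Re z ≥ 3 cos θ` and `|Im z|³ ≥
  -- 1/8`), and points near it. For `r > 3` one has `(r+2)² ≤ 4r²` and `6(r+2) ≤ 12r²`, whence the
  -- rate.
  refine ⟨M + 8 / (3 * Real.cos θ) * C + 8 * C, 12 + 4 * B, by positivity, fun r φ hr hφ => ?_⟩
  have hE : 1 ≤ Real.exp ((12 + 4 * B) * r ^ 2) := Real.one_le_exp (by positivity)
  have hp1 : 0 ≤ 8 / (3 * Real.cos θ) * C := by positivity
  by_cases hr3 : r ≤ 3
  · have := hM r φ hr hr3 hφ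
    nlinarith
  push Not at hr3
  set z := polar r φ with hzdef
  have hn : ‖z‖ = r := norm_polar hr φ
  have hexp : Real.exp (6 * (r + 2)) * Real.exp (B * (r + 2) ^ 2) ≤
      Real.exp ((12 + 4 * B) * r ^ 2) := by
    rw [← Real.exp_add]
    apply Real.exp_le_exp.2
    have : (r + 2) ^ 2 ≤ 4 * r ^ 2 := by nlinarith
    nlinarith
  have hcosφ : Real.cos θ ≤ Real.cos φ := by
    rw [← Real.cos_abs φ]
    exact Real.cos_le_cos_of_nonneg_of_le_pi (abs_nonneg _) (by linarith) hφ
  have hx : 3 * Real.cos θ ≤ z.re := by rw [hzdef, polar_re]; gcongr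
  by_cases hy : |z.im| ≤ 1 / 2
  · have hx2 : 2 ≤ z.re := by
      have h1 : z.re ^ 2 + z.im ^ 2 = r ^ 2 := by
        rw [← hn, Complex.sq_norm, Complex.normSq_apply]; ring
      have h2 : z.im ^ 2 ≤ 1 := by rw [← sq_abs]; nlinarith [abs_nonneg z.im]
      by_contra hcon
      push Not at hcon
      have : 0 < z.re := by linarith
      nlinarith
    have := norm_regQuot_le_of_circle hF ht hs hinj hz
      (S := C * (Real.exp (6 * (r + 2)) * Real.exp (B * (r + 2) ^ 2))) (by positivity) hx2
      (by linarith) (fun w h1 h2 => by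
        have hxr : z.re ≤ r := by rw [← hn]; exact Complex.re_le_norm z
        have hw : ‖w‖ ≤ r + 2 := by
          refine (Complex.norm_le_abs_re_add_abs_im w).trans ?_
          have : |w.re| ≤ z.re + 1 := abs_le.2 ⟨by linarith [(abs_le.1 h1).1],
            by linarith [(abs_le.1 h1).2]⟩
          linarith
        calc Real.exp (6 * ‖w‖) * ‖F w‖ ≤
            Real.exp (6 * (r + 2)) * (C * Real.exp (B * (r + 2) ^ 2)) := by
              gcongr
              exact (hall w).trans (by gcongr)
          _ = _ := by ring)
    refine this.trans ?_
    have : C * (Real.exp (6 * (r + 2)) * Real.exp (B * (r + 2) ^ 2)) ≤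
      C * Real.exp ((12 + 4 * B) * r ^ 2) := by gcongr
    nlinarith
  · push Not at hy
    have him : z.im ≠ 0 := by intro h; rw [h] at hy; norm_num at hy
    have hre : 0 < z.re := lt_of_lt_of_le (by positivity) hx
    have h1 := norm_regQuot_mul_le_crude (F := F) ht hs hre him
    have h2 : 3 * Real.cos θ / 8 ≤ z.re * |z.im| ^ 3 := by
      have : (1 / 2 : ℝ) ^ 3 ≤ |z.im| ^ 3 := by gcongr
      nlinarith
    have h3 : Real.exp (6 * ‖z‖) * ‖F z‖ ≤ C * Real.exp ((12 + 4 * B) * r ^ 2) := by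
      calc Real.exp (6 * ‖z‖) * ‖F z‖ ≤
            Real.exp (6 * (r + 2)) * (C * Real.exp (B * (r + 2) ^ 2)) := by
              have := hall z
              rw [hn] at this ⊢
              gcongr
              · linarith
              · exact this.trans (by gcongr; linarith)
          _ = C * (Real.exp (6 * (r + 2)) * Real.exp (B * (r + 2) ^ 2)) := by ring
          _ ≤ _ := by gcongr
    have h4 : ‖regQuot F (canonProd t s) z‖ * (3 * Real.cos θ / 8) ≤
        C * Real.exp ((12 + 4 * B) * r ^ 2) :=
      (mul_le_mul_of_nonneg_left h2 (norm_nonneg _)).trans (h1.trans h3)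
    rw [← le_div_iff₀ (by positivity)] at h4
    refine h4.trans ?_
    have e : C * Real.exp ((12 + 4 * B) * r ^ 2) / (3 * Real.cos θ / 8) =
      8 / (3 * Real.cos θ) * C * Real.exp ((12 + 4 * B) * r ^ 2) := by field_simp
    rw [e]
    gcongr
    nlinarith

/-- Gaussian decay of the quotient on the positive axis. -/
lemma exists_regQuot_real_decay (hF : Differentiable ℂ F) (ht : Interlaced t) (hs : Interlaced s)
    (hinj : Function.Injective t) (hz : ∀ k, F ((1 / t k : ℝ) : ℂ) = 0) (hC : 0 ≤ C) (hB : 0 ≤ B)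
    (ha : 0 ≤ a) (hall : ∀ z, ‖F z‖ ≤ C * Real.exp (B * ‖z‖ ^ 2))
    (hreal : ∀ x : ℝ, 0 ≤ x → ‖F x‖ ≤ C * Real.exp (-a * x ^ 2)) {a' : ℝ} (ha' : a' < a) :
    ∃ M, 0 ≤ M ∧ ∀ x : ℝ, 0 ≤ x →
      ‖regQuot F (canonProd t s) x‖ ≤ M * Real.exp (-a' * x ^ 2) := by
  have hG : ∀ r φ, 0 ≤ r → |φ| ≤ 0 → ContinuousAt (regQuot F (canonProd t s)) (polar r φ) :=
    fun r φ hr hφ => (differentiableAt_regQuot_canonProd hF ht hs hinj hz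
      (polar_re_pos_or_eq_zero hr (by positivity) hφ)).continuousAt
  obtain ⟨M, hM0, hM⟩ := exists_bound_on_compact_sector hG 2
  -- On the unit disc about `x` the exponent is at most `6(x+2) - a((x-1)² - 1) + 2B(x+1)`; here `L`
  -- is its linear coefficient and `12 + 2B` its constant term. The spare rate `a - a'` absorbs `L
  -- x`.
  set L := 6 + 2 * a + 2 * B
  set K := L ^ 2 / (4 * (a - a')) + (12 + 2 * B) with hK
  refine ⟨M * Real.exp (|a'| * 4) + 8 * (C * Real.exp K), by positivity, fun x hx => ?_⟩
  by_cases hx2 : x ≤ 2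
  · have h1 := hM x 0 hx hx2 (by simp)
    rw [polar_zero_right] at h1
    have h2 : 1 ≤ Real.exp (|a'| * 4) * Real.exp (-a' * x ^ 2) := by
      rw [← Real.exp_add]
      apply Real.one_le_exp
      have : x ^ 2 ≤ 4 := by nlinarith
      nlinarith [le_abs_self a', abs_nonneg a', sq_nonneg x]
    have h3 : 0 ≤ 8 * (C * Real.exp K) * Real.exp (-a' * x ^ 2) := by positivity
    nlinarith
  · push Not at hx2
    have := norm_regQuot_le_of_circle hF ht hs hinj hz
      (S := C * (Real.exp K * Real.exp (-a' * x ^ 2))) (z := x) (by positivity) (by simpa using hx2.le)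
      (by simp) (fun w h1 h2 => by
        rw [Complex.ofReal_re] at h1
        obtain ⟨h3, h4⟩ := abs_le.1 h1
        have hw : ‖w‖ ≤ x + 2 := by
          refine (Complex.norm_le_abs_re_add_abs_im w).trans ?_
          have : |w.re| ≤ x + 1 := abs_le.2 ⟨by linarith, by linarith⟩
          linarith
        have hFw := norm_le_near_real_axis hF hC hreal hall (z := w) (by linarith)
        have e1 : (x - 1) ^ 2 - 1 ≤ w.re ^ 2 - w.im ^ 2 := by
          have : w.im ^ 2 ≤ 1 := by rw [← sq_abs]; nlinarith [abs_nonneg w.im]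
          nlinarith
        have e2 : w.re * |w.im| ≤ (x + 1) * 1 := by
          gcongr; linarith
        have e3 : 6 * ‖w‖ + (-a * (w.re ^ 2 - w.im ^ 2) + B * (2 * (w.re * |w.im|))) ≤
            K + -a' * x ^ 2 := by
          have l1 := linear_le_sq (sub_pos.2 ha') L x
          have l2 := mul_le_mul_of_nonneg_left e1 ha
          have l3 := mul_le_mul_of_nonneg_left e2 hB
          rw [hK]
          simp only [L] at l1 ⊢
          nlinarith
        calc Real.exp (6 * ‖w‖) * ‖F w‖ ≤ Real.exp (6 * ‖w‖) * (C * Real.exp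
              (-a * (w.re ^ 2 - w.im ^ 2) + B * (2 * (w.re * |w.im|)))) := by gcongr
          _ = C * Real.exp (6 * ‖w‖ +
              (-a * (w.re ^ 2 - w.im ^ 2) + B * (2 * (w.re * |w.im|)))) := by
                rw [Real.exp_add (6 * ‖w‖)]; ring
          _ ≤ C * Real.exp (K + -a' * x ^ 2) := by gcongr
          _ = _ := by rw [Real.exp_add])
    refine this.trans ?_
    have h3 : 0 ≤ M * Real.exp (|a'| * 4) * Real.exp (-a' * x ^ 2) := by positivity
    nlinarith

/-- Decay of the quotient on the two rays bounding a sector. -/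
lemma exists_regQuot_ray_decay (hF : Differentiable ℂ F) (ht : Interlaced t) (hs : Interlaced s)
    (hinj : Function.Injective t) (hz : ∀ k, F ((1 / t k : ℝ) : ℂ) = 0) (hC : 0 ≤ C)
    (hθ0 : 0 < θ) (hθ : θ < Real.pi / 2) {κ δ : ℝ} (hδ : 0 < δ)
    (hray : ∀ r φ, 0 ≤ r → |φ| = θ → ‖F (polar r φ)‖ ≤ C * Real.exp (κ * r ^ 2)) :
    ∃ M, 0 ≤ M ∧ ∀ r φ, 0 ≤ r → |φ| = θ → ‖regQuot F (canonProd t s) (polar r φ)‖ ≤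
      M * Real.exp ((κ - Real.pi * Real.sin (2 * θ) + δ) * r ^ 2) := by
  have hpi := Real.pi_pos
  have hG : ∀ r φ, 0 ≤ r → |φ| ≤ θ → ContinuousAt (regQuot F (canonProd t s)) (polar r φ) :=
    fun r φ hr hφ => (differentiableAt_regQuot_canonProd hF ht hs hinj hz
      (polar_re_pos_or_eq_zero hr hθ hφ)).continuousAt
  obtain ⟨M, hM0, hM⟩ := exists_bound_on_compact_sector hG 1
  have hc : 0 < Real.cos θ := Real.cos_pos_of_mem_Ioo ⟨by linarith, hθ⟩
  have hsn : 0 < Real.sin θ := Real.sin_pos_of_pos_of_lt_pi hθ0 (by linarith)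
  -- The exponent of growth of `|sin πz²|` on the ray, which division by the canonical product
  -- gains.
  set τ := Real.pi * Real.sin (2 * θ) with hτ
  have hτe : τ = 2 * Real.pi * (Real.cos θ * Real.sin θ) := by rw [hτ, Real.sin_two_mul]; ring
  have hτ0 : 0 < τ := by rw [hτe]; positivity
  have hτ4 : τ ≤ 4 := by nlinarith [Real.sin_le_one (2 * θ), Real.pi_le_four]
  set ω := κ - τ + δ with hω
  set D := Real.pi * C / (τ * Real.sin θ ^ 2) with hD
  have hD0 : 0 ≤ D := by positivity
  refine ⟨M * Real.exp |ω| + D * Real.exp (10 ^ 2 / (4 * δ)), by positivity, fun r φ hr hφ => ?_⟩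
  by_cases hr1 : r ≤ 1
  · have h1 := hM r φ hr hr1 hφ.le
    have h2 : 1 ≤ Real.exp |ω| * Real.exp (ω * r ^ 2) := by
      rw [← Real.exp_add]
      apply Real.one_le_exp
      have : r ^ 2 ≤ 1 := by nlinarith
      nlinarith [neg_abs_le ω, abs_nonneg ω, sq_nonneg r]
    have h3 : 0 ≤ D * Real.exp (10 ^ 2 / (4 * δ)) * Real.exp (ω * r ^ 2) := by positivity
    nlinarith
  push Not at hr1
  set z := polar r φ with hzdef
  have hn : ‖z‖ = r := norm_polar hr φ
  have hcφ : Real.cos φ = Real.cos θ := by rw [← hφ, Real.cos_abs]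
  have hsφ : |Real.sin φ| = Real.sin θ := by
    rcases abs_cases φ with ⟨h, _⟩ | ⟨h, _⟩
    · rw [h] at hφ; rw [hφ, abs_of_pos hsn]
    · rw [h] at hφ; rw [← hφ, Real.sin_neg, abs_of_neg]
      rw [← hφ, Real.sin_neg] at hsn; linarith
  have hzre : z.re = r * Real.cos θ := by rw [hzdef, polar_re, hcφ]
  have hzim : |z.im| = r * Real.sin θ := by rw [hzdef, polar_im, abs_mul, hsφ, abs_of_nonneg hr]
  have hre : 0 < z.re := by rw [hzre]; positivity
  have him : z.im ≠ 0 := by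
    rw [← abs_pos, hzim]; positivity
  have hT : 2 * Real.pi * |z.re * z.im| = τ * r ^ 2 := by
    rw [abs_mul, hzim, hzre, abs_of_pos (by positivity), hτe]; ring
  have h1 := norm_regQuot_mul_le (F := F) ht hs hre him
  rw [hT, hn, ← sq_abs z.im, hzim] at h1
  set g := ‖regQuot F (canonProd t s) z‖ with hg
  have hg0 : 0 ≤ g := norm_nonneg _
  have hT0 : 0 ≤ τ * r ^ 2 := by positivity
  have h2 := exp_mul_self_le_sinh (τ * r ^ 2)
  -- The two polynomial losses cost `e^{4r}` and `e^{6r}`, hence the `10` in the constant.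
  have h3 : 1 + 2 * (τ * r ^ 2) ≤ Real.exp (4 * r) := by
    have := Real.quadratic_le_exp_of_nonneg (x := 4 * r) (by positivity)
    nlinarith [sq_nonneg r]
  have h4 := pow_four_mul_le_exp hr
  have h5 := hray r φ hr hφ
  have h6 : g * (τ * Real.sin θ ^ 2) * Real.exp (τ * r ^ 2) ≤
      Real.pi * C * Real.exp (10 * r) * Real.exp (κ * r ^ 2) := by
    calc g * (τ * Real.sin θ ^ 2) * Real.exp (τ * r ^ 2)
        ≤ r ^ 4 * (g * (τ * Real.sin θ ^ 2) * Real.exp (τ * r ^ 2)) :=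
          le_mul_of_one_le_left (by positivity) (one_le_pow₀ hr1.le)
      _ = g * (r * Real.sin θ) ^ 2 * (Real.exp (τ * r ^ 2) * (τ * r ^ 2)) := by ring
      _ ≤ g * (r * Real.sin θ) ^ 2 * ((1 + 2 * (τ * r ^ 2)) * Real.sinh (τ * r ^ 2)) := by gcongr
      _ = (1 + 2 * (τ * r ^ 2)) * (g * ((r * Real.sin θ) ^ 2 * Real.sinh (τ * r ^ 2))) := by ring
      _ ≤ (1 + 2 * (τ * r ^ 2)) * (Real.pi * r ^ 4 * (1 + r ^ 2) * ‖F z‖) := by gcongr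
      _ = Real.pi * ((1 + 2 * (τ * r ^ 2)) * (r ^ 4 * (1 + r ^ 2)) * ‖F z‖) := by ring
      _ ≤ Real.pi * (Real.exp (4 * r) * Real.exp (6 * r) * (C * Real.exp (κ * r ^ 2))) := by gcongr
      _ = _ := by rw [← Real.exp_add]; ring_nf
  have h7 : Real.exp (10 * r) ≤ Real.exp (δ * r ^ 2) * Real.exp (10 ^ 2 / (4 * δ)) := by
    rw [← Real.exp_add]
    exact Real.exp_le_exp.2 (linear_le_sq hδ 10 r)
  have h8 : g ≤ D * Real.exp (10 ^ 2 / (4 * δ)) * Real.exp (ω * r ^ 2) := by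
    have e : Real.exp (ω * r ^ 2) * Real.exp (τ * r ^ 2) =
        Real.exp (κ * r ^ 2) * Real.exp (δ * r ^ 2) := by
      rw [← Real.exp_add, ← Real.exp_add, hω]; ring_nf
    have hpos : 0 < τ * Real.sin θ ^ 2 * Real.exp (τ * r ^ 2) := by positivity
    refine le_of_mul_le_mul_right ?_ hpos
    calc g * (τ * Real.sin θ ^ 2 * Real.exp (τ * r ^ 2))
        ≤ Real.pi * C * Real.exp (10 * r) * Real.exp (κ * r ^ 2) := by rw [← mul_assoc]; exact h6
      _ ≤ Real.pi * C * (Real.exp (δ * r ^ 2) * Real.exp (10 ^ 2 / (4 * δ))) *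
          Real.exp (κ * r ^ 2) := by gcongr
      _ = Real.pi * C * Real.exp (10 ^ 2 / (4 * δ)) *
          (Real.exp (ω * r ^ 2) * Real.exp (τ * r ^ 2)) := by rw [e]; ring
      _ = _ := by rw [hD]; field_simp
  refine h8.trans ?_
  gcongr
  have : 0 ≤ M * Real.exp |ω| := by positivity
  linarith

/-- An entire function of order two with Gaussian decay on the positive axis and too many zeros on
that axis vanishes there. -/
theorem eq_zero_of_gaussian_decay_of_zeros (hF : Differentiable ℂ F) (ht : Interlaced t)
    (hinj : Function.Injective t) (hz : ∀ k, F ((1 / t k : ℝ) : ℂ) = 0) (hC : 0 ≤ C) (hB : 0 ≤ B)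
    (ha : 0 ≤ a) (hall : ∀ z, ‖F z‖ ≤ C * Real.exp (B * ‖z‖ ^ 2))
    (hreal : ∀ x : ℝ, 0 ≤ x → ‖F x‖ ≤ C * Real.exp (-a * x ^ 2))
    (hθ0 : Real.pi / 4 ≤ θ) (hθ : θ < Real.pi / 2) {κ : ℝ}
    (hray : ∀ r φ, 0 ≤ r → |φ| = θ → ‖F (polar r φ)‖ ≤ C * Real.exp (κ * r ^ 2))
    (hneg : κ + a * Real.cos (2 * θ) - Real.pi * Real.sin (2 * θ) < 0) {x : ℝ} (hx : 0 < x) :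
    F x = 0 := by
  have hpi := Real.pi_pos
  -- The negative zeros of the product are immaterial in the right half-plane; the lattice is a
  -- convenient choice.
  have hs := Interlaced.recipSqrt
  set G := regQuot F (canonProd t recipSqrt) with hGdef
  -- A quarter of the deficit: the ray estimate spends one `β`, lowering `a` to `a'` at most
  -- another, and decay at rate `β` still remains on the rays.
  set β := -(κ + a * Real.cos (2 * θ) - Real.pi * Real.sin (2 * θ)) / 4 with hβ
  have hβ0 : 0 < β := by rw [hβ]; linarith
  set a' := a - β with ha'
  have hθpos : 0 < θ := by linarith
  obtain ⟨M1, hM1, h1⟩ := exists_regQuot_real_decay hF ht hs hinj hz hC hB ha hall hreal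
    (a' := a') (by linarith)
  obtain ⟨M2, hM2, h2⟩ := exists_regQuot_ray_decay hF ht hs hinj hz hC hθpos hθ hβ0 hray
  obtain ⟨M3, B', hM3, h3⟩ := exists_regQuot_growth hF ht hs hinj hz hC hB hθpos.le hθ hall
  set K : ℂ → ℂ := fun z => G z * Complex.exp (((a' : ℝ) + (0 : ℝ) * Complex.I) * z ^ 2) with hK
  have hKn : ∀ r φ, ‖K (polar r φ)‖ =
      ‖G (polar r φ)‖ * Real.exp (r ^ 2 * (a' * Real.cos (2 * φ))) := by
    intro r φ
    rw [hK]
    simp only [norm_mul]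
    rw [norm_exp_polar_sq]
    simp
  have hKd : ∀ r φ, 0 ≤ r → |φ| ≤ θ → DifferentiableAt ℂ K (polar r φ) := fun r φ hr hφ =>
    (differentiableAt_regQuot_canonProd hF ht hs hinj hz
      (polar_re_pos_or_eq_zero hr hθ hφ)).mul (by fun_prop)
  set M := M1 + M2 with hM
  have hM0 : 0 ≤ M := by positivity
  have k1 : ∀ r, 0 ≤ r → ‖K (polar r 0)‖ ≤ M := by
    intro r hr
    rw [hKn, polar_zero_right]
    have := h1 r hr
    calc ‖G r‖ * Real.exp (r ^ 2 * (a' * Real.cos (2 * 0)))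
        ≤ M1 * Real.exp (-a' * r ^ 2) * Real.exp (r ^ 2 * (a' * Real.cos (2 * 0))) := by gcongr
      _ = M1 := by
        have e : -a' * r ^ 2 + r ^ 2 * (a' * Real.cos (2 * 0)) = 0 := by
          rw [mul_zero, Real.cos_zero]; ring
        rw [mul_assoc, ← Real.exp_add, e, Real.exp_zero, mul_one]
      _ ≤ M := by linarith
  have k2 : ∀ r φ, 0 ≤ r → |φ| = θ → ‖K (polar r φ)‖ ≤ M * Real.exp (-β * r ^ 2) := by
    intro r φ hr hφ
    have := h2 r φ hr hφ
    rw [hKn]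
    have hcos : Real.cos (2 * φ) = Real.cos (2 * θ) := by
      rw [← hφ, ← Real.cos_abs (2 * φ), abs_mul, abs_two]
    calc ‖G (polar r φ)‖ * Real.exp (r ^ 2 * (a' * Real.cos (2 * φ)))
        ≤ M2 * Real.exp ((κ - Real.pi * Real.sin (2 * θ) + β) * r ^ 2) *
          Real.exp (r ^ 2 * (a' * Real.cos (2 * φ))) := by gcongr
      _ ≤ M2 * Real.exp (-β * r ^ 2) := by
        rw [mul_assoc, ← Real.exp_add, hcos]
        gcongr
        have hc := Real.neg_one_le_cos (2 * θ)
        have : κ - Real.pi * Real.sin (2 * θ) + β + a' * Real.cos (2 * θ) ≤ -β := by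
          rw [ha']; nlinarith
        nlinarith [sq_nonneg r]
      _ ≤ _ := by gcongr; linarith
  have k3 : ∀ r φ, 0 ≤ r → |φ| ≤ θ → ‖K (polar r φ)‖ ≤ M3 * Real.exp ((B' + |a'|) * r ^ 2) := by
    intro r φ hr hφ
    have := h3 r φ hr hφ
    rw [hKn]
    calc ‖G (polar r φ)‖ * Real.exp (r ^ 2 * (a' * Real.cos (2 * φ)))
        ≤ M3 * Real.exp (B' * r ^ 2) * Real.exp (r ^ 2 * |a'|) := by
          gcongr
          calc a' * Real.cos (2 * φ) ≤ |a' * Real.cos (2 * φ)| := le_abs_self _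
            _ = |a'| * |Real.cos (2 * φ)| := abs_mul _ _
            _ ≤ |a'| * 1 := by gcongr; exact Real.abs_cos_le_one _
            _ = _ := mul_one _
      _ = _ := by rw [mul_assoc, ← Real.exp_add]; ring_nf
  have hsin0 : 0 ≤ Real.sin (2 * θ) :=
    Real.sin_nonneg_of_nonneg_of_le_pi (by linarith) (by linarith)
  have hsin1 := Real.sin_le_one (2 * θ)
  -- The exponent `-β sin 2φ` vanishes on the axis, where `K` is bounded, and is at least `-β` on
  -- the ray at `θ`, where `K` decays at rate `β`.
  have k4 : ∀ r φ, 0 ≤ r → 0 ≤ φ → φ ≤ θ →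
      ‖K (polar r φ)‖ ≤ M * Real.exp (r ^ 2 * (-β * Real.sin (2 * φ))) := by
    intro r φ hr hφ0 hφ
    have := norm_le_gaussian_of_sector (f := K) (α := 0) (β := θ) (p := 0) (q := -β) (C := M)
      (B := B' + |a'|) hM3 hθpos (by linarith)
      (fun r φ hr h h' => hKd r φ hr (abs_le.2 ⟨by linarith, h'⟩))
      (fun r φ hr h h' => k3 r φ hr (abs_le.2 ⟨by linarith, h'⟩))
      (fun r hr => by simpa using k1 r hr)
      (fun r hr => (k2 r θ hr (abs_of_pos hθpos)).trans (by
        refine mul_le_mul_of_nonneg_left (Real.exp_le_exp.2 ?_) hM0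
        nlinarith [sq_nonneg r, mul_nonneg hβ0.le (sq_nonneg r)])) hr hφ0 hφ
    simpa using this
  have k5 : ∀ r φ, 0 ≤ r → -θ ≤ φ → φ ≤ 0 →
      ‖K (polar r φ)‖ ≤ M * Real.exp (r ^ 2 * (β * Real.sin (2 * φ))) := by
    intro r φ hr hφ0 hφ
    have := norm_le_gaussian_of_sector (f := K) (α := -θ) (β := 0) (p := 0) (q := β) (C := M)
      (B := B' + |a'|) hM3 (by linarith) (by linarith)
      (fun r φ hr h h' => hKd r φ hr (abs_le.2 ⟨h, by linarith⟩))
      (fun r φ hr h h' => k3 r φ hr (abs_le.2 ⟨h, by linarith⟩))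
      (fun r hr => (k2 r (-θ) hr (by rw [abs_neg, abs_of_pos hθpos])).trans (by
        refine mul_le_mul_of_nonneg_left (Real.exp_le_exp.2 ?_) hM0
        rw [mul_neg 2 θ, Real.sin_neg]
        nlinarith [sq_nonneg r, mul_nonneg hβ0.le (sq_nonneg r)]))
      (fun r hr => by simpa using k1 r hr) hr hφ0 hφ
    simpa using this
  -- Choose `ψ` with `β sin 2ψ = m cos 2ψ`. On the rays `±ψ` the decay just found is that of `e^{-m
  -- z²}`, so it spreads to the axis between them with the same constant `M`. Since `ψ < π/4 ≤ θ`,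
  -- the thin sector lies inside the large one.
  have k6 : ∀ m : ℝ, 0 < m → ‖K x‖ ≤ M * Real.exp (-m * x ^ 2) := by
    intro m hm
    set ψ := Real.arctan (m / β) / 2 with hψ
    have hψ0 : 0 < ψ := by
      have := Real.arctan_pos.2 (div_pos hm hβ0); positivity
    have hψ1 : ψ < Real.pi / 4 := by
      have := Real.arctan_lt_pi_div_two (m / β); linarith
    have hbal : β * Real.sin (2 * ψ) = m * Real.cos (2 * ψ) := by
      have hc : Real.cos (2 * ψ) ≠ 0 :=
        (Real.cos_pos_of_mem_Ioo ⟨by linarith, by linarith⟩).ne'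
      have : Real.tan (2 * ψ) = m / β := by
        rw [hψ, mul_div_cancel₀ _ two_ne_zero, Real.tan_arctan]
      rw [Real.tan_eq_sin_div_cos, div_eq_div_iff hc hβ0.ne'] at this
      linarith
    have := norm_le_gaussian_of_sector (f := K) (α := -ψ) (β := ψ) (p := -m) (q := 0) (C := M)
      (B := B' + |a'|) hM3 (by linarith) (by linarith)
      (fun r φ hr h h' => hKd r φ hr (abs_le.2 ⟨by linarith, by linarith⟩))
      (fun r φ hr h h' => k3 r φ hr (abs_le.2 ⟨by linarith, by linarith⟩))
      (fun r hr => by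
        have := k5 r (-ψ) hr (by linarith) (by linarith)
        rw [mul_neg 2 ψ, Real.sin_neg, mul_neg, hbal] at this
        rw [mul_neg 2 ψ, Real.cos_neg]
        simpa using this)
      (fun r hr => by
        have := k4 r ψ hr hψ0.le (by linarith)
        rw [neg_mul, hbal] at this
        simpa using this) hx.le (φ := 0) (by linarith) hψ0.le
    rw [polar_zero_right] at this
    simpa [mul_comm] using this
  have hKx : K x = 0 := by
    rw [← norm_le_zero_iff]
    have hlim : Tendsto (fun m : ℝ => M * Real.exp (-m * x ^ 2)) atTop (nhds (M * 0)) := by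
      refine Tendsto.const_mul _ (Real.tendsto_exp_atBot.comp ?_)
      exact tendsto_neg_atTop_atBot.atBot_mul_const (by positivity)
    rw [mul_zero] at hlim
    exact ge_of_tendsto hlim ((eventually_gt_atTop 0).mono fun m hm => k6 m hm)
  have hGx : G x = 0 := by
    simpa [hK] using hKx
  -- At a zero of the product the quotient says nothing about `F x`, but there `x` is one of the
  -- prescribed zeros of `F`.
  by_cases hP : canonProd t recipSqrt x = 0
  · by_contra hFx
    have : ∃ k, 1 - (x : ℂ) * t k = 0 := by
      by_contra hcon
      push Not at hcon
      exact canonProd_ne_zero ht hs (fun k =>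
        one_add_canonTerm_ne_zero hs (by simpa using hx) (hcon k)) hP
    obtain ⟨k, hk⟩ := this
    apply hFx
    have htk : (t k : ℂ) ≠ 0 := by exact_mod_cast (ht.pos k).ne'
    have : (x : ℂ) = ((1 / t k : ℝ) : ℂ) := by
      push_cast
      rw [eq_div_iff htk]
      exact (sub_eq_zero.1 hk).symm
    rw [this]
    exact hz k
  · rw [hGdef, regQuot_of_ne hP, div_eq_zero_iff] at hGx
    exact hGx.resolve_right hP

end

/-! ### Entire extension of the Hardy class -/

lemma integrable_exp_neg_sq_add {b : ℝ} (hb : 0 < b) (c : ℝ) :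
    MeasureTheory.Integrable fun x : ℝ => Real.exp (-b * x ^ 2 + c * x) := by
  have h := (integrable_exp_neg_mul_sq hb).comp_add_right (-(c / (2 * b)))
  refine (h.const_mul (Real.exp (c ^ 2 / (4 * b)))).congr (.of_forall fun x => ?_)
  simp only
  rw [← Real.exp_add]
  congr 1
  field_simp
  ring

lemma integral_exp_neg_sq_add {b : ℝ} (hb : 0 < b) (c : ℝ) :
    ∫ x : ℝ, Real.exp (-b * x ^ 2 + c * x) =
      Real.exp (c ^ 2 / (4 * b)) * ∫ x : ℝ, Real.exp (-b * x ^ 2) := by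
  rw [← MeasureTheory.integral_add_right_eq_self (fun x : ℝ => Real.exp (-b * x ^ 2))
    (-(c / (2 * b))), ← MeasureTheory.integral_const_mul]
  congr 1
  funext x
  rw [← Real.exp_add]
  congr 1
  field_simp
  ring

/-- The Fourier–Laplace transform of a function with Gaussian decay is entire, with an explicit
Gaussian bound. -/
lemma fourierLaplace_entire {φ : ℝ → ℂ} (hφ : Continuous φ) {M b : ℝ} (hb : 0 < b)
    (hM : ∀ x, ‖φ x‖ ≤ M * Real.exp (-b * x ^ 2)) :
    Differentiable ℂ (fun z : ℂ => ∫ x : ℝ, Complex.exp (2 * Real.pi * x * z * Complex.I) * φ x) ∧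
    ∀ z : ℂ, ‖∫ x : ℝ, Complex.exp (2 * Real.pi * x * z * Complex.I) * φ x‖ ≤
      (M * ∫ x : ℝ, Real.exp (-b * x ^ 2)) * Real.exp (Real.pi ^ 2 * z.im ^ 2 / b) := by
  have hpi := Real.pi_pos
  have hM0 : 0 ≤ M := by simpa using (norm_nonneg _).trans (hM 0)
  have hexp : ∀ (x : ℝ) (z : ℂ), ‖Complex.exp (2 * Real.pi * x * z * Complex.I)‖ =
      Real.exp (-(2 * Real.pi * z.im) * x) := by
    intro x z
    rw [Complex.norm_exp]
    congr 1
    simp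
    ring
  have hint : ∀ z : ℂ, ∀ x : ℝ, ‖Complex.exp (2 * Real.pi * x * z * Complex.I) * φ x‖ ≤
      M * Real.exp (-b * x ^ 2 + -(2 * Real.pi * z.im) * x) := by
    intro z x
    rw [norm_mul, hexp, Real.exp_add]
    calc _ ≤ Real.exp (-(2 * Real.pi * z.im) * x) * (M * Real.exp (-b * x ^ 2)) := by
          gcongr; exact hM x
      _ = _ := by ring
  have hcont : ∀ z : ℂ, Continuous fun x : ℝ =>
      Complex.exp (2 * Real.pi * x * z * Complex.I) * φ x := fun z => by fun_prop
  constructor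
  · intro z
    -- The first summand bounds the exponential on the unit ball about `z`; the second pays for the
    -- factor `2π|x|` produced by differentiation.
    set c := 2 * Real.pi * (|z.im| + 1) + 2 * Real.pi with hc
    have := hasDerivAt_integral_of_dominated_loc_of_deriv_le (𝕜 := ℂ)
      (μ := MeasureTheory.volume)
      (F := fun (w : ℂ) (x : ℝ) => Complex.exp (2 * Real.pi * x * w * Complex.I) * φ x)
      (F' := fun (w : ℂ) (x : ℝ) => Complex.exp (2 * Real.pi * x * w * Complex.I) *
        (2 * Real.pi * x * Complex.I) * φ x) (x₀ := z)
      (bound := fun x => M * (Real.exp (-b * x ^ 2 + c * x) + Real.exp (-b * x ^ 2 + -c * x)))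
      (Metric.ball_mem_nhds z one_pos)
      (.of_forall fun w => (hcont w).aestronglyMeasurable)
      (((integrable_exp_neg_sq_add hb _).const_mul M).mono' (hcont z).aestronglyMeasurable
        (.of_forall (hint z)))
      (by
        refine Continuous.aestronglyMeasurable ?_
        fun_prop)
      (.of_forall fun x w hw => by
        have hw1 : |w.im| ≤ |z.im| + 1 := by
          have h1 := (Complex.abs_im_le_norm (w - z)).trans (mem_ball_iff_norm.1 hw).le
          rw [Complex.sub_im] at h1
          have := abs_sub_abs_le_abs_sub w.im z.im
          linarith
        have e1 : ‖(2 * Real.pi * x * Complex.I : ℂ)‖ = 2 * Real.pi * |x| := by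
          simp [abs_of_pos hpi]
        rw [norm_mul, norm_mul, hexp, e1]
        have e2 : 2 * Real.pi * |x| ≤ Real.exp (2 * Real.pi * |x|) := by
          linarith [Real.add_one_le_exp (2 * Real.pi * |x|)]
        have e3 : -(2 * Real.pi * w.im) * x ≤ 2 * Real.pi * (|z.im| + 1) * |x| := by
          calc -(2 * Real.pi * w.im) * x ≤ |-(2 * Real.pi * w.im) * x| := le_abs_self _
            _ = 2 * Real.pi * |w.im| * |x| := by
              rw [abs_mul, abs_neg, abs_mul, abs_of_pos Real.two_pi_pos]
            _ ≤ _ := by gcongr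
        have e4 : Real.exp (c * |x|) ≤ Real.exp (c * x) + Real.exp (-c * x) := by
          rcases abs_cases x with ⟨h, _⟩ | ⟨h, _⟩ <;> rw [h]
          · linarith [Real.exp_pos (-c * x)]
          · rw [mul_neg, ← neg_mul]; linarith [Real.exp_pos (c * x)]
        calc _ ≤ Real.exp (2 * Real.pi * (|z.im| + 1) * |x|) * Real.exp (2 * Real.pi * |x|) *
              (M * Real.exp (-b * x ^ 2)) := by
              gcongr
              exact hM x
          _ = M * (Real.exp (-b * x ^ 2) * Real.exp (c * |x|)) := by
              rw [← Real.exp_add, hc, mul_comm, mul_assoc]; ring_nf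
          _ ≤ M * (Real.exp (-b * x ^ 2) * (Real.exp (c * x) + Real.exp (-c * x))) := by gcongr
          _ = _ := by rw [mul_add (Real.exp _), ← Real.exp_add, ← Real.exp_add])
      (((integrable_exp_neg_sq_add hb _).add (integrable_exp_neg_sq_add hb _)).const_mul M)
      (.of_forall fun x w _ => by
        have h1 : HasDerivAt (fun w : ℂ => 2 * Real.pi * x * w * Complex.I)
            (2 * Real.pi * x * Complex.I) w := by
          simpa using ((hasDerivAt_id w).const_mul (2 * Real.pi * x : ℂ)).mul_const Complex.I
        exact h1.cexp.mul_const _)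
    exact this.2.differentiableAt
  · intro z
    refine (MeasureTheory.norm_integral_le_of_norm_le
      ((integrable_exp_neg_sq_add hb _).const_mul M) (.of_forall (hint z))).trans (le_of_eq ?_)
    rw [MeasureTheory.integral_const_mul, integral_exp_neg_sq_add hb]
    have : (-(2 * Real.pi * z.im)) ^ 2 / (4 * b) = Real.pi ^ 2 * z.im ^ 2 / b := by
      field_simp; ring
    rw [this]; ring

lemma HardyClass.exists_bound {a b : ℝ} {f : 𝓢(ℝ, ℂ)} (hf : f ∈ HardyClass a b) :
    ∃ M, 0 ≤ M ∧ (∀ x : ℝ, ‖f x‖ ≤ M * Real.exp (-(a * Real.pi) * x ^ 2)) ∧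
      ∀ ξ : ℝ, ‖𝓕 (f : ℝ → ℂ) ξ‖ ≤ M * Real.exp (-(b * Real.pi) * ξ ^ 2) := by
  obtain ⟨⟨M1, h1⟩, M2, h2⟩ := hf
  have aux : ∀ {c u K x : ℝ}, u * Real.exp (c * Real.pi * |x| ^ 2) ≤ K →
      u ≤ K * Real.exp (-(c * Real.pi) * x ^ 2) := by
    intro c u K x h
    rw [neg_mul, Real.exp_neg, ← div_eq_mul_inv, le_div_iff₀ (Real.exp_pos _)]
    rwa [sq_abs] at h
  refine ⟨max (max M1 M2) 0, le_max_right _ _, fun x => ?_, fun x => ?_⟩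
  · exact aux ((h1 ⟨x, rfl⟩).trans ((le_max_left _ _).trans (le_max_left _ _)))
  · exact aux ((h2 ⟨x, rfl⟩).trans ((le_max_right _ _).trans (le_max_left _ _)))

/-- Functions in the Hardy class extend to entire functions of order two. -/
lemma HardyClass.exists_entire {a b : ℝ} (hb : 0 < b) {f : 𝓢(ℝ, ℂ)} (hf : f ∈ HardyClass a b) :
    ∃ E : ℂ → ℂ, Differentiable ℂ E ∧ (∀ x : ℝ, E x = f x) ∧
      ∃ C, 0 ≤ C ∧ (∀ z, ‖E z‖ ≤ C * Real.exp (Real.pi / b * z.im ^ 2)) ∧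
        ∀ x : ℝ, ‖E x‖ ≤ C * Real.exp (-(a * Real.pi) * x ^ 2) := by
  have hpi := Real.pi_pos
  obtain ⟨M, hM, h1, h2⟩ := HardyClass.exists_bound hf
  have hcont : Continuous (𝓕 (f : ℝ → ℂ)) := by
    rw [← SchwartzMap.fourier_coe]; exact (𝓕 f).continuous
  have hint : MeasureTheory.Integrable (𝓕 (f : ℝ → ℂ)) := by
    rw [← SchwartzMap.fourier_coe]; exact (𝓕 f).integrable
  obtain ⟨hd, hbd⟩ := fourierLaplace_entire hcont (by positivity) h2
  set I := ∫ x : ℝ, Real.exp (-(b * Real.pi) * x ^ 2)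
  have hI : 0 ≤ I := MeasureTheory.integral_nonneg fun _ => (Real.exp_pos _).le
  have heq : ∀ x : ℝ, ∫ ξ : ℝ, Complex.exp (2 * Real.pi * ξ * x * Complex.I) *
      𝓕 (f : ℝ → ℂ) ξ = f x := by
    intro x
    have := congrFun (f.continuous.fourierInv_fourier_eq f.integrable hint) x
    rw [Real.fourierInv_eq'] at this
    rw [← this]
    congr 1
    funext ξ
    simp only [smul_eq_mul, RCLike.inner_apply, conj_trivial]
    congr 2
    push_cast
    ring
  refine ⟨_, hd, heq, M * I + M, by positivity, fun z => (hbd z).trans ?_, fun x => ?_⟩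
  · have e : Real.pi ^ 2 * z.im ^ 2 / (b * Real.pi) = Real.pi / b * z.im ^ 2 := by field_simp
    rw [e]
    gcongr
    linarith
  · rw [heq]
    refine (h1 x).trans ?_
    gcongr
    have : 0 ≤ M * I := by positivity
    linarith

/-! ### Uniqueness from dense zeros -/

/-- Polynomials are dominated by arbitrarily flat Gaussians. -/
lemma exists_norm_prod_sub_le {ι : Type*} (S : Finset ι) (c : ι → ℂ) {ε : ℝ} (hε : 0 < ε) :
    ∃ K, 0 ≤ K ∧ ∀ z, ‖∏ i ∈ S, (z - c i)‖ ≤ K * Real.exp (ε * ‖z‖ ^ 2) := by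
  refine ⟨(∏ i ∈ S, (1 + ‖c i‖)) * Real.exp ((S.card : ℝ) ^ 2 / (4 * ε)),
    mul_nonneg (Finset.prod_nonneg fun _ _ => by positivity) (Real.exp_pos _).le, fun z => ?_⟩
  rw [norm_prod]
  calc ∏ i ∈ S, ‖z - c i‖ ≤ ∏ i ∈ S, ((1 + ‖c i‖) * Real.exp ‖z‖) := by
        refine Finset.prod_le_prod (fun _ _ => norm_nonneg _) fun i _ => ?_
        have h1 := norm_sub_le z (c i)
        have h2 := Real.add_one_le_exp ‖z‖
        nlinarith [norm_nonneg z, norm_nonneg (c i),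
          mul_nonneg (norm_nonneg (c i)) (norm_nonneg z)]
    _ = (∏ i ∈ S, (1 + ‖c i‖)) * Real.exp (S.card * ‖z‖) := by
        rw [Finset.prod_mul_distrib, Finset.prod_const, ← Real.exp_nat_mul]
    _ ≤ (∏ i ∈ S, (1 + ‖c i‖)) *
        (Real.exp ((S.card : ℝ) ^ 2 / (4 * ε)) * Real.exp (ε * ‖z‖ ^ 2)) := by
        rw [← Real.exp_add]
        refine mul_le_mul_of_nonneg_left (Real.exp_le_exp.2 ?_)
          (Finset.prod_nonneg fun _ _ => by positivity)
        linarith [linear_le_sq hε (S.card : ℝ) ‖z‖]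
    _ = _ := by ring

lemma eq_zero_of_eq_zero_on_Ioo {F : ℂ → ℂ} (hF : Differentiable ℂ F) {r : ℝ} (hr : 0 < r)
    (h : ∀ x : ℝ, 0 < x → x < r → F x = 0) (z : ℂ) : F z = 0 := by
  have hA : AnalyticOnNhd ℂ F Set.univ := hF.differentiableOn.analyticOnNhd isOpen_univ
  refine hA.eqOn_zero_of_preconnected_of_frequently_eq_zero isPreconnected_univ
    (z₀ := 0) (Set.mem_univ _) ?_ (Set.mem_univ z)
  have ht : Tendsto (fun x : ℝ => (x : ℂ)) (nhdsWithin 0 (Set.Ioi 0))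
      (nhdsWithin 0 {0}ᶜ) := by
    refine tendsto_nhdsWithin_iff.2 ⟨?_, ?_⟩
    · have : Tendsto (fun x : ℝ => (x : ℂ)) (nhds 0) (nhds ((0 : ℝ) : ℂ)) :=
        Complex.continuous_ofReal.tendsto 0
      rw [Complex.ofReal_zero] at this
      exact this.mono_left nhdsWithin_le_nhds
    · filter_upwards [self_mem_nhdsWithin] with x hx
      simpa using (ne_of_gt hx)
  refine ht.frequently (Eventually.frequently ?_)
  filter_upwards [Ioo_mem_nhdsGT hr] with x hx
  exact h x hx.1 hx.2

/-- An entire function with Gaussian bounds on the real axis and in the imaginary direction which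
vanishes at a point of almost every cell of a sufficiently dense grid is zero. -/
theorem eq_zero_of_zeros_in_cells {F : ℂ → ℂ} (hF : Differentiable ℂ F) {C A D θ : ℝ} (hC : 0 ≤ C)
    (hA : 0 < A) (hD : 0 < D)
    (hreal : ∀ x : ℝ, ‖F x‖ ≤ C * Real.exp (-(2 * Real.pi * A) * x ^ 2))
    (hall : ∀ z, ‖F z‖ ≤ C * Real.exp (2 * Real.pi / A * z.im ^ 2))
    (hz : ∃ k₀ : ℕ, ∀ k : ℕ, k₀ ≤ k → ∃ x : ℝ, 0 < x ∧ (k + 1) * D ≤ x ^ 2 ∧ x ^ 2 < (k + 2) * D ∧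
      F x = 0)
    (hθ0 : Real.pi / 4 ≤ θ) (hθ : θ < Real.pi / 2)
    (hneg : D * (2 * Real.pi / A * Real.sin θ ^ 2 + 2 * Real.pi * A * Real.cos (2 * θ)) <
      Real.pi * Real.sin (2 * θ)) (z : ℂ) : F z = 0 := by
  have hpi := Real.pi_pos
  obtain ⟨k₀, hk₀⟩ := hz
  choose! ξ hξ0 hξ1 hξ2 hξF using hk₀
  have hsD : 0 < √D := Real.sqrt_pos.2 hD
  have hsD2 : √D ^ 2 = D := Real.sq_sqrt hD.le
  -- The first `k₀` cells may contain no zero of `F`. They receive the lattice nodes, and `F` is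
  -- multiplied by the polynomial `p` vanishing there.
  set t : ℕ → ℝ := fun k => if k < k₀ then recipSqrt k else √D / ξ k with ht
  have hrec : ∀ k : ℕ, k₀ ≤ k → recipSqrt (k + 1) < √D / ξ k ∧ √D / ξ k ≤ recipSqrt k := by
    intro k hk
    have h0 := hξ0 k hk
    unfold recipSqrt
    constructor
    · rw [div_lt_div_iff₀ (by positivity) h0, one_mul, ← Real.sqrt_mul hD.le]
      refine Real.lt_sqrt_of_sq_lt ?_
      push_cast
      linarith [hξ2 k hk]
    · rw [div_le_div_iff₀ h0 (by positivity), one_mul, ← Real.sqrt_mul hD.le]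
      refine Real.sqrt_le_iff.2 ⟨h0.le, ?_⟩
      linarith [hξ1 k hk]
  have hlt : ∀ k, recipSqrt (k + 1) < t k ∧ t k ≤ recipSqrt k := by
    intro k
    simp only [ht]
    split_ifs with h
    · refine ⟨?_, le_rfl⟩
      unfold recipSqrt
      push_cast
      gcongr
      linarith
    · exact hrec k (not_lt.1 h)
  have hI : Interlaced t := fun k => ⟨(hlt k).1.le, (hlt k).2⟩
  have hinj : Function.Injective t := by
    refine StrictAnti.injective (strictAnti_nat_of_succ_lt fun k => ?_)
    exact (hlt (k + 1)).2.trans_lt (hlt k).1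
  set g := D * (2 * Real.pi / A * Real.sin θ ^ 2 + 2 * Real.pi * A * Real.cos (2 * θ)) -
    Real.pi * Real.sin (2 * θ) with hg
  have hg0 : g < 0 := by rw [hg]; linarith
  -- The rate `ε` pays for `p`. It enters the ray condition at most twice, leaving it below `g/2`,
  -- and the second bound keeps the decay rate on the axis nonnegative.
  set ε := min (-g / 4) (2 * Real.pi * A * D) with hε
  have hε0 : 0 < ε := lt_min (by linarith) (by positivity)
  have hε1 : ε ≤ -g / 4 := min_le_left _ _
  have hε2 : ε ≤ 2 * Real.pi * A * D := min_le_right _ _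
  set p : ℂ → ℂ := fun z => ∏ k ∈ Finset.range k₀, (z - ((√(k + 1) : ℝ) : ℂ)) with hp
  obtain ⟨K, hK0, hK⟩ := exists_norm_prod_sub_le (Finset.range k₀)
    (fun k : ℕ => ((√(k + 1) : ℝ) : ℂ)) hε0
  set H : ℂ → ℂ := fun z => F (√D * z) * p z with hH
  have hHd : Differentiable ℂ H := by
    have : Differentiable ℂ p := by
      simp only [hp]; fun_prop
    simp only [hH]
    exact (hF.comp (differentiable_id.const_mul _)).mul this
  have him : ∀ z : ℂ, ((√D : ℂ) * z).im ^ 2 = D * z.im ^ 2 := by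
    intro z; rw [Complex.im_ofReal_mul, mul_pow, hsD2]
  have hHz : ∀ z, ‖H z‖ ≤ (C * K) * Real.exp (2 * Real.pi / A * (D * z.im ^ 2) + ε * ‖z‖ ^ 2) := by
    intro z
    rw [Real.exp_add, hH]
    simp only [norm_mul]
    have h1 := hall (√D * z)
    rw [him] at h1
    calc _ ≤ C * Real.exp (2 * Real.pi / A * (D * z.im ^ 2)) * (K * Real.exp (ε * ‖z‖ ^ 2)) := by
          gcongr; exact hK z
      _ = _ := by ring
  have hHx : ∀ x : ℝ, ‖H x‖ ≤ (C * K) * Real.exp (-(2 * Real.pi * A * D - ε) * x ^ 2) := by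
    intro x
    have e : -(2 * Real.pi * A * D - ε) * x ^ 2 =
      -(2 * Real.pi * A) * (√D * x) ^ 2 + ε * ‖(x : ℂ)‖ ^ 2 := by
      rw [mul_pow, hsD2, Complex.norm_real, Real.norm_eq_abs, sq_abs]; ring
    rw [e, Real.exp_add, hH]
    simp only [norm_mul]
    have h1 := hreal (√D * x)
    rw [Complex.ofReal_mul] at h1
    calc _ ≤ C * Real.exp (-(2 * Real.pi * A) * (√D * x) ^ 2) * (K * Real.exp (ε * ‖(x : ℂ)‖ ^ 2)) := by
          gcongr; exact hK x
      _ = _ := by ring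
  have hH0 : ∀ k, H ((1 / t k : ℝ) : ℂ) = 0 := by
    intro k
    simp only [hH, ht]
    split_ifs with h
    · rw [mul_eq_zero]; right
      refine Finset.prod_eq_zero (Finset.mem_range.2 h) ?_
      simp [recipSqrt]
    · rw [mul_eq_zero]; left
      have : ((√D : ℂ) * ((1 / (√D / ξ k) : ℝ) : ℂ)) = (ξ k : ℂ) := by
        rw [← Complex.ofReal_mul]; congr 1; field_simp
      rw [this]
      exact hξF k (not_lt.1 h)
  have hzero : ∀ x : ℝ, 0 < x → H x = 0 := fun x hx =>
    eq_zero_of_gaussian_decay_of_zeros (θ := θ) (B := 2 * Real.pi / A * D + ε)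
      (κ := 2 * Real.pi / A * (D * Real.sin θ ^ 2) + ε) (a := 2 * Real.pi * A * D - ε)
      (C := C * K) hHd hI hinj hH0 (by positivity) (by positivity) (by linarith)
      (fun z => (hHz z).trans (by
        gcongr
        have h1 : z.im ^ 2 ≤ ‖z‖ ^ 2 := by
          rw [← sq_abs z.im]
          gcongr
          exact Complex.abs_im_le_norm z
        have h2 : 2 * Real.pi / A * (D * z.im ^ 2) ≤ 2 * Real.pi / A * (D * ‖z‖ ^ 2) := by gcongr
        linarith))
      (fun x _ => hHx x) hθ0 hθ
      (fun r φ hr hφ => (hHz _).trans (le_of_eq (by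
        have : Real.sin φ ^ 2 = Real.sin θ ^ 2 := by
          rw [← hφ]
          rcases abs_cases φ with ⟨h, _⟩ | ⟨h, _⟩ <;> rw [h]
          rw [Real.sin_neg, neg_sq]
        rw [polar_im, norm_polar hr, mul_pow, this]
        ring_nf)))
      (by
        have hc := Real.neg_one_le_cos (2 * θ)
        have : 2 * Real.pi / A * (D * Real.sin θ ^ 2) + ε +
          (2 * Real.pi * A * D - ε) * Real.cos (2 * θ) - Real.pi * Real.sin (2 * θ) =
          g + ε * (1 - Real.cos (2 * θ)) := by rw [hg]; ring
        rw [this]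
        nlinarith) hx
  -- On `(0, √D)` the scaled variable is less than one, while the zeros of `p` are at least one, so
  -- there `F` itself vanishes.
  refine eq_zero_of_eq_zero_on_Ioo hF hsD (fun x hx0 hx1 => ?_) z
  have h1 := hzero (x / √D) (by positivity)
  simp only [hH, mul_eq_zero] at h1
  have e : ((√D : ℂ) * ((x / √D : ℝ) : ℂ)) = x := by
    rw [← Complex.ofReal_mul]; congr 1; field_simp
  rw [e] at h1
  refine h1.resolve_right fun h2 => ?_
  obtain ⟨k, _, hk⟩ := Finset.prod_eq_zero_iff.1 h2
  rw [← Complex.ofReal_sub, Complex.ofReal_eq_zero] at hk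
  have h3 : x / √D < 1 := (div_lt_one hsD).2 hx1
  have h4 : 1 ≤ √((k : ℝ) + 1) := Real.one_le_sqrt.2 (by linarith [k.cast_nonneg (α := ℝ)])
  linarith

lemma pauliConst_pos {A : ℝ} (hA0 : 0 < A) (hA1 : A < 1) : 0 < pauliConst A := by
  unfold pauliConst
  split_ifs
  · positivity
  · have : 0 < √(1 - A ^ 2) := Real.sqrt_pos.2 (by nlinarith)
    positivity

/-- With `u = tan θ` the condition reads `D (u (1/A - A) + A/u) < 1`. The bracket is minimal where
`sin θ = A`, with value `2 √(1 - A²)`. This angle is at least `π/4` exactly when `A ≥ 1/√2`;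
otherwise the endpoint `π/4` is best, with value `1/A`. -/
lemma exists_angle {A D : ℝ} (hA0 : 0 < A) (hA1 : A < 1) (hD : D < 2 / pauliConst A) :
    ∃ θ, Real.pi / 4 ≤ θ ∧ θ < Real.pi / 2 ∧
      D * (2 * Real.pi / A * Real.sin θ ^ 2 + 2 * Real.pi * A * Real.cos (2 * θ)) <
        Real.pi * Real.sin (2 * θ) := by
  have hpi := Real.pi_pos
  unfold pauliConst at hD
  split_ifs at hD with h
  · refine ⟨Real.pi / 4, le_rfl, by linarith, ?_⟩
    have e : 2 * (Real.pi / 4) = Real.pi / 2 := by ring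
    rw [e, Real.cos_pi_div_two, Real.sin_pi_div_two, Real.sin_pi_div_four, div_pow,
      Real.sq_sqrt zero_le_two]
    have : D < A := by simpa using hD
    have e2 : D * (2 * Real.pi / A * (2 / 2 ^ 2) + 2 * Real.pi * A * 0) = D / A * Real.pi := by
      field_simp; ring
    rw [e2, mul_one]
    have : D / A < 1 := (div_lt_one hA0).2 this
    nlinarith
  · push Not at h
    have hs : 0 < √(1 - A ^ 2) := Real.sqrt_pos.2 (by nlinarith)
    have hs2 : √(1 - A ^ 2) ^ 2 = 1 - A ^ 2 := Real.sq_sqrt (by nlinarith)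
    refine ⟨Real.arcsin A, ?_, Real.arcsin_lt_pi_div_two.2 hA1, ?_⟩
    · rw [Real.le_arcsin_iff_sin_le ⟨by linarith, by linarith⟩ ⟨by linarith, by linarith⟩,
        Real.sin_pi_div_four]
      refine le_trans (le_of_eq ?_) h
      rw [div_eq_div_iff two_ne_zero (by positivity), Real.mul_self_sqrt zero_le_two, one_mul]
    · rw [Real.cos_two_mul', Real.sin_two_mul, Real.sin_arcsin (by linarith) hA1.le,
        Real.cos_arcsin, hs2]
      have h1 : D * (2 * √(1 - A ^ 2)) < 1 := by
        rw [lt_div_iff₀ (by positivity)] at hD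
        linarith
      have e : D * (2 * Real.pi / A * A ^ 2 + 2 * Real.pi * A * (1 - A ^ 2 - A ^ 2)) =
          D * (2 * √(1 - A ^ 2)) * (2 * Real.pi * A * √(1 - A ^ 2)) := by
        have : D * (2 * √(1 - A ^ 2)) * (2 * Real.pi * A * √(1 - A ^ 2)) =
          4 * D * Real.pi * A * √(1 - A ^ 2) ^ 2 := by ring
        rw [this, hs2]
        field_simp
        ring
      rw [e]
      have : 0 < 2 * Real.pi * A * √(1 - A ^ 2) := by positivity
      nlinarith

namespace IsOrderedEnumeration

variable {Λ : Set ℝ} {l : ℤ → ℝ}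

lemma tendsto_atTop (h : IsOrderedEnumeration Λ l) : Tendsto l atTop atTop := by
  refine tendsto_atTop_atTop_of_monotone h.strictMono.monotone fun b => ?_
  have := h.not_bddAbove
  rw [← h.range_eq, not_bddAbove_iff] at this
  obtain ⟨_, ⟨j, rfl⟩, hj⟩ := this b
  exact ⟨j, hj.le⟩

lemma tendsto_atBot (h : IsOrderedEnumeration Λ l) : Tendsto l atBot atBot := by
  refine tendsto_atBot_atBot_of_monotone h.strictMono.monotone fun b => ?_
  have := h.not_bddBelow
  rw [← h.range_eq, not_bddBelow_iff] at this
  obtain ⟨_, ⟨j, rfl⟩, hj⟩ := this b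
  exact ⟨j, hj.le⟩

/-- Small weighted gaps put a point into every far cell of a slightly coarser grid of squares. -/
lemma exists_mem_cell (h : IsOrderedEnumeration Λ l) {σ D : ℝ} (hσD : 2 * σ < D)
    (hl : ∀ᶠ j in atTop, |l j| * (l (j + 1) - l j) < σ) :
    ∃ k₀ : ℕ, ∀ k : ℕ, k₀ ≤ k → ∃ x ∈ Λ, 0 < x ∧ (k + 1) * D ≤ x ^ 2 ∧ x ^ 2 < (k + 2) * D := by
  have hg : 0 < D - 2 * σ := by linarith
  -- Beyond `R` the bound `l_j d < σ` on a gap `d` forces `d² < D - 2σ`, so the squares advance by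
  -- `2 l_j d + d² < D`.
  set R := σ ^ 2 / (D - 2 * σ) + 1 with hR
  have hR1 : 1 ≤ R := by rw [hR]; linarith [div_nonneg (sq_nonneg σ) hg.le]
  have hRσ : σ ^ 2 < (D - 2 * σ) * R ^ 2 := by
    have e : (D - 2 * σ) * R = σ ^ 2 + (D - 2 * σ) := by rw [hR]; field_simp
    nlinarith [mul_le_mul_of_nonneg_left hR1 (by positivity : 0 ≤ (D - 2 * σ) * R)]
  obtain ⟨J, hJ⟩ := eventually_atTop.1 (hl.and (h.tendsto_atTop.eventually_ge_atTop R))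
  have hstep : ∀ j, J ≤ j → l (j + 1) ^ 2 < l j ^ 2 + D := by
    intro j hj
    obtain ⟨h1, h2⟩ := hJ j hj
    have hpos : 0 < l j := by linarith
    rw [abs_of_pos hpos] at h1
    have hd : 0 < l (j + 1) - l j := sub_pos.2 (h.strictMono (lt_add_one j))
    set d := l (j + 1) - l j with hddef
    have h3 : (R * d) ^ 2 < σ ^ 2 := by
      have : R * d ≤ l j * d := by gcongr
      have : 0 < R * d := by positivity
      nlinarith
    have h4 : d ^ 2 < D - 2 * σ := by
      have : R ^ 2 * d ^ 2 < R ^ 2 * (D - 2 * σ) := by nlinarith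
      exact lt_of_mul_lt_mul_left this (by positivity)
    have e : l (j + 1) = l j + d := by rw [hddef]; ring
    rw [e]
    nlinarith
  have hD : 0 < D := by
    have := hstep J le_rfl
    have h2 := (hJ J le_rfl).2
    have : l J ^ 2 < l (J + 1) ^ 2 := by
      have := h.strictMono (lt_add_one J)
      nlinarith
    linarith
  obtain ⟨k₀, hk₀⟩ := exists_nat_gt (l J ^ 2 / D)
  refine ⟨k₀, fun k hk => ?_⟩
  have hkJ : l J ^ 2 < (k + 1) * D := by
    rw [div_lt_iff₀ hD] at hk₀
    have : (k₀ : ℝ) ≤ k := by exact_mod_cast hk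
    nlinarith
  obtain ⟨b, hb⟩ := eventually_atTop.1 (h.tendsto_atTop.eventually_ge_atTop (max 1 ((k + 1) * D)))
  -- Take the last point whose square lies below the cell: as the squares advance by less than `D`,
  -- the next one cannot jump over it.
  obtain ⟨j, ⟨hj1, hj2⟩, hjmax⟩ := Int.exists_greatest_of_bdd
    (P := fun j => J ≤ j ∧ l j ^ 2 < (k + 1) * D)
    ⟨b, fun j hj => by
      by_contra hcon
      have h1 := hb j (by omega)
      have h2 : 1 ≤ l j := (le_max_left _ _).trans h1
      have h3 : (k + 1) * D ≤ l j := (le_max_right _ _).trans h1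
      nlinarith [hj.2]⟩ ⟨J, le_rfl, hkJ⟩
  refine ⟨l (j + 1), h.range_eq ▸ ⟨j + 1, rfl⟩, ?_, ?_, ?_⟩
  · linarith [(hJ (j + 1) (by omega)).2]
  · by_contra hcon
    have := hjmax (j + 1) ⟨by omega, not_le.1 hcon⟩
    omega
  · linarith [hstep j hj1]

end IsOrderedEnumeration

/-- Uniqueness for the modulus from sufficiently dense samples. -/
theorem norm_eq_of_limsupSpacing_lt {A : ℝ} (hA0 : 0 < A) (hA1 : A < 1) {f g : 𝓢(ℝ, ℂ)}
    (hf : f ∈ HardyClass A A) (hg : g ∈ HardyClass A A) {Λ : Set ℝ} {l : ℤ → ℝ}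
    (hl : IsOrderedEnumeration Λ l)
    (hlim : limsupSpacing l < ((1 / pauliConst A : ℝ) : EReal))
    (hfg : ∀ x ∈ Λ, ‖f x‖ = ‖g x‖) (x : ℝ) : ‖f x‖ = ‖g x‖ := by
  have hc := pauliConst_pos hA0 hA1
  have hpi := Real.pi_pos
  obtain ⟨σ, hσ1, hσ2⟩ := EReal.lt_iff_exists_real_btwn.1 hlim
  have hσ2 : σ < 1 / pauliConst A := by exact_mod_cast hσ2
  have hev := eventually_lt_of_limsup_lt hσ1
  rw [eventually_sup] at hev
  have hev : ∀ᶠ j in atTop, |l j| * (l (j + 1) - l j) < σ :=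
    hev.2.mono fun j hj => by exact_mod_cast hj
  have hσ0 : 0 < σ := by
    obtain ⟨j, hj⟩ := hev.exists
    refine lt_of_le_of_lt ?_ hj
    exact mul_nonneg (abs_nonneg _) (sub_nonneg.2 (hl.strictMono (lt_add_one j)).le)
  -- This `D` lies strictly between `2σ`, needed for the cells to be hit, and `2/c₁(A)`, needed for
  -- the angle.
  obtain ⟨k₀, hk₀⟩ := hl.exists_mem_cell (D := σ + 1 / pauliConst A) (by linarith) hev
  obtain ⟨θ, hθ1, hθ2, hθ3⟩ := exists_angle (D := σ + 1 / pauliConst A) hA0 hA1 (by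
    have : 2 / pauliConst A = 1 / pauliConst A + 1 / pauliConst A := by ring
    linarith)
  obtain ⟨E, hE, hEf, C, hC, hE1, hE2⟩ := HardyClass.exists_entire hA0 hf
  obtain ⟨G, hG, hGg, C', hC', hG1, hG2⟩ := HardyClass.exists_entire hA0 hg
  set cj := starRingEnd ℂ
  have hconj : ∀ {E : ℂ → ℂ}, Differentiable ℂ E → Differentiable ℂ fun z => cj (E (cj z)) := by
    intro E hE z
    have := (hE (cj z)).conj_conj
    rw [Complex.conj_conj] at this
    exact this
  -- The entire extension of `|f|² - |g|²`, using the reflection `z ↦ conj (E (conj z))`.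
  set F : ℂ → ℂ := fun z => E z * cj (E (cj z)) - G z * cj (G (cj z)) with hFdef
  have hF : Differentiable ℂ F := (hE.mul (hconj hE)).sub (hG.mul (hconj hG))
  have hFx : ∀ x : ℝ, F x = ((‖f x‖ ^ 2 - ‖g x‖ ^ 2 : ℝ) : ℂ) := by
    intro x
    simp only [hFdef, cj, Complex.conj_ofReal, hEf, hGg, Complex.mul_conj, Complex.normSq_eq_norm_sq]
    push_cast
    ring
  have hbound : ∀ {H : ℂ → ℂ} {K : ℝ}, 0 ≤ K → (∀ z, ‖H z‖ ≤ K * Real.exp (Real.pi / A * z.im ^ 2)) →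
      ∀ z, ‖H z * cj (H (cj z))‖ ≤ K ^ 2 * Real.exp (2 * Real.pi / A * z.im ^ 2) := by
    intro H K hK hH z
    rw [norm_mul, RCLike.norm_conj]
    have h1 := hH (cj z)
    rw [Complex.conj_im, neg_sq] at h1
    calc _ ≤ (K * Real.exp (Real.pi / A * z.im ^ 2)) * (K * Real.exp (Real.pi / A * z.im ^ 2)) := by
          gcongr; exact hH z
      _ = K ^ 2 * (Real.exp (Real.pi / A * z.im ^ 2) * Real.exp (Real.pi / A * z.im ^ 2)) := by ring
      _ = _ := by rw [← Real.exp_add]; ring_nf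
  have hboundx : ∀ {H : ℂ → ℂ} {K : ℝ}, 0 ≤ K →
      (∀ x : ℝ, ‖H x‖ ≤ K * Real.exp (-(A * Real.pi) * x ^ 2)) →
      ∀ x : ℝ, ‖H x * cj (H (cj x))‖ ≤ K ^ 2 * Real.exp (-(2 * Real.pi * A) * x ^ 2) := by
    intro H K hK hH x
    rw [norm_mul, RCLike.norm_conj, Complex.conj_ofReal]
    calc _ ≤ (K * Real.exp (-(A * Real.pi) * x ^ 2)) * (K * Real.exp (-(A * Real.pi) * x ^ 2)) := by
          gcongr <;> exact hH x
      _ = K ^ 2 * (Real.exp (-(A * Real.pi) * x ^ 2) * Real.exp (-(A * Real.pi) * x ^ 2)) := by ring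
      _ = _ := by rw [← Real.exp_add]; ring_nf
  have hzero := eq_zero_of_zeros_in_cells (C := C ^ 2 + C' ^ 2) hF (by positivity) hA0
    (D := σ + 1 / pauliConst A) (by positivity)
    (fun x => (norm_sub_le _ _).trans (by
      rw [add_mul]
      exact add_le_add (hboundx hC hE2 x) (hboundx hC' hG2 x)))
    (fun z => (norm_sub_le _ _).trans (by
      rw [add_mul]
      exact add_le_add (hbound hC hE1 z) (hbound hC' hG1 z)))
    ⟨k₀, fun k hk => by
      obtain ⟨x, hx, h1, h2, h3⟩ := hk₀ k hk
      refine ⟨x, h1, h2, h3, ?_⟩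
      rw [hFx, hfg x hx, sub_self, Complex.ofReal_zero]⟩ hθ1 hθ2 hθ3 x
  rw [hFx, Complex.ofReal_eq_zero, sub_eq_zero] at hzero
  exact (sq_eq_sq₀ (norm_nonneg _) (norm_nonneg _)).1 hzero

/-! ### From entire functions back to the Hardy class -/

/-- Shifting a horizontal contour. -/
lemma integral_eq_integral_add_mul_I {H : ℂ → ℂ} (hH : Differentiable ℂ H) {M η Y : ℝ} (hη : 0 < η)
    (hb : ∀ x y : ℝ, |y| ≤ |Y| → ‖H (x + y * Complex.I)‖ ≤ M * Real.exp (-η * x ^ 2)) :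
    ∫ x : ℝ, H x = ∫ x : ℝ, H (x + Y * Complex.I) := by
  have hM : 0 ≤ M := by simpa using (norm_nonneg _).trans (hb 0 0 (by simp))
  have hint : ∀ y : ℝ, |y| ≤ |Y| →
      MeasureTheory.Integrable fun x : ℝ => H (x + y * Complex.I) := by
    intro y hy
    refine ((integrable_exp_neg_mul_sq hη).const_mul M).mono' ?_ (.of_forall fun x => hb x y hy)
    exact (hH.continuous.comp (by fun_prop)).aestronglyMeasurable
  have hlim : ∀ y : ℝ, |y| ≤ |Y| → Tendsto (fun T : ℝ => ∫ x in (-T)..T, H (x + y * Complex.I))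
      atTop (nhds (∫ x : ℝ, H (x + y * Complex.I))) := fun y hy =>
    MeasureTheory.intervalIntegral_tendsto_integral (hint y hy) tendsto_neg_atTop_atBot tendsto_id
  have hside : ∀ s : ℝ, (s = 1 ∨ s = -1) → Tendsto (fun T : ℝ =>
      ∫ y in (0 : ℝ)..Y, H ((s * T : ℝ) + y * Complex.I)) atTop (nhds 0) := by
    intro s hs
    have hs2 : s ^ 2 = 1 := by rcases hs with rfl | rfl <;> norm_num
    refine squeeze_zero_norm (a := fun T : ℝ => M * Real.exp (-η * T ^ 2) * |Y - 0|) (fun T => ?_) ?_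
    · refine intervalIntegral.norm_integral_le_of_norm_le_const fun y hy => ?_
      have := hb (s * T) y (by
        rw [Set.mem_uIoc] at hy
        rcases hy with ⟨h1, h2⟩ | ⟨h1, h2⟩
        · rw [abs_of_pos h1, abs_of_pos (h1.trans_le h2)]; exact h2
        · rw [abs_of_nonpos h2, abs_of_neg (h1.trans_le h2)]; linarith)
      rwa [mul_pow, hs2, one_mul] at this
    · have : Tendsto (fun T : ℝ => M * Real.exp (-η * T ^ 2) * |Y - 0|) atTop
          (nhds (M * 0 * |Y - 0|)) := by
        refine (Tendsto.const_mul _ (Real.tendsto_exp_atBot.comp ?_)).mul_const _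
        exact (tendsto_pow_atTop two_ne_zero).const_mul_atTop_of_neg (neg_lt_zero.2 hη)
      simpa using this
  have h0 := hlim 0 (by simp)
  have hY := hlim Y le_rfl
  have hdiff : Tendsto (fun T : ℝ => (∫ x in (-T)..T, H (x + (0 : ℝ) * Complex.I)) -
      ∫ x in (-T)..T, H (x + Y * Complex.I)) atTop (nhds 0) := by
    have h2 := ((hside (-1) (Or.inr rfl)).sub (hside 1 (Or.inl rfl))).const_mul Complex.I
    rw [sub_zero, mul_zero] at h2
    refine h2.congr fun T => ?_
    have := Complex.integral_boundary_rect_eq_zero_of_differentiableOn H (-T : ℝ)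
      (T + Y * Complex.I) hH.differentiableOn
    simp only [Complex.ofReal_re, Complex.ofReal_im, Complex.add_re, Complex.mul_re, Complex.I_re,
      Complex.I_im, Complex.add_im, Complex.mul_im, mul_zero, mul_one, zero_add, add_zero, sub_zero,
      smul_eq_mul] at this
    simp only [neg_one_mul, one_mul]
    linear_combination -this
  have := tendsto_nhds_unique hdiff (h0.sub hY)
  simp only [Complex.ofReal_zero, zero_mul, add_zero] at this
  exact (sub_eq_zero.1 this.symm)

lemma iteratedDeriv_comp_ofReal {U : ℂ → ℂ} (hU : Differentiable ℂ U) (n : ℕ) :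
    iteratedDeriv n (fun x : ℝ => U x) = fun x : ℝ => iteratedDeriv n U x := by
  induction n with
  | zero => simp
  | succ n ih =>
    rw [iteratedDeriv_succ, ih, iteratedDeriv_succ]
    funext x
    have : Differentiable ℂ (iteratedDeriv n U) :=
      (hU.contDiff (n := ⊤)).differentiable_iteratedDeriv n (by exact_mod_cast WithTop.coe_lt_top _)
    exact (this x).hasDerivAt.comp_ofReal.deriv

/-- An entire function with suitable Gaussian bounds restricts to a member of the Hardy class. -/
theorem exists_hardyClass_of_entire {U : ℂ → ℂ} (hU : Differentiable ℂ U) {A C η : ℝ} (hA : 0 < A)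
    (hη : 0 < η) (hC : 0 ≤ C)
    (hb : ∀ x y : ℝ, ‖U (x + y * Complex.I)‖ ≤ C * Real.exp (-η * x ^ 2 + Real.pi / A * y ^ 2))
    (hx : ∀ x : ℝ, ‖U x‖ ≤ C * Real.exp (-(A * Real.pi) * x ^ 2)) :
    ∃ f ∈ HardyClass A A, ∀ x : ℝ, f x = U x := by
  have hpi := Real.pi_pos
  have hsmooth : ContDiff ℝ (⊤ : ℕ∞) fun x : ℝ => U x :=
    (hU.contDiff.restrict_scalars ℝ).comp Complex.ofRealCLM.contDiff
  have hdecay : ∀ k n : ℕ, ∃ K, ∀ x : ℝ,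
      ‖x‖ ^ k * ‖iteratedFDeriv ℝ n (fun x : ℝ => U x) x‖ ≤ K := by
    intro k n
    refine ⟨n.factorial * (C * Real.exp (η + Real.pi / A)) *
      Real.exp ((k : ℝ) ^ 2 / (4 * (η / 2))), fun x => ?_⟩
    rw [norm_iteratedFDeriv_eq_norm_iteratedDeriv, iteratedDeriv_comp_ofReal hU]
    -- Cauchy's estimate on the unit circle about `x`. There `x² ≤ 2 (Re z)² + 2`, which halves the
    -- rate `η`; the remaining half absorbs `|x|^k`.
    have h1 := Complex.norm_iteratedDeriv_le_of_forall_mem_sphere_norm_le (c := (x : ℂ)) (R := 1)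
      (C := C * Real.exp (η + Real.pi / A) * Real.exp (-(η / 2) * x ^ 2)) n one_pos hU.diffContOnCl
      (fun z hz => by
        have e : z = (z.re : ℂ) + z.im * Complex.I := (Complex.re_add_im z).symm
        have h := hb z.re z.im
        rw [← e] at h
        refine h.trans ?_
        rw [mul_assoc, ← Real.exp_add]
        refine mul_le_mul_of_nonneg_left (Real.exp_le_exp.2 ?_) hC
        have e1 : (z.re - x) ^ 2 + z.im ^ 2 = 1 := by
          have h1 : ‖z - x‖ ^ 2 = (z.re - x) ^ 2 + z.im ^ 2 := by
            rw [Complex.sq_norm, Complex.normSq_apply]; simp; ring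
          rw [mem_sphere_iff_norm] at hz
          rw [← h1, hz]; norm_num
        have e2 : x ^ 2 ≤ 2 * z.re ^ 2 + 2 := by
          nlinarith [sq_nonneg (2 * z.re - x), sq_nonneg z.im]
        have e3 : z.im ^ 2 ≤ 1 := by nlinarith [sq_nonneg (z.re - x)]
        have e4 : Real.pi / A * z.im ^ 2 ≤ Real.pi / A * 1 := by gcongr
        nlinarith)
    rw [one_pow, div_one] at h1
    have h2 : ‖x‖ ^ k ≤ Real.exp ((k : ℝ) ^ 2 / (4 * (η / 2))) * Real.exp (η / 2 * x ^ 2) := by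
      calc ‖x‖ ^ k ≤ Real.exp |x| ^ k := by
            gcongr
            rw [Real.norm_eq_abs]
            linarith [Real.add_one_le_exp |x|]
        _ = Real.exp (k * |x|) := by rw [Real.exp_nat_mul]
        _ ≤ _ := by
          rw [← Real.exp_add]
          apply Real.exp_le_exp.2
          have := linear_le_sq (half_pos hη) (k : ℝ) |x|
          rw [sq_abs] at this
          linarith
    calc _ ≤ (Real.exp ((k : ℝ) ^ 2 / (4 * (η / 2))) * Real.exp (η / 2 * x ^ 2)) *
          (n.factorial * (C * Real.exp (η + Real.pi / A) * Real.exp (-(η / 2) * x ^ 2))) := by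
          gcongr
      _ = n.factorial * (C * Real.exp (η + Real.pi / A)) * Real.exp ((k : ℝ) ^ 2 / (4 * (η / 2))) *
          (Real.exp (η / 2 * x ^ 2) * Real.exp (-(η / 2) * x ^ 2)) := by ring
      _ = _ := by
        rw [← Real.exp_add]
        have : η / 2 * x ^ 2 + -(η / 2) * x ^ 2 = 0 := by ring
        rw [this, Real.exp_zero, mul_one]
  let f : 𝓢(ℝ, ℂ) := ⟨fun x : ℝ => U x, hsmooth, hdecay⟩
  have hf : ∀ x : ℝ, f x = U x := fun _ => rfl
  set I := ∫ x : ℝ, Real.exp (-η * x ^ 2)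
  refine ⟨f, ⟨⟨C, ?_⟩, ⟨C * I, ?_⟩⟩, hf⟩
  · rintro _ ⟨x, rfl⟩
    simp only
    rw [hf, ← le_div_iff₀ (Real.exp_pos _), div_eq_mul_inv, ← Real.exp_neg, sq_abs, ← neg_mul]
    exact hx x
  · rintro _ ⟨ξ, rfl⟩
    simp only
    rw [← le_div_iff₀ (Real.exp_pos _), div_eq_mul_inv, ← Real.exp_neg, sq_abs, ← neg_mul]
    set H : ℂ → ℂ := fun z => Complex.exp (-2 * Real.pi * z * ξ * Complex.I) * U z with hH
    have hHd : Differentiable ℂ H := by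
      simp only [hH]; fun_prop
    have hHn : ∀ x y : ℝ, ‖H (x + y * Complex.I)‖ ≤
        C * Real.exp (-η * x ^ 2 + Real.pi / A * y ^ 2 + 2 * Real.pi * y * ξ) := by
      intro x y
      simp only [hH]
      rw [norm_mul, Complex.norm_exp, Real.exp_add _ (2 * Real.pi * y * ξ)]
      have e : (-2 * Real.pi * (x + y * Complex.I) * ξ * Complex.I : ℂ).re =
          2 * Real.pi * y * ξ := by simp
      rw [e, mul_comm, ← mul_assoc]
      gcongr
      exact hb x y
    -- This height minimises `π Y²/A + 2π Y ξ`, with minimum `-πA ξ²`: exactly the decay required of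
    -- the Fourier transform.
    set Y := -(A * ξ)
    have hshift := integral_eq_integral_add_mul_I (H := H) hHd (η := η) (Y := Y)
      (M := C * Real.exp (Real.pi / A * Y ^ 2 + 2 * Real.pi * |Y| * |ξ|)) hη (fun x y hy => by
        refine (hHn x y).trans ?_
        rw [mul_assoc C, ← Real.exp_add]
        refine mul_le_mul_of_nonneg_left (Real.exp_le_exp.2 ?_) hC
        have h1 : y ^ 2 ≤ Y ^ 2 := sq_le_sq.2 hy
        have h2 : 2 * Real.pi * y * ξ ≤ 2 * Real.pi * |Y| * |ξ| := by
          calc 2 * Real.pi * y * ξ ≤ |2 * Real.pi * y * ξ| := le_abs_self _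
            _ = 2 * Real.pi * |y| * |ξ| := by
              rw [abs_mul, abs_mul, abs_of_pos Real.two_pi_pos]
            _ ≤ _ := by gcongr
        have h3 : Real.pi / A * y ^ 2 ≤ Real.pi / A * Y ^ 2 := by gcongr
        linarith)
    have hF : 𝓕 (f : ℝ → ℂ) ξ = ∫ x : ℝ, H x := by
      rw [Real.fourier_real_eq_integral_exp_smul]
      congr 1
      funext x
      simp only [hf, hH, smul_eq_mul]
      push_cast
      rfl
    rw [hF, hshift]
    have e : ∀ x : ℝ, C * Real.exp (-η * x ^ 2 + Real.pi / A * Y ^ 2 + 2 * Real.pi * Y * ξ) =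
        C * Real.exp (-(A * Real.pi) * ξ ^ 2) * Real.exp (-η * x ^ 2) := by
      intro x
      rw [mul_assoc C, ← Real.exp_add]
      congr 2
      simp only [Y]
      field_simp
      ring
    refine (MeasureTheory.norm_integral_le_of_norm_le
      ((integrable_exp_neg_mul_sq hη).const_mul (C * Real.exp (-(A * Real.pi) * ξ ^ 2)))
      (.of_forall fun x => (hHn x Y).trans (le_of_eq (e x)))).trans (le_of_eq ?_)
    rw [MeasureTheory.integral_const_mul]
    ring

/-! ### Entire functions with prescribed sparse zeros -/

/-- A set of positive points whose squares are separated fits into an interlacing sequence. -/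
lemma exists_interlaced {T : Set ℝ} {D : ℝ} (hD : 0 < D) (hpos : ∀ x ∈ T, 0 < x)
    (hbig : ∀ x ∈ T, D ≤ x ^ 2) (hsep : ∀ x ∈ T, ∀ y ∈ T, x ≠ y → D ≤ |x ^ 2 - y ^ 2|) :
    ∃ t, Interlaced t ∧ ∀ x ∈ T, ∃ k, t k = √D / x := by
  classical
  set cell : ℕ → ℝ → Prop := fun k x => x ∈ T ∧ (k + 1) * D ≤ x ^ 2 ∧ x ^ 2 < (k + 2) * D with hcell
  -- A half-open cell of length `D` holds at most one square, by separation, so the choice is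
  -- forced; empty cells receive the lattice value.
  set t : ℕ → ℝ := fun k => if h : ∃ x, cell k x then √D / h.choose else recipSqrt k with ht
  refine ⟨t, fun k => ?_, fun x hx => ?_⟩
  · simp only [ht]
    split_ifs with h
    · obtain ⟨h0, h1, h2⟩ := h.choose_spec
      have hp := hpos _ h0
      unfold recipSqrt
      constructor
      · rw [div_le_div_iff₀ (by positivity) hp, one_mul, ← Real.sqrt_mul hD.le]
        refine Real.le_sqrt_of_sq_le ?_
        push_cast
        linarith
      · rw [div_le_div_iff₀ hp (by positivity), one_mul, ← Real.sqrt_mul hD.le]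
        refine Real.sqrt_le_iff.2 ⟨hp.le, ?_⟩
        linarith
    · exact ⟨recipSqrt_antitone k.le_succ, le_rfl⟩
  · have h1 : 1 ≤ x ^ 2 / D := (one_le_div hD).2 (hbig x hx)
    have hf1 : 1 ≤ ⌊x ^ 2 / D⌋₊ := Nat.le_floor (by exact_mod_cast h1)
    -- The cells start at `D`, so the index is the floor minus one; `D ≤ x²` makes this legitimate.
    obtain ⟨k, hk⟩ := Nat.exists_eq_add_of_le' hf1
    have hl := Nat.floor_le (zero_le_one.trans h1)
    have hu := Nat.lt_floor_add_one (x ^ 2 / D)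
    rw [hk] at hl hu
    push_cast at hl hu
    rw [le_div_iff₀ hD] at hl
    rw [div_lt_iff₀ hD] at hu
    have hc : cell k x := ⟨hx, hl, by linarith⟩
    have hex : ∃ x, cell k x := ⟨x, hc⟩
    refine ⟨k, ?_⟩
    simp only [ht, dif_pos hex]
    obtain ⟨g0, g1, g2⟩ := hex.choose_spec
    congr 1
    by_contra hne
    have := hsep _ g0 x hx hne
    rw [le_abs] at this
    rcases this with h | h <;> linarith [hc.2.2]

lemma canonProd_ofReal_im {t s : ℕ → ℝ} (ht : Interlaced t) (hs : Interlaced s) (x : ℝ) :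
    (canonProd t s x).im = 0 := by
  have h := (Complex.continuous_im.tendsto _).comp (tendsto_canonProd ht hs x)
  refine tendsto_nhds_unique h (tendsto_const_nhds.congr fun N => ?_)
  have : ∏ k ∈ Finset.range N, (1 + canonTerm t s k x) = ((∏ k ∈ Finset.range N,
      ((1 - x * t k) * (1 + x * s k) * (1 + x ^ 2 * recipSqrt k ^ 2)) : ℝ) : ℂ) := by
    rw [Complex.ofReal_prod]
    refine Finset.prod_congr rfl fun k _ => ?_
    rw [one_add_canonTerm]
    push_cast
    rfl
  simp only [Function.comp]
  rw [this, Complex.ofReal_im]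

/-- A real entire function of order two, of prescribed type, vanishing on a given set of reals
whose squares are separated. -/
lemma exists_entire_vanishing {S : Set ℝ} {E : Finset ℝ} {D ε : ℝ} (hD : 0 < D) (hε : 0 < ε)
    (hbig : ∀ x ∈ S, x ∉ E → D ≤ x ^ 2)
    (hsep : ∀ x ∈ S, ∀ y ∈ S, x ∉ E → y ∉ E → 0 < x * y → x ≠ y → D ≤ |x ^ 2 - y ^ 2|) :
    ∃ P : ℂ → ℂ, Differentiable ℂ P ∧ (∀ x ∈ S, P x = 0) ∧ (∀ x : ℝ, (P x).im = 0) ∧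
      (∀ x : ℝ, 0 < x → x < √D → x ∉ E → P x ≠ 0) ∧ ∃ C, 0 ≤ C ∧ ∀ z : ℂ,
        ‖P z‖ ≤ C * Real.exp (2 * (Real.pi / D) * |z.re * z.im| + ε * ‖z‖ ^ 2) := by
  have hpi := Real.pi_pos
  have hsD : 0 < √D := Real.sqrt_pos.2 hD
  have hsD2 : √D ^ 2 = D := Real.sq_sqrt hD.le
  obtain ⟨t, ht, htz⟩ := exists_interlaced (T := {x | x ∈ S ∧ x ∉ E ∧ 0 < x}) hD
    (fun x hx => hx.2.2) (fun x hx => hbig x hx.1 hx.2.1)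
    (fun x hx y hy hne => hsep x hx.1 y hy.1 hx.2.1 hy.2.1 (mul_pos hx.2.2 hy.2.2) hne)
  obtain ⟨s, hs, hsz⟩ := exists_interlaced (T := {x | -x ∈ S ∧ -x ∉ E ∧ 0 < x}) hD
    (fun x hx => hx.2.2) (fun x hx => by simpa using hbig (-x) hx.1 hx.2.1)
    (fun x hx y hy hne => by
      have := hsep (-x) hx.1 (-y) hy.1 hx.2.1 hy.2.1 (by
        rw [neg_mul_neg]; exact mul_pos hx.2.2 hy.2.2) (fun h => hne (neg_injective h))
      simpa using this)
  -- The finitely many exceptional points, where separation may fail, are removed by a polynomial.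
  -- It costs half of `ε`; the other half absorbs the term linear in `|Re z|` in the growth of the
  -- canonical product.
  set p : ℂ → ℂ := fun z => ∏ e ∈ E, (z - (e : ℂ)) with hp
  obtain ⟨K, hK0, hK⟩ := exists_norm_prod_sub_le E (fun e : ℝ => (e : ℂ)) (half_pos hε)
  set P : ℂ → ℂ := fun z => p z * canonProd t s (z / √D) with hP
  have hdiv : ∀ x : ℝ, (x : ℂ) / √D = ((x / √D : ℝ) : ℂ) := fun x => by push_cast; rfl
  have hpx : ∀ x : ℝ, p x = ((∏ e ∈ E, (x - e) : ℝ) : ℂ) := fun x => by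
    simp only [hp]; push_cast; rfl
  refine ⟨P, ?_, fun x hx => ?_, fun x => ?_, fun x h0 h1 hxE => ?_, ?_⟩
  · have h1 : Differentiable ℂ p := by simp only [hp]; fun_prop
    exact h1.mul ((differentiable_canonProd ht hs).comp (differentiable_id.div_const _))
  · simp only [hP, mul_eq_zero]
    by_cases hxE : x ∈ E
    · left
      exact Finset.prod_eq_zero hxE (sub_self _)
    · right
      have hx0 : x ≠ 0 := by
        rintro rfl
        have := hbig 0 hx hxE
        norm_num at this
        linarith
      rw [hdiv]
      rcases lt_or_gt_of_ne hx0 with h | h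
      · obtain ⟨k, hk⟩ := hsz (-x) ⟨by simpa using hx, by simpa using hxE, by linarith⟩
        refine canonProd_eq_zero_of k ?_
        rw [one_add_canonTerm, hk, ← Complex.ofReal_mul, ← Complex.ofReal_mul]
        have : x / √D * (√D / -x) = -1 := by field_simp
        rw [this]; simp
      · obtain ⟨k, hk⟩ := htz x ⟨hx, hxE, h⟩
        refine canonProd_eq_zero_of k ?_
        rw [one_add_canonTerm, hk, ← Complex.ofReal_mul]
        have : x / √D * (√D / x) = 1 := by field_simp
        rw [this]; simp
  · simp only [hP]
    rw [hdiv, hpx, Complex.im_ofReal_mul, canonProd_ofReal_im ht hs, mul_zero]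
  · simp only [hP]
    have hu1 : x / √D < 1 := (div_lt_one hsD).2 h1
    have hu0 : 0 < x / √D := by positivity
    refine mul_ne_zero ?_ ?_
    · rw [hpx, Complex.ofReal_ne_zero]
      exact Finset.prod_ne_zero_iff.2 fun e he h => hxE (by rw [sub_eq_zero.1 h]; exact he)
    · rw [hdiv]
      refine canonProd_ne_zero ht hs fun k => one_add_canonTerm_ne_zero hs (by simpa using hu0) ?_
      intro h
      have h2 : x / √D * t k = 1 := by exact_mod_cast (sub_eq_zero.1 h).symm
      have h3 := (ht k).2.trans (recipSqrt_le_one k)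
      nlinarith [ht.pos k]
  · set L := 2 * Real.pi / √D with hL
    refine ⟨K * (4 * Real.exp (2 * Real.pi + L ^ 2 / (4 * (ε / 2)))), by positivity, fun z => ?_⟩
    have h1 := norm_canonProd_le ht hs (z / √D)
    have hre : (z / √D).re = z.re / √D := Complex.div_ofReal_re _ _
    have him : (z / √D).im = z.im / √D := Complex.div_ofReal_im _ _
    rw [hre, him] at h1
    have e1 : z.re / √D * (z.im / √D) = z.re * z.im / D := by
      rw [div_mul_div_comm, ← sq, hsD2]
    rw [e1, abs_div, abs_div, abs_of_pos hsD, abs_of_pos hD] at h1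
    have h2 : 2 * Real.pi * (|z.re| / √D + 1) ≤
        2 * Real.pi + L ^ 2 / (4 * (ε / 2)) + ε / 2 * ‖z‖ ^ 2 := by
      have l1 := linear_le_sq (half_pos hε) L ‖z‖
      have l2 : L * |z.re| ≤ L * ‖z‖ :=
        mul_le_mul_of_nonneg_left (Complex.abs_re_le_norm z) (by positivity)
      have l3 : 2 * Real.pi * (|z.re| / √D + 1) = L * |z.re| + 2 * Real.pi := by
        rw [hL]; field_simp
      linarith
    simp only [hP, norm_mul]
    calc ‖p z‖ * ‖canonProd t s (z / √D)‖
        ≤ (K * Real.exp (ε / 2 * ‖z‖ ^ 2)) * (4 * Real.exp (2 * Real.pi * (|z.re| / √D + 1) +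
          2 * Real.pi * (|z.re * z.im| / D))) := by gcongr; exact hK z
      _ ≤ (K * Real.exp (ε / 2 * ‖z‖ ^ 2)) * (4 * Real.exp (2 * Real.pi +
          L ^ 2 / (4 * (ε / 2)) + ε / 2 * ‖z‖ ^ 2 + 2 * Real.pi * (|z.re * z.im| / D))) := by gcongr
      _ = K * (4 * Real.exp (2 * Real.pi + L ^ 2 / (4 * (ε / 2)))) *
          Real.exp (2 * (Real.pi / D) * |z.re * z.im| + ε * ‖z‖ ^ 2) := by
        have e : 2 * Real.pi + L ^ 2 / (4 * (ε / 2)) + ε / 2 * ‖z‖ ^ 2 +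
            2 * Real.pi * (|z.re * z.im| / D) + ε / 2 * ‖z‖ ^ 2 =
            (2 * Real.pi + L ^ 2 / (4 * (ε / 2))) +
            (2 * (Real.pi / D) * |z.re * z.im| + ε * ‖z‖ ^ 2) := by ring
        calc _ = K * (4 * (Real.exp (2 * Real.pi + L ^ 2 / (4 * (ε / 2)) + ε / 2 * ‖z‖ ^ 2 +
            2 * Real.pi * (|z.re * z.im| / D)) * Real.exp (ε / 2 * ‖z‖ ^ 2))) := by ring
          _ = _ := by rw [← Real.exp_add, e, Real.exp_add]; ring

/-! ### Sharpness: the weight, the separation and the counterexample -/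

/-- Below the threshold there is an admissible Gaussian weight. -/
lemma exists_gaussian_weight {A b : ℝ} (hA0 : 0 < A) (hA1 : A < 1) (hb0 : 0 < b)
    (hb : b < Real.pi * pauliConst A / 4) :
    ∃ a, Real.pi * A < a ∧ b ^ 2 < a * (Real.pi / A - a) := by
  have hpi := Real.pi_pos
  unfold pauliConst at hb
  split_ifs at hb with h
  -- The maximiser of `a (π/A - a)`; it exceeds `πA` exactly because `A < 1/√2`.
  · refine ⟨Real.pi / (2 * A), ?_, ?_⟩
    · rw [lt_div_iff₀ (by positivity)]
      have h2 : A ^ 2 < 1 / 2 := by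
        have : A ^ 2 < (1 / √2) ^ 2 := by gcongr
        rwa [div_pow, Real.sq_sqrt zero_le_two, one_pow] at this
      nlinarith
    · have e : Real.pi / (2 * A) * (Real.pi / A - Real.pi / (2 * A)) = (Real.pi / (2 * A)) ^ 2 := by
        field_simp; ring
      rw [e]
      have e2 : Real.pi * (2 / A) / 4 = Real.pi / (2 * A) := by field_simp; ring
      rw [e2] at hb
      gcongr
  · have hs2 : √(1 - A ^ 2) ^ 2 = 1 - A ^ 2 := Real.sq_sqrt (by nlinarith)
    have h1 : b ^ 2 < Real.pi * A * (Real.pi / A - Real.pi * A) := by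
      have e : Real.pi * A * (Real.pi / A - Real.pi * A) = (Real.pi * √(1 - A ^ 2)) ^ 2 := by
        rw [mul_pow, hs2]; field_simp
      rw [e]
      have : b < Real.pi * √(1 - A ^ 2) := by linarith
      gcongr
    -- Here the supremum over `a > πA` is approached at the excluded endpoint, so `a` is taken
    -- slightly larger, by continuity.
    have hc : Continuous fun a : ℝ => a * (Real.pi / A - a) := by fun_prop
    have hev : ∀ᶠ a in nhdsWithin (Real.pi * A) (Set.Ioi (Real.pi * A)),
        b ^ 2 < a * (Real.pi / A - a) :=
      (hc.continuousAt.eventually_const_lt h1).filter_mono nhdsWithin_le_nhds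
    obtain ⟨a, ha2, ha1⟩ := (hev.and self_mem_nhdsWithin).exists
    exact ⟨a, ha1, ha2⟩

/-- The hypothesis is the discriminant condition making `a x² - 2b|xy| + (π/A - a) y²` positive
definite. Definiteness is open, which leaves room for `ε`: both for the `ε|z|²` in the growth of the
product and for horizontal decay. -/
lemma exists_quadratic_slack {A a b : ℝ} (hA0 : 0 < A) (hb0 : 0 < b) (ha : Real.pi * A < a)
    (hab : b ^ 2 < a * (Real.pi / A - a)) :
    ∃ ε, 0 < ε ∧ ε ≤ a - Real.pi * A ∧ ∀ x y : ℝ,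
      -a * (x ^ 2 - y ^ 2) + 2 * b * |x * y| + ε * (x ^ 2 + y ^ 2) ≤
        -ε * x ^ 2 + Real.pi / A * y ^ 2 := by
  have hpi := Real.pi_pos
  have ha0 : 0 < a := lt_trans (by positivity) ha
  set m := Real.pi / A - a with hm
  have hm0 : 0 < m := by
    by_contra hcon
    nlinarith [sq_nonneg b]
  -- Chosen so that `(a - 2ε)(m - ε) ≥ am - 2ε(a + m) ≥ b²` for `ε ≤ ε₀`.
  set ε₀ := (a * m - b ^ 2) / (2 * (a + m)) with hε₀
  have h0 : 0 < ε₀ := div_pos (by linarith) (by positivity)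
  have h1 : 2 * ε₀ * (a + m) = a * m - b ^ 2 := by rw [hε₀]; field_simp
  set ε := min ε₀ (a - Real.pi * A) with hε
  have hε0 : 0 < ε := lt_min h0 (by linarith)
  have hε1 : ε ≤ ε₀ := min_le_left _ _
  have h2 : 2 * ε * (a + m) ≤ a * m - b ^ 2 := by rw [← h1]; gcongr
  have hα : 0 < a - 2 * ε := by
    by_contra hcon
    nlinarith [mul_pos hε0 ha0, pow_pos hb0 2]
  have hdet : b ^ 2 ≤ (a - 2 * ε) * (m - ε) := by nlinarith [mul_pos hε0 hε0, mul_pos hε0 ha0]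
  refine ⟨ε, hε0, min_le_right _ _, fun x y => ?_⟩
  have key : 0 ≤ (a - 2 * ε) * ((a - 2 * ε) * x ^ 2 + (m - ε) * y ^ 2 - 2 * b * |x * y|) := by
    have e : (a - 2 * ε) * ((a - 2 * ε) * x ^ 2 + (m - ε) * y ^ 2 - 2 * b * |x * y|) =
        ((a - 2 * ε) * |x| - b * |y|) ^ 2 + ((a - 2 * ε) * (m - ε) - b ^ 2) * y ^ 2 := by
      rw [abs_mul]
      linear_combination (-(a - 2 * ε) ^ 2) * sq_abs x - b ^ 2 * sq_abs y
    rw [e]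
    have := mul_nonneg (sub_nonneg.2 hdet) (sq_nonneg y)
    positivity
  have key2 := nonneg_of_mul_nonneg_right key hα
  have : Real.pi / A = m + a := by rw [hm]; ring
  rw [this]
  nlinarith

namespace IsOrderedEnumeration

variable {Λ : Set ℝ} {l : ℤ → ℝ}

/-- Large weighted gaps separate the squares of far points. -/
lemma exists_sq_separation (h : IsOrderedEnumeration Λ l) {σ δ : ℝ} (hσ : 0 < σ)
    (hδσ : δ < 2 * σ) (htop : ∀ᶠ j in atTop, σ < |l j| * (l (j + 1) - l j))
    (hbot : ∀ᶠ j in atBot, σ < |l j| * (l (j + 1) - l j)) (R : ℝ) :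
    ∃ J : ℤ, 0 ≤ J ∧ (∀ j, J ≤ j → R ≤ l j ∧ l j ^ 2 + δ ≤ l (j + 1) ^ 2) ∧
      ∀ j, j ≤ -J → l j ≤ -R ∧ l j ^ 2 + δ ≤ l (j - 1) ^ 2 := by
  set R' := max (max R 1) (max δ (σ / (2 * σ - δ))) with hR'
  have r1 : R ≤ R' := (le_max_left _ _).trans (le_max_left _ _)
  have r2 : 1 ≤ R' := (le_max_right _ _).trans (le_max_left _ _)
  have r3 : δ ≤ R' := (le_max_left _ _).trans (le_max_right _ _)
  have r4 : σ / (2 * σ - δ) ≤ R' := (le_max_right _ _).trans (le_max_right _ _)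
  rw [div_le_iff₀ (by linarith)] at r4
  obtain ⟨J1, hJ1⟩ := eventually_atTop.1 (htop.and (h.tendsto_atTop.eventually_ge_atTop R'))
  obtain ⟨J2, hJ2⟩ := eventually_atBot.1 (hbot.and (h.tendsto_atBot.eventually_le_atBot (-R')))
  refine ⟨max 0 (max J1 (-J2)), le_max_left _ _, fun j hj => ?_, fun j hj => ?_⟩
  · obtain ⟨h1, h2⟩ := hJ1 j (by omega)
    refine ⟨r1.trans h2, ?_⟩
    have hd : 0 < l (j + 1) - l j := sub_pos.2 (h.strictMono (lt_add_one j))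
    rw [abs_of_pos (by linarith)] at h1
    nlinarith
  · obtain ⟨h1, h2⟩ := hJ2 (j - 1) (by omega)
    obtain ⟨_, h3⟩ := hJ2 j (by omega)
    refine ⟨by linarith, ?_⟩
    rw [sub_add_cancel] at h1
    have hd : 0 < l j - l (j - 1) := sub_pos.2 (h.strictMono (by omega))
    rw [abs_of_neg (by linarith)] at h1
    set d := l j - l (j - 1) with hddef
    have e : l j = l (j - 1) + d := by rw [hddef]; ring
    set u := -l (j - 1) with hu
    have e2 : l (j - 1) = -u := by rw [hu]; ring
    rw [e, e2]
    have hq : R' ≤ u - d := by linarith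
    -- At the negative end the weight sits on the outer point of the gap, and the squares grow by
    -- `2ud - d²`. For `d ≥ 1` this exceeds `R' ≥ δ`; for `d < 1` the loss against `2σ` is covered
    -- by `σ/R' ≤ 2σ - δ`.
    by_cases hd1 : 1 ≤ d
    · nlinarith
    · push Not at hd1
      nlinarith

end IsOrderedEnumeration

lemma add_mul_le_of_step {q : ℤ → ℝ} {δ : ℝ} {J : ℤ} (h : ∀ j, J ≤ j → q j + δ ≤ q (j + 1))
    {j : ℤ} (hj : J ≤ j) (n : ℕ) : q j + n * δ ≤ q (j + n) := by
  induction n with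
  | zero => simp
  | succ n ih =>
    have := h (j + n) (by omega)
    push_cast
    rw [← add_assoc]
    linarith

/-- Distinct indices of equal parity differ by at least two, so splitting by parity doubles the
separation. -/
lemma le_abs_sub_of_step {q : ℤ → ℝ} {δ : ℝ} (hδ : 0 < δ) {J : ℤ}
    (h : ∀ j, J ≤ j → q j + δ ≤ q (j + 1)) {i j : ℤ} (hi : J ≤ i) (hj : J ≤ j) (hne : i ≠ j)
    (hpar : i % 2 = j % 2) : 2 * δ ≤ |q i - q j| := by
  have aux : ∀ {i j : ℤ}, J ≤ i → i < j → i % 2 = j % 2 → 2 * δ ≤ |q i - q j| := by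
    intro i j hi hlt hpar
    obtain ⟨n, hn⟩ := Int.eq_ofNat_of_zero_le (sub_nonneg.2 hlt.le)
    have h1 := add_mul_le_of_step h hi n
    have h2 : i + n = j := by omega
    have h3 : (2 : ℝ) ≤ n := by exact_mod_cast (by omega : 2 ≤ n)
    rw [h2] at h1
    rw [abs_sub_comm]
    refine le_trans ?_ (le_abs_self _)
    nlinarith
  rcases lt_or_gt_of_ne hne with hlt | hlt
  · exact aux hi hlt hpar
  · rw [abs_sub_comm]
    exact aux hj hlt hpar.symm

/-- Non-uniqueness for the modulus from sparse samples. -/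
theorem exists_norm_ne_of_lt_liminfSpacing {A : ℝ} (hA0 : 0 < A) (hA1 : A < 1) {Λ : Set ℝ}
    {l : ℤ → ℝ} (hl : IsOrderedEnumeration Λ l)
    (hlim : ((1 / pauliConst A : ℝ) : EReal) < liminfSpacing l) :
    ∃ f ∈ HardyClass A A, ∃ g ∈ HardyClass A A,
      (∀ x ∈ Λ, ‖f x‖ = ‖g x‖) ∧ ¬ ∀ x : ℝ, ‖f x‖ = ‖g x‖ := by
  have hc := pauliConst_pos hA0 hA1
  have hpi := Real.pi_pos
  obtain ⟨σ, hσ1, hσ2⟩ := EReal.lt_iff_exists_real_btwn.1 hlim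
  have hσ1 : 1 / pauliConst A < σ := by exact_mod_cast hσ1
  have hev := eventually_lt_of_lt_liminf hσ2
  rw [eventually_sup] at hev
  have hc1 : 0 < 1 / pauliConst A := by positivity
  have hσ0 : 0 < σ := hc1.trans hσ1
  -- Strictly between `2/c₁(A)` and `2σ`: the squares eventually advance by `δ`, and `D = 2δ >
  -- 4/c₁(A)` is the separation within a parity class.
  set δ := σ + 1 / pauliConst A with hδ
  have hδ0 : 0 < δ := by positivity
  set D := 2 * δ with hD
  have hD0 : 0 < D := by positivity
  -- The radius `D + 1` makes the squares of all far points at least `D`, so the cells can hold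
  -- them.
  obtain ⟨J, hJ0, hJ1, hJ2⟩ := hl.exists_sq_separation (δ := δ) hσ0 (by linarith)
    (hev.2.mono fun j hj => by exact_mod_cast hj) (hev.1.mono fun j hj => by exact_mod_cast hj)
    (D + 1)
  set E : Finset ℝ := (Finset.Icc (-J) J).image l with hE
  have hout : ∀ j, l j ∉ E → J < j ∨ j < -J := by
    intro j hj
    by_contra hcon
    push Not at hcon
    exact hj (Finset.mem_image_of_mem _ (Finset.mem_Icc.2 ⟨hcon.2, hcon.1⟩))
  have hneg : ∀ j, -(-J) ≤ j → l (-j) ^ 2 + δ ≤ l (-(j + 1)) ^ 2 := by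
    intro j hj
    have := (hJ2 (-j) (by omega)).2
    rwa [show -j - 1 = -(j + 1) by ring] at this
  have hposj : ∀ j, J < j → D + 1 ≤ l j := fun j hj => (hJ1 j hj.le).1
  have hnegj : ∀ j, j < -J → l j ≤ -(D + 1) := fun j hj => (hJ2 j hj.le).1
  set b := Real.pi / D with hb
  have hbc : b < Real.pi * pauliConst A / 4 := by
    rw [hb, div_lt_div_iff₀ hD0 (by norm_num)]
    have h1 : 4 * (1 / pauliConst A) < D := by linarith
    have h2 : 4 < pauliConst A * D := by
      have := mul_lt_mul_of_pos_left h1 hc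
      rwa [mul_left_comm, mul_one_div_cancel hc.ne', mul_one] at this
    nlinarith
  obtain ⟨a, ha1, ha2⟩ := exists_gaussian_weight hA0 hA1 (by positivity) hbc
  obtain ⟨ε, hε0, hε1, hε2⟩ := exists_quadratic_slack hA0 (by positivity) ha1 ha2
  have hcons : ∀ r : ℤ, ∃ P : ℂ → ℂ, Differentiable ℂ P ∧ (∀ j : ℤ, j % 2 = r → P (l j) = 0) ∧
      (∀ x : ℝ, (P x).im = 0) ∧ (∀ x : ℝ, 0 < x → x < √D → x ∉ E → P x ≠ 0) ∧ ∃ C, 0 ≤ C ∧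
        ∀ z : ℂ, ‖P z‖ ≤ C * Real.exp (2 * (Real.pi / D) * |z.re * z.im| + ε * ‖z‖ ^ 2) := by
    intro r
    obtain ⟨P, h1, h2, h3⟩ := exists_entire_vanishing (S := l '' {j | j % 2 = r}) (E := E) hD0 hε0
      (by
        rintro _ ⟨j, _, rfl⟩ hj
        rcases hout j hj with h | h
        · nlinarith [hposj j h]
        · nlinarith [hnegj j h])
      (by
        rintro _ ⟨i, hi, rfl⟩ _ ⟨j, hj, rfl⟩ hiE hjE hij hne
        have hne' : i ≠ j := fun h => hne (by rw [h])
        have hpar : i % 2 = j % 2 := hi.trans hj.symm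
        rcases hout i hiE with h | h <;> rcases hout j hjE with h' | h'
        · exact le_abs_sub_of_step (q := fun j => l j ^ 2) hδ0 (fun j hj => (hJ1 j hj).2)
            h.le h'.le hne' hpar
        · nlinarith [hposj i h, hnegj j h']
        · nlinarith [hposj j h', hnegj i h]
        · have := le_abs_sub_of_step (q := fun j => l (-j) ^ 2) hδ0 hneg (i := -i) (j := -j)
            (by omega) (by omega) (by omega) (by omega)
          simpa using this)
    exact ⟨P, h1, fun j hj => h2 _ ⟨j, hj, rfl⟩, h3⟩
  have hgauss : ∀ {P : ℂ → ℂ} {C : ℝ}, 0 ≤ C → (∀ z : ℂ, ‖P z‖ ≤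
      C * Real.exp (2 * (Real.pi / D) * |z.re * z.im| + ε * ‖z‖ ^ 2)) →
      (∀ x y : ℝ, ‖Complex.exp (-a * (x + y * Complex.I) ^ 2) * P (x + y * Complex.I)‖ ≤
        C * Real.exp (-ε * x ^ 2 + Real.pi / A * y ^ 2)) ∧
      ∀ x : ℝ, ‖Complex.exp (-a * (x : ℂ) ^ 2) * P x‖ ≤ C * Real.exp (-(A * Real.pi) * x ^ 2) := by
    intro P C hC hPb
    have hmain : ∀ x y : ℝ, ‖Complex.exp (-a * (x + y * Complex.I) ^ 2) * P (x + y * Complex.I)‖ ≤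
        C * Real.exp (-a * (x ^ 2 - y ^ 2) + 2 * b * |x * y| + ε * (x ^ 2 + y ^ 2)) := by
      intro x y
      have h1 := hPb (x + y * Complex.I)
      have e1 : ‖(x + y * Complex.I : ℂ)‖ ^ 2 = x ^ 2 + y ^ 2 := by
        rw [Complex.sq_norm, Complex.normSq_add_mul_I]
      have e2 : (-a * (x + y * Complex.I) ^ 2 : ℂ).re = -a * (x ^ 2 - y ^ 2) := by
        simp [sq]
      rw [e1] at h1
      simp only [Complex.add_re, Complex.ofReal_re, Complex.mul_re, Complex.I_re, mul_zero,
        Complex.ofReal_im, Complex.I_im, mul_one, sub_self, add_zero, Complex.add_im,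
        Complex.mul_im, zero_add] at h1
      rw [norm_mul, Complex.norm_exp, e2]
      calc _ ≤ Real.exp (-a * (x ^ 2 - y ^ 2)) *
            (C * Real.exp (2 * (Real.pi / D) * |x * y| + ε * (x ^ 2 + y ^ 2))) := by gcongr
        _ = C * (Real.exp (-a * (x ^ 2 - y ^ 2)) *
            Real.exp (2 * (Real.pi / D) * |x * y| + ε * (x ^ 2 + y ^ 2))) := by ring
        _ = _ := by rw [← Real.exp_add, ← add_assoc]
    refine ⟨fun x y => (hmain x y).trans ?_, fun x => ?_⟩
    · exact mul_le_mul_of_nonneg_left (Real.exp_le_exp.2 (hε2 x y)) hC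
    · have := hmain x 0
      simp only [Complex.ofReal_zero, zero_mul, add_zero] at this
      refine this.trans ?_
      refine mul_le_mul_of_nonneg_left (Real.exp_le_exp.2 ?_) hC
      have : 0 ≤ (a - Real.pi * A - ε) * x ^ 2 :=
        mul_nonneg (by linarith) (sq_nonneg x)
      simp
      nlinarith
  obtain ⟨P, hPd, hP0, hPr, hPn, C, hC, hPb⟩ := hcons 0
  obtain ⟨Q, hQd, hQ0, hQr, hQn, C', hC', hQb⟩ := hcons 1
  obtain ⟨hP1, hP2⟩ := hgauss hC hPb
  obtain ⟨hQ1, hQ2⟩ := hgauss hC' hQb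
  set w : ℂ → ℂ := fun z => Complex.exp (-a * z ^ 2) with hw
  have hwd : Differentiable ℂ w := by simp only [hw]; fun_prop
  obtain ⟨f, hf, hfx⟩ := exists_hardyClass_of_entire (U := fun z => w z * P z + w z * Q z)
    (C := C + C') ((hwd.mul hPd).add (hwd.mul hQd)) hA0 hε0 (by positivity)
    (fun x y => (norm_add_le _ _).trans (by rw [add_mul]; exact add_le_add (hP1 x y) (hQ1 x y)))
    (fun x => (norm_add_le _ _).trans (by rw [add_mul]; exact add_le_add (hP2 x) (hQ2 x)))
  obtain ⟨g, hg, hgx⟩ := exists_hardyClass_of_entire (U := fun z => w z * P z - w z * Q z)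
    (C := C + C') ((hwd.mul hPd).sub (hwd.mul hQd)) hA0 hε0 (by positivity)
    (fun x y => (norm_sub_le _ _).trans (by rw [add_mul]; exact add_le_add (hP1 x y) (hQ1 x y)))
    (fun x => (norm_sub_le _ _).trans (by rw [add_mul]; exact add_le_add (hP2 x) (hQ2 x)))
  refine ⟨f, hf, g, hg, ?_, ?_⟩
  · rw [← hl.range_eq]
    rintro _ ⟨j, rfl⟩
    rw [hfx, hgx]
    rcases Int.emod_two_eq_zero_or_one j with h | h
    · rw [hP0 j h]; simp
    · rw [hQ0 j h]; simp
  · intro hall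
    -- At such a point neither `P` nor `Q` vanishes, while equal moduli would force `|P + Q| = |P -
    -- Q|`, that is `P Q = 0` for real values.
    obtain ⟨x, hx, hxE⟩ := (Set.Ioo_infinite (Real.sqrt_pos.2 hD0)).exists_notMem_finset E
    have h1 := hall x
    rw [hfx, hgx, ← mul_add, ← mul_sub, norm_mul, norm_mul] at h1
    have h2 := mul_left_cancel₀ (norm_ne_zero_iff.2 (Complex.exp_ne_zero _)) h1
    have hPx : P x = ((P x).re : ℂ) := Complex.ext rfl (by simpa using hPr x)
    have hQx : Q x = ((Q x).re : ℂ) := Complex.ext rfl (by simpa using hQr x)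
    have hP' := hPn x hx.1 hx.2 hxE
    have hQ' := hQn x hx.1 hx.2 hxE
    rw [hPx, Complex.ofReal_ne_zero] at hP'
    rw [hQx, Complex.ofReal_ne_zero] at hQ'
    rw [hPx, hQx, ← Complex.ofReal_add, ← Complex.ofReal_sub, Complex.norm_real, Complex.norm_real,
      Real.norm_eq_abs, Real.norm_eq_abs, ← sq_eq_sq₀ (abs_nonneg _) (abs_nonneg _), sq_abs,
      sq_abs] at h2
    have h3 : (P x).re * (Q x).re = 0 := by linarith
    exact (mul_ne_zero hP' hQ') h3

theorem mainTheorem1 (A : ℝ) (hA0 : 0 < A) (hA1 : A < 1) :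
    (∀ f ∈ HardyClass A A, ∀ g ∈ HardyClass A A,
      ∀ (Λ : Set ℝ) (l : ℤ → ℝ), IsOrderedEnumeration Λ l →
        limsupSpacing l < ((1 / pauliConst A : ℝ) : EReal) →
        (∀ x ∈ Λ, ‖f x‖ = ‖g x‖) →
        ∀ x : ℝ, ‖f x‖ = ‖g x‖) ∧
    (∀ (Λ : Set ℝ) (l : ℤ → ℝ), IsOrderedEnumeration Λ l →
        ((1 / pauliConst A : ℝ) : EReal) < liminfSpacing l →
        ∃ f ∈ HardyClass A A, ∃ g ∈ HardyClass A A,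
          (∀ x ∈ Λ, ‖f x‖ = ‖g x‖) ∧ ¬ ∀ x : ℝ, ‖f x‖ = ‖g x‖) := by
  exact ⟨fun _ hf _ hg _ _ hl hlim hfg => norm_eq_of_limsupSpacing_lt hA0 hA1 hf hg hl hlim hfg,
    fun _ _ hl hlim => exists_norm_ne_of_lt_liminfSpacing hA0 hA1 hl hlim⟩
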